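/- Let $\Omega\subset\mathbb R^n$ be a bounded, open, connected, nonempty set with $C^1$ boundary $\Gamma=\partial\Omega$. Let $H\in C(\overline\Omega\times\mathbb R^n)$, $g\in C(\Gamma)$ and $\gamma\in C(\Gamma,\mathbb R^n)$ be such that, for every $x\in\overline\Omega$, $H(x,\cdot)$ is convex and $\lim_{|p|\to\infty}H(x,p)=\infty$, and such that $\nu(x)\cdot\gamma(x)>0$ for every $x\in\Gamma$, where $\nu(x)$ is the outer unit normal. For $a\in\mathbb R$ consider the problem $$(\mathrm{P}_a)\qquad H(x,Du(x))=a\ \text{ in }\Omega,\qquad \gamma(x)\cdot Du(x)=g(x)\ \text{ on }\Gamma .$$ A function $u:\overline\Omega\to\mathbb R$ is a *subsolution* (resp. *supersolution*) of $(\mathrm{P}_a)$ if it is bounded above (resp. below) and, whenever $\phi\in C^1(\overline\Omega)$, $x\in\overline\Omega$ and $u^*-\phi$ attains a maximum (resp. $u_*-\phi$ attains a minimum) over $\overline\Omega$ at $x$, one has $H(x,D\phi(x))\le a$ (resp. $\ge a$) if $x\in\Omega$, and $H(x,D\phi(x))\le a$ or $\gamma(x)\cdot D\phi(x)\le g(x)$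 (resp. $H(x,D\phi(x))\ge a$ or $\gamma(x)\cdot D\phi(x)\ge g(x)$) if $x\in\Gamma$. Here $u^*$ and $u_*$ are the upper and lower semicontinuous envelopes of $u$ on $\overline\Omega$. A *solution* is a function that is both a subsolution and a supersolution. Assume the normalization $$\inf\{a\in\mathbb R:\ (\mathrm{P}_a)\text{ has a subsolution}\}=0 .$$ For $x,y\in\overline\Omega$ put $$d(x,y)=\sup\{v(x)-v(y):\ v\text{ is an upper semicontinuous subsolution of }(\mathrm{P}_0)\},$$ and let $\mathcal A=\{y\in\overline\Omega:\ d(\cdot,y)\text{ is a (real-valued) solution of }(\mathrm{P}_0)\}$ be the Aubry–Mather set. Let $L(x,\xi)=\sup_{p\in\mathbb R^n}(\xi\cdot p-H(x,p))\in(-\infty,\infty]$. Let $\mathrm{SP}$ be the set of triples $(\eta,v,l)$ such that $\eta:[0,\infty)\to\overline\Omega$ is absolutely continuous on bounded intervals, $v:[0,\infty)\to\mathbb R^n$ and $l:[0,\infty)\to\mathbb R$ are integrable on bounded intervals, and for a.e. $t\ge0$ $$\dot\eta(t)+l(t)\gamma(\eta(t))=v(t),\qquad l(t)\ge0,\qquad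 l(t)=0\ \text{ if }\eta(t)\in\Omega$$ (in particular the term $l\gamma(\eta)$, and likewise $g(\eta)l$, is read as $0$ where $\eta\in\Omega$ and $l=0$). The integral $\int_0^t\big(L(\eta(s),-v(s))+g(\eta(s))l(s)\big)\,ds$ is understood to be $+\infty$ if $s\mapsto L(\eta(s),-v(s))$ is not integrable on $(0,t)$. **Theorem.** Let $\tau>0$ and $y\in\overline\Omega$. Then $y\in\mathcal A$ if and only if $$\inf\Big\{\int_0^t\big(L(\eta(s),-v(s))+g(\eta(s))l(s)\big)\,ds:\ t>\tau,\ (\eta,v,l)\in\mathrm{SP},\ \eta(0)=\eta(t)=y\Big\}=0 .$$ -/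

import Mathlib

open Set Filter Topology MeasureTheory
open scoped RealInnerProductSpace Gradient

noncomputable section

namespace NeumannHJ

/-- `ψ` is a `C¹` local defining function of the set `Ω` near the point `x`: near `x`,
the set `Ω` is `{ψ < 0}`, and the gradient of `ψ` does not vanish at `x`. -/
structure IsLocalDefiningFunction {n : ℕ} (Ω : Set (EuclideanSpace ℝ (Fin n)))
    (x : EuclideanSpace ℝ (Fin n)) (ψ : EuclideanSpace ℝ (Fin n) → ℝ) : Prop where
  contDiffAt : ContDiffAt ℝ 1 ψ x
  gradient_ne_zero : ∇ ψ x ≠ 0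
  mem_iff : ∀ᶠ z in 𝓝 x, (z ∈ Ω ↔ ψ z < 0)

/-- The (open) set `Ω` has a `C¹` boundary. -/
def HasC1Boundary {n : ℕ} (Ω : Set (EuclideanSpace ℝ (Fin n))) : Prop :=
  ∀ x ∈ frontier Ω, ∃ ψ, IsLocalDefiningFunction Ω x ψ

/-- `ν` is the outer unit normal vector of `Ω` at the boundary point `x`. -/
def IsOuterUnitNormal {n : ℕ} (Ω : Set (EuclideanSpace ℝ (Fin n)))
    (x ν : EuclideanSpace ℝ (Fin n)) : Prop :=
  ∃ ψ, IsLocalDefiningFunction Ω x ψ ∧ ν = ‖∇ ψ x‖⁻¹ • ∇ ψ x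

/-- The vector field `γ` is oblique to the boundary of `Ω`. -/
def IsOblique {n : ℕ} (Ω : Set (EuclideanSpace ℝ (Fin n)))
    (γ : EuclideanSpace ℝ (Fin n) → EuclideanSpace ℝ (Fin n)) : Prop :=
  ∀ x ∈ frontier Ω, ∀ ν, IsOuterUnitNormal Ω x ν → 0 < ⟪ν, γ x⟫

/-- The upper semicontinuous envelope `u^*`, on `closure Ω`, of `u` restricted to `closure Ω`.
It is used only for functions bounded above on `closure Ω`, at points of `closure Ω`, where
this upper limit (which includes the point itself) is a genuine real number. -/
def uscEnvelope {n : ℕ} (Ω : Set (EuclideanSpace ℝ (Fin n)))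
    (u : EuclideanSpace ℝ (Fin n) → ℝ) (x : EuclideanSpace ℝ (Fin n)) : ℝ :=
  limsup u (𝓝[closure Ω] x)

/-- The lower semicontinuous envelope `u_*`, on `closure Ω`, of `u` restricted to `closure Ω`.
It is used only for functions bounded below on `closure Ω`, at points of `closure Ω`. -/
def lscEnvelope {n : ℕ} (Ω : Set (EuclideanSpace ℝ (Fin n)))
    (u : EuclideanSpace ℝ (Fin n) → ℝ) (x : EuclideanSpace ℝ (Fin n)) : ℝ :=
  liminf u (𝓝[closure Ω] x)

/-- `u` (restricted to `closure Ω`) is a viscosity subsolution of `H(x, Du) = a` in `Ω`,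
`γ · Du = g` on the boundary of `Ω`. -/
def IsSubsolution {n : ℕ} (Ω : Set (EuclideanSpace ℝ (Fin n)))
    (H : EuclideanSpace ℝ (Fin n) → EuclideanSpace ℝ (Fin n) → ℝ)
    (γ : EuclideanSpace ℝ (Fin n) → EuclideanSpace ℝ (Fin n))
    (g : EuclideanSpace ℝ (Fin n) → ℝ) (a : ℝ)
    (u : EuclideanSpace ℝ (Fin n) → ℝ) : Prop :=
  BddAbove (u '' closure Ω) ∧
    ∀ x ∈ closure Ω, ∀ φ : EuclideanSpace ℝ (Fin n) → ℝ, ContDiff ℝ 1 φ →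
      IsMaxOn (fun z => uscEnvelope Ω u z - φ z) (closure Ω) x →
        (x ∈ Ω → H x (∇ φ x) ≤ a) ∧
        (x ∈ frontier Ω → H x (∇ φ x) ≤ a ∨ ⟪γ x, ∇ φ x⟫ ≤ g x)

/-- `u` (restricted to `closure Ω`) is a viscosity supersolution of `H(x, Du) = a` in `Ω`,
`γ · Du = g` on the boundary of `Ω`. -/
def IsSupersolution {n : ℕ} (Ω : Set (EuclideanSpace ℝ (Fin n)))
    (H : EuclideanSpace ℝ (Fin n) → EuclideanSpace ℝ (Fin n) → ℝ)
    (γ : EuclideanSpace ℝ (Fin n) → EuclideanSpace ℝ (Fin n))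
    (g : EuclideanSpace ℝ (Fin n) → ℝ) (a : ℝ)
    (u : EuclideanSpace ℝ (Fin n) → ℝ) : Prop :=
  BddBelow (u '' closure Ω) ∧
    ∀ x ∈ closure Ω, ∀ φ : EuclideanSpace ℝ (Fin n) → ℝ, ContDiff ℝ 1 φ →
      IsMinOn (fun z => lscEnvelope Ω u z - φ z) (closure Ω) x →
        (x ∈ Ω → a ≤ H x (∇ φ x)) ∧
        (x ∈ frontier Ω → a ≤ H x (∇ φ x) ∨ g x ≤ ⟪γ x, ∇ φ x⟫)

/-- `u` is a viscosity solution: it is both a sub- and a supersolution (hence bounded). -/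
def IsSolution {n : ℕ} (Ω : Set (EuclideanSpace ℝ (Fin n)))
    (H : EuclideanSpace ℝ (Fin n) → EuclideanSpace ℝ (Fin n) → ℝ)
    (γ : EuclideanSpace ℝ (Fin n) → EuclideanSpace ℝ (Fin n))
    (g : EuclideanSpace ℝ (Fin n) → ℝ) (a : ℝ)
    (u : EuclideanSpace ℝ (Fin n) → ℝ) : Prop :=
  IsSubsolution Ω H γ g a u ∧ IsSupersolution Ω H γ g a u

/-- The critical value (additive eigenvalue): the infimum, in `[-∞, ∞]`, of the real numbers
`a` for which the boundary value problem has a subsolution. -/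
def criticalValue {n : ℕ} (Ω : Set (EuclideanSpace ℝ (Fin n)))
    (H : EuclideanSpace ℝ (Fin n) → EuclideanSpace ℝ (Fin n) → ℝ)
    (γ : EuclideanSpace ℝ (Fin n) → EuclideanSpace ℝ (Fin n))
    (g : EuclideanSpace ℝ (Fin n) → ℝ) : EReal :=
  sInf {e : EReal | ∃ a : ℝ, (∃ u, IsSubsolution Ω H γ g a u) ∧ e = (a : EReal)}

/-- The function `d(x, y)`: the supremum, in `[-∞, ∞]`, of `v x - v y` over the upper
semicontinuous subsolutions `v` of the problem with `a = 0`. -/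
def dist0 {n : ℕ} (Ω : Set (EuclideanSpace ℝ (Fin n)))
    (H : EuclideanSpace ℝ (Fin n) → EuclideanSpace ℝ (Fin n) → ℝ)
    (γ : EuclideanSpace ℝ (Fin n) → EuclideanSpace ℝ (Fin n))
    (g : EuclideanSpace ℝ (Fin n) → ℝ) (x y : EuclideanSpace ℝ (Fin n)) : EReal :=
  sSup {e : EReal | ∃ v : EuclideanSpace ℝ (Fin n) → ℝ,
    UpperSemicontinuousOn v (closure Ω) ∧ IsSubsolution Ω H γ g 0 v ∧
      e = ((v x - v y : ℝ) : EReal)}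

/-- The Aubry-Mather set: the points `y` of `closure Ω` for which `d(·, y)` is (real valued and)
a solution of the problem with `a = 0`. -/
def aubrySet {n : ℕ} (Ω : Set (EuclideanSpace ℝ (Fin n)))
    (H : EuclideanSpace ℝ (Fin n) → EuclideanSpace ℝ (Fin n) → ℝ)
    (γ : EuclideanSpace ℝ (Fin n) → EuclideanSpace ℝ (Fin n))
    (g : EuclideanSpace ℝ (Fin n) → ℝ) : Set (EuclideanSpace ℝ (Fin n)) :=
  {y | y ∈ closure Ω ∧ ∃ w : EuclideanSpace ℝ (Fin n) → ℝ,
    (∀ x ∈ closure Ω, dist0 Ω H γ g x y = (w x : EReal)) ∧ IsSolution Ω H γ g 0 w}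

/-- The triple `(η, v, l)`, of functions on `[0, ∞)`, solves the Skorokhod problem in
`closure Ω` with reflection direction `γ`. Values at negative times are irrelevant. -/
structure IsSkorokhodTriple {n : ℕ} (Ω : Set (EuclideanSpace ℝ (Fin n)))
    (γ : EuclideanSpace ℝ (Fin n) → EuclideanSpace ℝ (Fin n))
    (η v : ℝ → EuclideanSpace ℝ (Fin n)) (l : ℝ → ℝ) : Prop where
  ac : ∀ T : ℝ, 0 < T → AbsolutelyContinuousOnInterval η 0 T
  integrable_v : ∀ T : ℝ, 0 < T → IntervalIntegrable v volume 0 T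
  integrable_l : ∀ T : ℝ, 0 < T → IntervalIntegrable l volume 0 T
  mem_closure : ∀ t : ℝ, 0 ≤ t → η t ∈ closure Ω
  dynamics : ∀ᵐ t : ℝ, 0 < t → ∃ η' : EuclideanSpace ℝ (Fin n),
    HasDerivAt η η' t ∧ η' + l t • γ (η t) = v t
  l_nonneg : ∀ᵐ t : ℝ, 0 < t → 0 ≤ l t
  l_eq_zero : ∀ᵐ t : ℝ, 0 < t → η t ∈ Ω → l t = 0

/-- The Lagrangian `L(x, ξ) = sup_p (ξ · p - H(x, p))`, with values in `(-∞, ∞]`. -/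
def lagrangian {n : ℕ} (H : EuclideanSpace ℝ (Fin n) → EuclideanSpace ℝ (Fin n) → ℝ)
    (x ξ : EuclideanSpace ℝ (Fin n)) : EReal :=
  ⨆ p : EuclideanSpace ℝ (Fin n), ((⟪ξ, p⟫ - H x p : ℝ) : EReal)

open scoped Classical in
/-- The action `∫₀ᵗ (L(η, -v) + g(η) l) ds`, with value `+∞` whenever the extended real valued
function `s ↦ L(η(s), -v(s))` is not integrable on `(0, t)`, that is, unless it is finite almost
everywhere there with an integrable real version. -/
def action {n : ℕ} (H : EuclideanSpace ℝ (Fin n) → EuclideanSpace ℝ (Fin n) → ℝ)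
    (g : EuclideanSpace ℝ (Fin n) → ℝ) (η v : ℝ → EuclideanSpace ℝ (Fin n)) (l : ℝ → ℝ)
    (t : ℝ) : EReal :=
  if (∀ᵐ s : ℝ, s ∈ Ioo 0 t → lagrangian H (η s) (-v s) ≠ ⊤) ∧
      IntervalIntegrable (fun s => (lagrangian H (η s) (-v s)).toReal) volume 0 t then
    ((∫ s in (0 : ℝ)..t, ((lagrangian H (η s) (-v s)).toReal + g (η s) * l s) : ℝ) : EReal)
  else ⊤

end NeumannHJ

end

open Set Filter Topology MeasureTheory
open scoped RealInnerProductSpace Gradient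

noncomputable section

namespace NeumannHJ

variable {n : ℕ}

section

/-! ### Geometry of domains with `C¹` boundary -/

variable {Ω : Set (EuclideanSpace ℝ (Fin n))}
    {γ : EuclideanSpace ℝ (Fin n) → EuclideanSpace ℝ (Fin n)}

/-! Write S_τ(x) for the infimum of the costs of arcs from x to y of duration larger than τ
(`minAction`). A subsolution u satisfies u(η(s₀)) - u(η(s₁)) ≤ action along every arc of the
Skorokhod problem (`NeumannData.sub_le_action`), and a subsolution exists at the critical level
itself (`NeumannData.exists_critical_subsolution`). Hence every loop costs at least 0, and the
infimum vanishes exactly when there are arbitrarily cheap loops.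

Suppose d = d(·, y) is a solution but S_τ(y) > 0. Put δ = S_τ(y)/(2τ) and W(x) = max over t in [0,
τ] of S_t(x) - δt. Dynamic programming makes W a strict subsolution, at level -δ, wherever the
maximizing t is positive (`NeumannData.subIneq_of_dynamic`). This happens wherever W > d, because
S_0 is a subsolution with S_0(y) ≤ 0, so S_0 ≤ d. Comparison with the supersolution d
(`NeumannData.le_of_strict`) gives W ≤ d, whereas W(y) ≥ S_τ(y)/2 > 0 = d(y).

Conversely, d is the largest subsolution vanishing at y. If it fails the supersolution test
somewhere, Perron's bump (`NeumannData.exists_bump`) produces a larger subsolution, smooth and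
strict near that point. Away from y this contradicts maximality. At y, a loop of duration larger
than τ either stays near y for time τ or travels a fixed distance, and strictness charges a fixed
amount in both cases (`NeumannData.exists_le_of_reach_self`), so cheap loops are impossible.

The analytic difficulty is the boundary: γ, g and the normal are merely continuous, and the boundary
condition holds only as an alternative to the equation. The doubling arguments therefore use a
quadratic form whose operator A sends γ(x₀) to an outer normal (`IsChart`): its gradient has almost
the right sign against γ at boundary points, and a small tilt along e makes the sign strict, which
excludes the boundary alternative. In the opposite direction, subsolution inequalities for value
functions come from explicit short arcs, which slide along the boundary when the desired velocity
points outwards (`NeumannData.exists_reach_of_lt`). -/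

lemma mem_or_mem_frontier {x : EuclideanSpace ℝ (Fin n)} (hx : x ∈ closure Ω) :
    x ∈ Ω ∨ x ∈ frontier Ω := by
  by_cases h : x ∈ interior Ω
  · exact Or.inl (interior_subset h)
  · exact Or.inr ⟨hx, h⟩

lemma notMem_of_mem_frontier (hΩ : IsOpen Ω) {x : EuclideanSpace ℝ (Fin n)} (hx : x ∈ frontier Ω) :
    x ∉ Ω := by
  rw [hΩ.frontier_eq] at hx
  exact hx.2

lemma mem_closure_of_mem_frontier {x : EuclideanSpace ℝ (Fin n)} (hx : x ∈ frontier Ω) :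
    x ∈ closure Ω :=
  frontier_subset_closure hx

lemma exists_ball_disjoint_frontier (hΩ : IsOpen Ω) {x : EuclideanSpace ℝ (Fin n)} (hx : x ∈ Ω) :
    ∃ r > 0, (∀ z, dist z x < r → z ∈ Ω) ∧ ∀ z ∈ frontier Ω, ¬ dist z x < r := by
  obtain ⟨r, hr, h⟩ := Metric.isOpen_iff.1 hΩ x hx
  exact ⟨r, hr, fun z hz => h hz, fun z hz hzr => notMem_of_mem_frontier hΩ hz (h hzr)⟩

namespace IsLocalDefiningFunction

variable {x : EuclideanSpace ℝ (Fin n)} {ψ : EuclideanSpace ℝ (Fin n) → ℝ}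

/-- A `C¹` function is strictly differentiable, so the linearization error is controlled for pairs
of nearby points and not only for pairs containing `x`. The signs on the closure and the frontier
follow from continuity of ψ near `x`. -/
lemma exists_radius (h : IsLocalDefiningFunction Ω x ψ) (hΩ : IsOpen Ω) {θ : ℝ} (hθ : 0 < θ) :
    ∃ r > 0, (∀ z, dist z x < r → (z ∈ Ω ↔ ψ z < 0)) ∧
      (∀ z ∈ closure Ω, dist z x < r → ψ z ≤ 0) ∧
      (∀ z ∈ frontier Ω, dist z x < r → ψ z = 0) ∧
      ∀ z z', dist z x < r → dist z' x < r →
        |ψ z - ψ z' - ⟪∇ ψ x, z - z'⟫| ≤ θ * ‖z - z'‖ := by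
  have hs := h.contDiffAt.hasStrictFDerivAt one_ne_zero
  have h1 := hs.isLittleO.def hθ
  have h2 : ∀ᶠ z in 𝓝 x, ContinuousAt ψ z :=
    (h.contDiffAt.eventually (by simp)).mono fun z hz => hz.continuousAt
  rw [nhds_prod_eq] at h1
  obtain ⟨r1, hr1, H1⟩ := Metric.eventually_nhds_iff.1 (h.mem_iff.and h2)
  rw [(Metric.nhds_basis_ball.prod_self).eventually_iff] at h1
  obtain ⟨r2, hr2, H2⟩ := h1
  have hcl : ∀ z ∈ closure Ω, dist z x < r1 → ψ z ≤ 0 := by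
    intro z hz hzr
    by_contra! hpos
    have h3 : ∀ᶠ w in 𝓝 z, 0 < ψ w := (H1 hzr).2.eventually (lt_mem_nhds hpos)
    have h4 : ∀ᶠ w in 𝓝 z, dist w x < r1 := Metric.isOpen_ball.mem_nhds hzr
    obtain ⟨w, ⟨hw1, hw2⟩, hw⟩ := mem_closure_iff_nhds.1 hz _ (h3.and h4)
    linarith [((H1 hw2).1).1 hw]
  refine ⟨min r1 r2, lt_min hr1 hr2, fun z hz => (H1 (hz.trans_le (min_le_left _ _))).1,
    fun z hz hzr => hcl z hz (hzr.trans_le (min_le_left _ _)), fun z hz hzr => ?_,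
    fun z z' hz hz' => ?_⟩
  · have hzr := hzr.trans_le (min_le_left _ _)
    refine le_antisymm (hcl z (mem_closure_of_mem_frontier hz) hzr) ?_
    by_contra! hneg
    exact notMem_of_mem_frontier hΩ hz ((H1 hzr).1.2 hneg)
  · have := H2 (x := (z, z')) ⟨hz.trans_le (min_le_right _ _), hz'.trans_le (min_le_right _ _)⟩
    simp only [Real.norm_eq_abs] at this
    rwa [← toDual_gradient, InnerProductSpace.toDual_apply_apply] at this

lemma inner_gradient_pos (h : IsLocalDefiningFunction Ω x ψ) (hγ : IsOblique Ω γ)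
    (hx : x ∈ frontier Ω) : 0 < ⟪∇ ψ x, γ x⟫ := by
  have := hγ x hx _ ⟨ψ, h, rfl⟩
  rw [real_inner_smul_left] at this
  exact (mul_pos_iff_of_pos_left (inv_pos.2 (norm_pos_iff.2 h.gradient_ne_zero))).1 this

/-- A small cone with axis `w` pointing inwards at `x` is contained in `Ω`, uniformly near `x`. -/
lemma exists_cone (h : IsLocalDefiningFunction Ω x ψ) (hΩ : IsOpen Ω) {w : EuclideanSpace ℝ (Fin n)}
    (hw : ⟪∇ ψ x, w⟫ < 0) :
    ∃ r > 0, ∃ κ > 0, ∀ z ∈ closure Ω, dist z x < r → ∀ s ∈ Ioo 0 r, ∀ ξ : EuclideanSpace ℝ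
        (Fin n), ‖ξ‖ ≤ κ * s →
      z + s • w + ξ ∈ Ω := by
  set m := -⟪∇ ψ x, w⟫ with hm
  have hm0 : 0 < m := by rw [hm]; linarith
  set N := ‖w‖ + ‖∇ ψ x‖ + 1 with hN
  have hN0 : 0 < N := by positivity
  -- The linear term along `s • w` is `-m * s`. With this accuracy the linearization error is at
  -- most `m * s / 4`, and the bound on `ξ` makes its contribution at most `m * s / 4` too, so ψ
  -- stays negative.
  obtain ⟨r, hr, h1, h2, -, h4⟩ := h.exists_radius hΩ (θ := m / (4 * N)) (by positivity)
  have hκ : 0 < min 1 (m / (4 * N)) := lt_min one_pos (by positivity)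
  refine ⟨min (r / 2) (r / (4 * N)), by positivity, min 1 (m / (4 * N)), hκ, ?_⟩
  intro z hz hzr s hs ξ hξ
  have hzr1 : dist z x < r / 2 := hzr.trans_le (min_le_left _ _)
  have hs0 := hs.1
  have hs1 : s * (4 * N) < r := by
    have := hs.2.trans_le (min_le_right _ _)
    rwa [lt_div_iff₀ (by positivity)] at this
  have hξ1 : ‖ξ‖ ≤ s := hξ.trans (by nlinarith [min_le_left 1 (m / (4 * N))])
  have hξ2 : ‖ξ‖ * (4 * N) ≤ m * s := by
    have : ‖ξ‖ ≤ m / (4 * N) * s :=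
      hξ.trans (mul_le_mul_of_nonneg_right (min_le_right _ _) hs0.le)
    rw [div_mul_eq_mul_div, le_div_iff₀ (by positivity)] at this
    exact this
  set ζ := s • w + ξ with hζ
  have hζn : ‖ζ‖ ≤ s * N := by
    calc ‖ζ‖ ≤ ‖s • w‖ + ‖ξ‖ := norm_add_le _ _
      _ ≤ s * ‖w‖ + s := by rw [norm_smul, Real.norm_of_nonneg hs0.le]; linarith
      _ ≤ s * N := by rw [hN]; nlinarith [norm_nonneg (∇ ψ x)]
  have hd : dist (z + ζ) x < r := by
    calc dist (z + ζ) x ≤ dist (z + ζ) z + dist z x := dist_triangle _ _ _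
      _ < r := by
        rw [dist_eq_norm, add_sub_cancel_left]; nlinarith
  rw [add_assoc, ← hζ, h1 _ hd]
  have h5 := h4 (z + ζ) z hd (by linarith)
  rw [add_sub_cancel_left] at h5
  have h6 := h2 z hz (by linarith)
  have h7 : ⟪∇ ψ x, ζ⟫ ≤ -(m * s) + N * ‖ξ‖ := by
    rw [hζ, inner_add_right, real_inner_smul_right]
    have : ⟪∇ ψ x, ξ⟫ ≤ N * ‖ξ‖ :=
      (real_inner_le_norm _ _).trans
        (mul_le_mul_of_nonneg_right (by rw [hN]; linarith [norm_nonneg w]) (norm_nonneg _))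
    have h8 : s * ⟪∇ ψ x, w⟫ = -(m * s) := by rw [hm]; ring
    linarith
  have h9 : m / (4 * N) * ‖ζ‖ ≤ m * s / 4 := by
    calc m / (4 * N) * ‖ζ‖ ≤ m / (4 * N) * (s * N) := by gcongr
      _ = m * s / 4 := by field_simp
  have h10 := (abs_le.1 h5).2
  have h11 : 0 < m * s := by positivity
  nlinarith

end IsLocalDefiningFunction

/-- Every point of the closure has an interior cone condition, uniform near the point. -/
lemma exists_interior_cone (hΩ : IsOpen Ω) (hC : HasC1Boundary Ω) {x : EuclideanSpace ℝ (Fin n)}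
    (hx : x ∈ closure Ω) :
    ∃ w : EuclideanSpace ℝ (Fin n), ∃ r > 0, ∃ κ > 0, ∀ z ∈ closure Ω, dist z x < r →
        ∀ s ∈ Ioo 0 r, ∀ ξ : EuclideanSpace ℝ (Fin n),
      ‖ξ‖ ≤ κ * s → z + s • w + ξ ∈ Ω := by
  rcases mem_or_mem_frontier hx with hx | hx
  · obtain ⟨r, hr, h, -⟩ := exists_ball_disjoint_frontier hΩ hx
    refine ⟨0, r / 2, by positivity, 1, one_pos, fun z _ hz s hs ξ hξ => h _ ?_⟩
    calc dist (z + s • (0 : EuclideanSpace ℝ (Fin n)) + ξ) x ≤ dist (z + s • (0 : EuclideanSpace ℝ (Fin n)) + ξ) z + dist z x :=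
          dist_triangle _ _ _
      _ < r := by
        rw [dist_eq_norm]
        simp only [smul_zero, add_zero, add_sub_cancel_left]
        linarith [hs.2]
  · obtain ⟨ψ, h⟩ := hC x hx
    refine ⟨-∇ ψ x, h.exists_cone hΩ ?_⟩
    rw [inner_neg_right, real_inner_self_eq_norm_sq]
    have := norm_pos_iff.2 h.gradient_ne_zero
    nlinarith [sq_nonneg ‖∇ ψ x‖, pow_pos this 2]

/-- The direction `-γ` points strictly inwards at boundary points. -/
lemma eventually_sub_smul_mem (hΩ : IsOpen Ω) (hC : HasC1Boundary Ω) (hγ : IsOblique Ω γ)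
    {x : EuclideanSpace ℝ (Fin n)}
    (hx : x ∈ frontier Ω) : ∀ᶠ s : ℝ in 𝓝[>] 0, x - s • γ x ∈ Ω := by
  obtain ⟨ψ, h⟩ := hC x hx
  obtain ⟨r, hr, κ, hκ, H⟩ := h.exists_cone hΩ (w := -γ x)
    (by rw [inner_neg_right]; linarith [h.inner_gradient_pos hγ hx])
  filter_upwards [Ioo_mem_nhdsGT hr] with s hs
  have := H x (mem_closure_of_mem_frontier hx) (by simpa using hr) s hs 0
    (by simpa using (mul_pos hκ hs.1).le)
  simpa [sub_eq_add_neg] using this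

/-- A symmetric positive definite operator `A` and a vector `e` adapted at `x` to the reflection
direction `γ`: the operator maps `γ` to an outer normal, up to small errors near `x`. -/
structure IsChart (Ω : Set (EuclideanSpace ℝ (Fin n)))
    (γ : EuclideanSpace ℝ (Fin n) → EuclideanSpace ℝ (Fin n)) (x : EuclideanSpace ℝ (Fin n))
    (A : EuclideanSpace ℝ (Fin n) →L[ℝ] EuclideanSpace ℝ (Fin n)) (e : EuclideanSpace ℝ (Fin n))
    (c : ℝ) : Prop where
  pos : 0 < c
  symm : ∀ ξ ζ, ⟪A ξ, ζ⟫ = ⟪A ζ, ξ⟫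
  coercive : ∀ ξ, c * ‖ξ‖ ^ 2 ≤ ⟪A ξ, ξ⟫
  oblique : ∀ θ > 0, ∃ r > 0, ∀ z ∈ frontier Ω, dist z x < r → 1 ≤ ⟪e, γ z⟫ ∧
    ∀ z' ∈ closure Ω, dist z' x < r → -(θ * ‖z - z'‖) ≤ ⟪A (z - z'), γ z⟫

/-- The operator `A` with `⟪A ξ, ξ⟫ = ⟪ν, ξ⟫² / m + ‖ξ - (⟪ν, ξ⟫ / m) • g‖²`, `m = ⟪ν, g⟫`, which
maps `g` to `ν`. -/
def obliqueForm (ν g : EuclideanSpace ℝ (Fin n)) : EuclideanSpace ℝ (Fin n) →L[ℝ] EuclideanSpace ℝ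
    (Fin n) :=
  let m := ⟪ν, g⟫
  let P : EuclideanSpace ℝ (Fin n) →L[ℝ] EuclideanSpace ℝ (Fin n) := ContinuousLinearMap.id ℝ
      (EuclideanSpace ℝ (Fin n)) - (m⁻¹ • innerSL ℝ ν).smulRight g
  (m⁻¹ • innerSL ℝ ν).smulRight ν + P - (m⁻¹ • (innerSL ℝ g).comp P).smulRight ν

lemma inner_obliqueForm (ν g ξ ζ : EuclideanSpace ℝ (Fin n)) :
    ⟪obliqueForm ν g ξ, ζ⟫ = ⟪ν, g⟫⁻¹ * ⟪ν, ξ⟫ * ⟪ν, ζ⟫ +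
      ⟪ξ - (⟪ν, g⟫⁻¹ * ⟪ν, ξ⟫) • g, ζ - (⟪ν, g⟫⁻¹ * ⟪ν, ζ⟫) • g⟫ := by
  simp only [obliqueForm, add_apply, sub_apply,
    ContinuousLinearMap.smulRight_apply, smul_apply,
    ContinuousLinearMap.comp_apply, ContinuousLinearMap.id_apply, innerSL_apply_apply,
    inner_add_left, inner_sub_left, inner_sub_right, real_inner_smul_left, real_inner_smul_right,
    smul_eq_mul, real_inner_comm g ξ]
  ring

/-- At an interior point the identity works, since a small ball misses the frontier. At a frontier
point the form of `obliqueForm` gives ⟪A ξ, γ x⟫ = ⟪∇ψ x, ξ⟫; for z on the frontier and z' in the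
closure, ψ z = 0 ≥ ψ z' bounds ⟪∇ψ x, z - z'⟫ from below up to a small multiple of ‖z - z'‖.
Continuity of γ allows γ z in place of γ x. -/
lemma exists_isChart (hΩ : IsOpen Ω) (hC : HasC1Boundary Ω) (hγ : IsOblique Ω γ)
    (hγc : ContinuousOn γ (frontier Ω)) {x : EuclideanSpace ℝ (Fin n)} (hx : x ∈ closure Ω) :
    ∃ A e c, IsChart Ω γ x A e c := by
  rcases mem_or_mem_frontier hx with hx | hx
  · obtain ⟨r, hr, -, h⟩ := exists_ball_disjoint_frontier hΩ hx
    exact ⟨ContinuousLinearMap.id ℝ (EuclideanSpace ℝ (Fin n)), 0, 1, one_pos,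
        fun ξ ζ => real_inner_comm _ _,
      fun ξ => by simp, fun θ hθ => ⟨r, hr, fun z hz hzr => absurd hzr (h z hz)⟩⟩
  · obtain ⟨ψ, h⟩ := hC x hx
    set ν := ∇ ψ x
    set g := γ x
    have hm : 0 < ⟪ν, g⟫ := h.inner_gradient_pos hγ hx
    set m := ⟪ν, g⟫ with hmdef
    set A := obliqueForm ν g
    have hA : ∀ ξ, ⟪A ξ, g⟫ = ⟪ν, ξ⟫ := by
      intro ξ
      rw [inner_obliqueForm, ← hmdef, inv_mul_cancel₀ hm.ne', one_smul, sub_self, inner_zero_right]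
      field_simp
      ring
    -- The vector `(2 / m) • ν` has inner product 2 with γ x, leaving room for the value 1 nearby.
    -- The coercivity constant comes from splitting ξ into its component along `g` and the remainder
    -- `w`.
    refine ⟨A, (2 / m) • ν, (2 * (m⁻¹ * ‖g‖ ^ 2 + 1))⁻¹, by positivity, fun ξ ζ => ?_, fun ξ => ?_,
      fun θ hθ => ?_⟩
    · rw [inner_obliqueForm, inner_obliqueForm, real_inner_comm (ζ - _) (ξ - _)]
      ring
    · rw [inner_obliqueForm, ← hmdef, real_inner_self_eq_norm_sq]
      set α := m⁻¹ * ⟪ν, ξ⟫ with hα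
      set w := ξ - α • g with hw
      have h1 : m⁻¹ * ⟪ν, ξ⟫ * ⟪ν, ξ⟫ = m * α ^ 2 := by rw [hα]; field_simp
      have h2 : ‖ξ‖ ≤ |α| * ‖g‖ + ‖w‖ := by
        have : ξ = α • g + w := by rw [hw]; abel
        calc ‖ξ‖ = ‖α • g + w‖ := by rw [← this]
          _ ≤ _ := (norm_add_le _ _).trans (by rw [norm_smul, Real.norm_eq_abs])
      have h3 : ‖ξ‖ ^ 2 ≤ 2 * (α ^ 2 * ‖g‖ ^ 2 + ‖w‖ ^ 2) := by
        calc ‖ξ‖ ^ 2 ≤ (|α| * ‖g‖ + ‖w‖) ^ 2 := by gcongr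
          _ ≤ 2 * ((|α| * ‖g‖) ^ 2 + ‖w‖ ^ 2) := by nlinarith [sq_nonneg (|α| * ‖g‖ - ‖w‖)]
          _ = _ := by rw [mul_pow, sq_abs]
      change _ ≤ m⁻¹ * ⟪ν, ξ⟫ * ⟪ν, ξ⟫ + ‖w‖ ^ 2
      rw [h1, inv_mul_le_iff₀ (by positivity)]
      have h4 : (m⁻¹ * ‖g‖ ^ 2 + 1) * (m * α ^ 2 + ‖w‖ ^ 2) =
          α ^ 2 * ‖g‖ ^ 2 + ‖w‖ ^ 2 + (m⁻¹ * ‖g‖ ^ 2 * ‖w‖ ^ 2 + m * α ^ 2) := by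
        field_simp
        ring
      have h5 : 0 ≤ m⁻¹ * ‖g‖ ^ 2 * ‖w‖ ^ 2 + m * α ^ 2 := by positivity
      linarith
    · obtain ⟨r1, hr1, -, H2, H3, H4⟩ := h.exists_radius hΩ (half_pos hθ)
      have hcont : Tendsto γ (𝓝[frontier Ω] x) (𝓝 g) := hγc x hx
      have e1 : ∀ᶠ z in 𝓝[frontier Ω] x, m / 2 < ⟪ν, γ z⟫ := by
        have : Tendsto (fun z => ⟪ν, γ z⟫) (𝓝[frontier Ω] x) (𝓝 ⟪ν, g⟫) :=
          tendsto_const_nhds.inner hcont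
        exact this.eventually (lt_mem_nhds (by linarith))
      have e2 : ∀ᶠ z in 𝓝[frontier Ω] x, ‖A‖ * ‖γ z - g‖ < θ / 2 := by
        have : Tendsto (fun z => ‖A‖ * ‖γ z - g‖) (𝓝[frontier Ω] x) (𝓝 (‖A‖ * ‖g - g‖)) :=
          (hcont.sub_const g).norm.const_mul _
        exact this.eventually (gt_mem_nhds (by simpa using hθ))
      obtain ⟨r2, hr2, H5⟩ := Metric.eventually_nhds_iff.1
        (eventually_nhdsWithin_iff.1 (e1.and e2))
      refine ⟨min r1 r2, lt_min hr1 hr2, fun z hz hzr => ?_⟩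
      obtain ⟨H5, H6⟩ := H5 (hzr.trans_le (min_le_right _ _)) hz
      have hzr := hzr.trans_le (min_le_left r1 r2)
      refine ⟨?_, fun z' hz' hzr' => ?_⟩
      · rw [real_inner_smul_left]
        calc (1 : ℝ) = 2 / m * (m / 2) := by field_simp
          _ ≤ _ := by gcongr
      · have hzr' := hzr'.trans_le (min_le_left r1 r2)
        have h7 := (abs_le.1 (H4 z z' hzr hzr')).2
        rw [H3 z hz hzr] at h7
        have h8 := H2 z' hz' hzr'
        have h9 : ⟪A (z - z'), γ z⟫ = ⟪ν, z - z'⟫ + ⟪A (z - z'), γ z - g⟫ := by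
          rw [inner_sub_right (A (z - z')) (γ z) g, hA]; ring
        have h10 : |⟪A (z - z'), γ z - g⟫| ≤ θ / 2 * ‖z - z'‖ := by
          calc _ ≤ ‖A (z - z')‖ * ‖γ z - g‖ := abs_real_inner_le_norm _ _
            _ ≤ ‖A‖ * ‖z - z'‖ * ‖γ z - g‖ := by gcongr; exact A.le_opNorm _
            _ = ‖A‖ * ‖γ z - g‖ * ‖z - z'‖ := by ring
            _ ≤ _ := by gcongr
        rw [h9]
        linarith [(abs_le.1 h10).1]


end

section

/-! ### The Hamiltonian and the Lagrangian -/

/-- The standing assumptions on the data of the Neumann type problem. -/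
structure NeumannData (Ω : Set (EuclideanSpace ℝ (Fin n)))
    (H : EuclideanSpace ℝ (Fin n) → EuclideanSpace ℝ (Fin n) → ℝ)
    (γ : EuclideanSpace ℝ (Fin n) → EuclideanSpace ℝ (Fin n)) (g : EuclideanSpace ℝ (Fin n) → ℝ) :
    Prop where
  isOpen : IsOpen Ω
  isConnected : IsConnected Ω
  isBounded : Bornology.IsBounded Ω
  c1 : HasC1Boundary Ω
  continuousOn_H : ContinuousOn (fun z : EuclideanSpace ℝ (Fin n) × EuclideanSpace ℝ
      (Fin n) => H z.1 z.2) (closure Ω ×ˢ univ)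
  continuousOn_γ : ContinuousOn γ (frontier Ω)
  continuousOn_g : ContinuousOn g (frontier Ω)
  convexOn : ∀ x ∈ closure Ω, ConvexOn ℝ univ (H x)
  coercive : ∀ x ∈ closure Ω, Tendsto (H x) (Bornology.cobounded (EuclideanSpace ℝ (Fin n))) atTop
  oblique : IsOblique Ω γ

/-- On a large sphere `f` exceeds `f 0` by at least 1; by convexity along rays from 0 it then grows
at least linearly outside the ball, and inside the ball it is bounded. -/
lemma exists_linear_lower_bound {f : EuclideanSpace ℝ (Fin n) → ℝ} (hf : ConvexOn ℝ univ f)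
    (hfc : Continuous f) (hf' : Tendsto f (Bornology.cobounded (EuclideanSpace ℝ (Fin n))) atTop) :
    ∃ c > 0, ∃ C, ∀ p, c * ‖p‖ - C ≤ f p := by
  have h1 := hf'.eventually_ge_atTop (f 0 + 1)
  obtain ⟨R, hR⟩ := (Metric.hasBasis_cobounded_compl_closedBall
      (0 : EuclideanSpace ℝ (Fin n))).eventually_iff.1 h1
  simp only [true_and, mem_compl_iff, Metric.mem_closedBall, dist_zero_right, not_le] at hR
  set R' := max R 0 + 1 with hR'
  have hR0 : 0 < R' := by positivity
  have hRR : R < R' := by rw [hR']; linarith [le_max_left R 0]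
  obtain ⟨M, hM⟩ := (isCompact_closedBall
      (0 : EuclideanSpace ℝ (Fin n)) R').exists_bound_of_continuousOn
    hfc.continuousOn
  refine ⟨R'⁻¹, inv_pos.2 hR0, |f 0| + |M| + 1, fun p => ?_⟩
  rcases le_or_gt ‖p‖ R' with h | h
  · have h2 := hM p (by simpa using h)
    rw [Real.norm_eq_abs] at h2
    have h3 : R'⁻¹ * ‖p‖ ≤ 1 := by
      rw [inv_mul_le_iff₀ hR0]; linarith
    linarith [neg_abs_le (f p), abs_nonneg (f 0), le_abs_self M]
  · have hp0 : 0 < ‖p‖ := hR0.trans h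
    set s := R' / ‖p‖ with hs
    have hs0 : 0 < s := by positivity
    have hs1 : s < 1 := by rw [hs, div_lt_one hp0]; exact h
    have h2 := hf.2 (mem_univ (0 : EuclideanSpace ℝ (Fin n))) (mem_univ p)
        (by linarith : 0 ≤ 1 - s) hs0.le (by ring)
    have h3 : ‖(1 - s) • (0 : EuclideanSpace ℝ (Fin n)) + s • p‖ = R' := by
      rw [smul_zero, zero_add, norm_smul, Real.norm_of_nonneg hs0.le, hs]
      field_simp
    have h4 := hR (x := (1 - s) • (0 : EuclideanSpace ℝ (Fin n)) + s • p) (by rw [h3]; exact hRR)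
    simp only [smul_eq_mul] at h2
    have h5 : 1 ≤ s * (f p - f 0) := by linarith
    have h6 : R'⁻¹ * ‖p‖ = s⁻¹ := by rw [hs]; field_simp
    have h7 : s⁻¹ ≤ f p - f 0 := by
      rw [inv_le_iff_one_le_mul₀ hs0, mul_comm]; exact h5
    rw [h6]
    linarith [neg_abs_le (f 0), abs_nonneg M, abs_nonneg (f 0)]

namespace NeumannData

variable {Ω : Set (EuclideanSpace ℝ (Fin n))}
    {H : EuclideanSpace ℝ (Fin n) → EuclideanSpace ℝ (Fin n) → ℝ}
    {γ : EuclideanSpace ℝ (Fin n) → EuclideanSpace ℝ (Fin n)} {g : EuclideanSpace ℝ (Fin n) → ℝ}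

lemma isCompact (D : NeumannData Ω H γ g) : IsCompact (closure Ω) := D.isBounded.isCompact_closure

lemma isCompact_frontier (D : NeumannData Ω H γ g) : IsCompact (frontier Ω) :=
  D.isCompact.of_isClosed_subset isClosed_frontier frontier_subset_closure

lemma continuous_H (D : NeumannData Ω H γ g) {x : EuclideanSpace ℝ (Fin n)} (hx : x ∈ closure Ω) :
    Continuous (H x) := by
  have h : ContinuousOn (fun p : EuclideanSpace ℝ (Fin n) => (x, p)) univ := by fun_prop
  have := D.continuousOn_H.comp h fun p _ => ⟨hx, mem_univ _⟩
  simpa [continuousOn_univ, Function.comp_def] using this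

lemma exists_modulus (D : NeumannData Ω H γ g) (R : ℝ) {ε : ℝ} (hε : 0 < ε) :
    ∃ δ > 0, ∀ x ∈ closure Ω, ∀ x' ∈ closure Ω, ∀ p p' : EuclideanSpace ℝ (Fin n), ‖p‖ ≤ R → ‖p'‖
        ≤ R →
      dist x x' < δ → ‖p - p'‖ < δ → |H x p - H x' p'| < ε := by
  have hc : ContinuousOn (fun z : EuclideanSpace ℝ (Fin n) × EuclideanSpace ℝ (Fin n) => H z.1 z.2)
      (closure Ω ×ˢ Metric.closedBall (0 : EuclideanSpace ℝ (Fin n)) R) :=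
    D.continuousOn_H.mono (prod_mono_right (subset_univ _))
  have := (D.isCompact.prod (isCompact_closedBall _ _)).uniformContinuousOn_of_continuous hc
  obtain ⟨δ, hδ, h⟩ := Metric.uniformContinuousOn_iff.1 this ε hε
  refine ⟨δ, hδ, fun x hx x' hx' p p' hp hp' hxx hpp => ?_⟩
  have := h (x, p) ⟨hx, by simpa using hp⟩ (x', p') ⟨hx', by simpa using hp'⟩
    (by rw [Prod.dist_eq]; exact max_lt hxx (by rwa [dist_eq_norm]))
  rwa [Real.dist_eq] at this

/-- A strict affine-plus-cone lower bound for `H x` persists for nearby base points. -/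
lemma exists_lower_bound_near (D : NeumannData Ω H γ g) {x p ζ : EuclideanSpace ℝ (Fin n)}
    (hx : x ∈ closure Ω)
    {b c b' c' : ℝ} (hb : b' < b) (hc : c' < c)
    (h : ∀ q, b + ⟪ζ, q - p⟫ + c * ‖q - p‖ ≤ H x q) :
    ∃ ρ > 0, ∀ x' ∈ closure Ω, dist x' x < ρ → ∀ q, b' + ⟪ζ, q - p⟫ + c' * ‖q - p‖ ≤ H x' q := by
  -- At distance `R` from `p` the gap between the slopes `c` and `c'` outweighs the possible defect
  -- at `p` itself. Inside this radius uniform continuity suffices; outside, convexity of `H x'` on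
  -- the ray from `p` carries the bound outwards from the sphere.
  set R := |H x p + 1 - b'| / (c - c') + 1 with hR
  have hcc : 0 < c - c' := by linarith
  have hR0 : 0 < R := by positivity
  have hRb : H x p + 1 - b' ≤ (c - c') * R := by
    have : (c - c') * R = |H x p + 1 - b'| + (c - c') := by rw [hR]; field_simp
    linarith [le_abs_self (H x p + 1 - b')]
  set ε := min (b - b') 1
  have hε : 0 < ε := lt_min (by linarith) one_pos
  have hε1 : ε ≤ b - b' := min_le_left _ _
  have hε2 : ε ≤ 1 := min_le_right _ _
  obtain ⟨ρ, hρ, hmod⟩ := D.exists_modulus (‖p‖ + R) hε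
  refine ⟨ρ, hρ, fun x' hx' hd q => ?_⟩
  have key : ∀ q, ‖q - p‖ ≤ R → |H x' q - H x q| < ε := by
    intro q hq
    have hq' : ‖q‖ ≤ ‖p‖ + R := by
      calc ‖q‖ = ‖p + (q - p)‖ := by rw [add_sub_cancel]
        _ ≤ _ := (norm_add_le _ _).trans (by linarith)
    exact hmod x' hx' x hx q q hq' hq' hd (by simpa using hρ)
  rcases le_or_gt ‖q - p‖ R with hq | hq
  · have h1 := (abs_lt.1 (key q hq)).1
    have h2 := h q
    nlinarith [norm_nonneg (q - p)]
  · have hn : 0 < ‖q - p‖ := hR0.trans hq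
    set s := R / ‖q - p‖ with hs
    have hs0 : 0 < s := by positivity
    have hs1 : s < 1 := by rw [hs, div_lt_one hn]; exact hq
    have hsR : s * ‖q - p‖ = R := by rw [hs]; field_simp
    set z := (1 - s) • p + s • q with hz
    have hzp : z - p = s • (q - p) := by rw [hz, smul_sub, sub_smul, one_smul]; abel
    have hzn : ‖z - p‖ = R := by rw [hzp, norm_smul, Real.norm_of_nonneg hs0.le, hsR]
    have h1 := (D.convexOn x' hx').2 (mem_univ p) (mem_univ q) (by linarith : 0 ≤ 1 - s) hs0.le
      (by ring)
    simp only [smul_eq_mul] at h1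
    have h2 := (abs_lt.1 (key z hzn.le)).1
    have h3 := (abs_lt.1 (key p (by simpa using hR0.le))).2
    have h4 := h z
    rw [hzn, hzp, real_inner_smul_right] at h4
    have h5 : (1 - s) * H x' p ≤ (1 - s) * (H x p + 1) :=
      mul_le_mul_of_nonneg_left (by linarith) (by linarith)
    have h6 : (1 - s) * (H x p + 1 - b') ≤ (c - c') * R := by
      rcases le_or_gt (H x p + 1 - b') 0 with h7 | h7
      · have : (1 - s) * (H x p + 1 - b') ≤ 0 := mul_nonpos_of_nonneg_of_nonpos (by linarith) h7
        have : 0 ≤ (c - c') * R := by positivity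
        linarith
      · nlinarith
    have h8 : s * (b' + ⟪ζ, q - p⟫ + c' * ‖q - p‖) ≤ s * H x' q := by
      have : s * (b' + ⟪ζ, q - p⟫ + c' * ‖q - p‖) = s * b' + s * ⟪ζ, q - p⟫ + c' * R := by
        rw [← hsR]; ring
      rw [this]
      nlinarith
    exact le_of_mul_le_mul_left h8 hs0

/-- Coercivity is assumed for each `x` separately. Convexity turns it into linear growth, which
persists at neighbouring base points by `exists_lower_bound_near`, and compactness makes the
constants uniform. -/
lemma exists_coercive_bound (D : NeumannData Ω H γ g) :
    ∃ c > 0, ∃ C, ∀ x ∈ closure Ω, ∀ p, c * ‖p‖ - C ≤ H x p := by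
  have := D.isCompact.induction_on
    (p := fun s => ∃ c > 0, ∃ C, ∀ x ∈ s ∩ closure Ω, ∀ p, c * ‖p‖ - C ≤ H x p)
    ⟨1, one_pos, 0, by simp⟩
    (fun s t hst ⟨c, hc, C, h⟩ => ⟨c, hc, C, fun x hx => h x ⟨hst hx.1, hx.2⟩⟩)
    (fun s t ⟨c, hc, C, h⟩ ⟨c', hc', C', h'⟩ => ⟨min c c', lt_min hc hc', max C C', ?_⟩)
    (fun x hx => ?_)
  · obtain ⟨c, hc, C, h⟩ := this
    exact ⟨c, hc, C, fun x hx => h x ⟨hx, hx⟩⟩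
  · rintro x ⟨hx | hx, hxc⟩ p
    · have := h x ⟨hx, hxc⟩ p
      nlinarith [norm_nonneg p, min_le_left c c', le_max_left C C']
    · have := h' x ⟨hx, hxc⟩ p
      nlinarith [norm_nonneg p, min_le_right c c', le_max_right C C']
  · obtain ⟨c, hc, C, h⟩ := exists_linear_lower_bound (D.convexOn x hx) (D.continuous_H hx)
      (D.coercive x hx)
    obtain ⟨ρ, hρ, h'⟩ := D.exists_lower_bound_near (p := 0) (ζ := 0) (b := -C) (b' := -C - 1)
      (c' := c / 2) hx (by linarith) (half_lt_self hc) (fun q => by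
        simp only [inner_zero_left, sub_zero]; linarith [h q])
    refine ⟨Metric.ball x ρ, mem_nhdsWithin_of_mem_nhds (Metric.ball_mem_nhds x hρ), c / 2,
      half_pos hc, C + 1, fun z hz p => ?_⟩
    have := h' z hz.2 hz.1 p
    simp only [inner_zero_left, sub_zero] at this
    linarith

/-- If `b < H x p`, then some supporting affine function of value `b` at `p` lies below `H x'`
for all `x'` near `x`, even after a small perturbation of its slope. -/
lemma exists_stable_slope (D : NeumannData Ω H γ g) {x p : EuclideanSpace ℝ (Fin n)}
    (hx : x ∈ closure Ω) {b : ℝ}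
    (hb : b < H x p) :
    ∃ ξ : EuclideanSpace ℝ (Fin n), ∃ ρ > 0, ∀ x' ∈ closure Ω, dist x' x < ρ → ∀ ξ' :
        EuclideanSpace ℝ (Fin n), ‖ξ' - ξ‖ ≤ ρ →
      ∀ q, b + ⟪ξ', q - p⟫ ≤ H x' q := by
  obtain ⟨a, hba, hap⟩ := exists_between hb
  obtain ⟨l, d, hl, hlp⟩ := (D.convexOn x hx).exists_affine_le_of_lt (𝕜 := ℝ) (mem_univ p) hap
    isClosed_univ ((D.continuous_H hx).lowerSemicontinuous.lowerSemicontinuousOn _)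
  set ξ₀ := (InnerProductSpace.toDual ℝ (EuclideanSpace ℝ (Fin n))).symm l
  have hξ₀ : ∀ q, ⟪ξ₀, q⟫ = l q := fun q => InnerProductSpace.toDual_symm_apply
  have h1 : ∀ q, a + ⟪ξ₀, q - p⟫ ≤ H x q := by
    intro q
    have := hl ⟨q, mem_univ q⟩
    simp only [RCLike.re_to_real] at hlp
    rw [inner_sub_right, hξ₀, hξ₀]
    have h2 : l q + d ≤ H x q := by simpa using this
    linarith
  obtain ⟨c, hc, C, hC⟩ := exists_linear_lower_bound (D.convexOn x hx) (D.continuous_H hx)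
      (D.coercive x hx)
  set B := |a| + |c * ‖p‖ + C| + 1
  have hB : 0 < B := by positivity
  -- Averaging the supporting affine function with the coercive bound, the latter with weight `t`,
  -- creates a growth term `t * c * ‖q - p‖`. This size of `t` costs at most half of `a - b` in the
  -- value; the growth later absorbs perturbations of the slope.
  set t := min (1 / 2) ((a - b) / (4 * B)) with ht
  have ht0 : 0 < t := lt_min (by norm_num) (div_pos (by linarith) (by positivity))
  have ht1 : t ≤ 1 / 2 := min_le_left _ _
  have htB : t * (4 * B) ≤ a - b := by
    calc t * (4 * B) ≤ (a - b) / (4 * B) * (4 * B) := by gcongr; exact min_le_right _ _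
      _ = a - b := by field_simp
  have h2 : ∀ q, (a + b) / 2 + ⟪(1 - t) • ξ₀, q - p⟫ + (t * c) * ‖q - p‖ ≤ H x q := by
    intro q
    have h3 := h1 q
    have h4 := hC q
    have h5 : ‖q - p‖ ≤ ‖q‖ + ‖p‖ := norm_sub_le _ _
    have h6 : (1 - t) * (a + ⟪ξ₀, q - p⟫) + t * (c * ‖q‖ - C) ≤ H x q := by nlinarith
    rw [real_inner_smul_left]
    have h7 : t * (c * ‖q - p‖) ≤ t * (c * (‖q‖ + ‖p‖)) := by gcongr
    have h8 : t * a + t * (c * ‖p‖ + C) ≤ t * (2 * B) := by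
      rw [← mul_add]
      refine mul_le_mul_of_nonneg_left ?_ ht0.le
      linarith [le_abs_self a, le_abs_self (c * ‖p‖ + C), abs_nonneg a,
        abs_nonneg (c * ‖p‖ + C)]
    nlinarith
  obtain ⟨ρ, hρ, h3⟩ := D.exists_lower_bound_near hx (b' := b) (c' := t * c / 2)
    (by linarith) (half_lt_self (by positivity)) h2
  refine ⟨(1 - t) • ξ₀, min ρ (t * c / 2), lt_min hρ (by positivity), ?_⟩
  intro x' hx' hd ξ' hξ' q
  have h4 := h3 x' hx' (hd.trans_le (min_le_left _ _)) q
  have h5 : ⟪ξ' - (1 - t) • ξ₀, q - p⟫ ≤ t * c / 2 * ‖q - p‖ :=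
    (real_inner_le_norm _ _).trans
      (mul_le_mul_of_nonneg_right (hξ'.trans (min_le_right _ _)) (norm_nonneg _))
  rw [inner_sub_left] at h5
  linarith

end NeumannData

/-! ### The Fenchel inequality. -/

variable {H : EuclideanSpace ℝ (Fin n) → EuclideanSpace ℝ (Fin n) → ℝ}

lemma le_lagrangian (H : EuclideanSpace ℝ (Fin n) → EuclideanSpace ℝ (Fin n) → ℝ)
    (x ξ p : EuclideanSpace ℝ (Fin n)) :
    ((⟪ξ, p⟫ - H x p : ℝ) : EReal) ≤ lagrangian H x ξ :=
  le_iSup (fun p : EuclideanSpace ℝ (Fin n) => ((⟪ξ, p⟫ - H x p : ℝ) : EReal)) p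

lemma lagrangian_le_of_forall {x ξ : EuclideanSpace ℝ (Fin n)} {b : ℝ}
    (h : ∀ p, ⟪ξ, p⟫ - H x p ≤ b) :
    lagrangian H x ξ ≤ (b : EReal) :=
  iSup_le fun p => EReal.coe_le_coe_iff.2 (h p)

lemma lagrangian_ne_bot (x ξ : EuclideanSpace ℝ (Fin n)) : lagrangian H x ξ ≠ ⊥ :=
  ne_bot_of_le_ne_bot (EReal.coe_ne_bot _) (le_lagrangian H x ξ 0)

/-- The Fenchel inequality for the real part of a finite Lagrangian. -/
lemma inner_sub_le_toReal_lagrangian {x ξ : EuclideanSpace ℝ (Fin n)} (h : lagrangian H x ξ ≠ ⊤)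
    (p : EuclideanSpace ℝ (Fin n)) :
    ⟪ξ, p⟫ - H x p ≤ (lagrangian H x ξ).toReal := by
  rw [← EReal.coe_le_coe_iff, EReal.coe_toReal h (lagrangian_ne_bot x ξ)]
  exact le_lagrangian H x ξ p

lemma toReal_lagrangian_le {x ξ : EuclideanSpace ℝ (Fin n)} {b : ℝ} (h : ∀ p, ⟪ξ, p⟫ - H x p ≤ b) :
    lagrangian H x ξ ≠ ⊤ ∧ (lagrangian H x ξ).toReal ≤ b := by
  have h1 := lagrangian_le_of_forall h
  have h2 : lagrangian H x ξ ≠ ⊤ := ne_top_of_le_ne_top (EReal.coe_ne_top _) h1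
  refine ⟨h2, ?_⟩
  rwa [← EReal.coe_le_coe_iff, EReal.coe_toReal h2 (lagrangian_ne_bot x ξ)]


end

section

/-! ### Gradient calculus -/

section Gradient

variable {f₁ f₂ : EuclideanSpace ℝ (Fin n) → ℝ} {p₁ p₂ x : EuclideanSpace ℝ (Fin n)}

lemma hasGradientAt_add (h₁ : HasGradientAt f₁ p₁ x) (h₂ : HasGradientAt f₂ p₂ x) :
    HasGradientAt (fun z => f₁ z + f₂ z) (p₁ + p₂) x := by
  rw [hasGradientAt_iff_hasFDerivAt] at *
  rw [map_add]
  exact h₁.add h₂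

lemma hasGradientAt_sub (h₁ : HasGradientAt f₁ p₁ x) (h₂ : HasGradientAt f₂ p₂ x) :
    HasGradientAt (fun z => f₁ z - f₂ z) (p₁ - p₂) x := by
  rw [hasGradientAt_iff_hasFDerivAt] at *
  rw [map_sub]
  exact h₁.sub h₂

lemma hasGradientAt_comp {h : ℝ → ℝ} {h' : ℝ} (hh : HasDerivAt h h' (f₁ x))
    (hf : HasGradientAt f₁ p₁ x) : HasGradientAt (fun z => h (f₁ z)) (h' • p₁) x := by
  rw [hasGradientAt_iff_hasFDerivAt] at *
  have := hh.comp_hasFDerivAt x hf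
  convert! this using 1
  ext v
  simp

lemma hasGradientAt_const_mul (a : ℝ) (hf : HasGradientAt f₁ p₁ x) :
    HasGradientAt (fun z => a * f₁ z) (a • p₁) x :=
  hasGradientAt_comp (by simpa using (hasDerivAt_id (f₁ x)).const_mul a) hf

lemma hasGradientAt_inner (q w : EuclideanSpace ℝ (Fin n)) (x : EuclideanSpace ℝ (Fin n)) :
    HasGradientAt (fun z => ⟪q, z - w⟫) q x := by
  rw [hasGradientAt_iff_hasFDerivAt]
  have h1 : HasFDerivAt (fun z : EuclideanSpace ℝ (Fin n) => z - w)
      (ContinuousLinearMap.id ℝ (EuclideanSpace ℝ (Fin n))) x :=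
    (hasFDerivAt_id x).sub_const w
  have h2 := ((innerSL ℝ q).hasFDerivAt (x := x - w)).comp x h1
  convert! h2 using 1

lemma hasGradientAt_form {A : EuclideanSpace ℝ (Fin n) →L[ℝ] EuclideanSpace ℝ (Fin n)}
    (hA : ∀ ξ ζ, ⟪A ξ, ζ⟫ = ⟪A ζ, ξ⟫) (w x : EuclideanSpace ℝ (Fin n)) :
    HasGradientAt (fun z => ⟪A (z - w), z - w⟫) ((2 : ℝ) • A (x - w)) x := by
  rw [hasGradientAt_iff_hasFDerivAt]
  have h1 : HasFDerivAt (fun z : EuclideanSpace ℝ (Fin n) => z - w)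
      (ContinuousLinearMap.id ℝ (EuclideanSpace ℝ (Fin n))) x :=
    (hasFDerivAt_id x).sub_const w
  have h2 := (A.hasFDerivAt (x := x - w)).comp x h1
  have h3 := HasFDerivAt.inner ℝ h2 h1
  convert! h3 using 1
  ext v
  simp [fderivInnerCLM_apply, hA v (x - w), inner_sub_left]
  ring

lemma contDiff_form (A : EuclideanSpace ℝ (Fin n) →L[ℝ] EuclideanSpace ℝ (Fin n))
    (w : EuclideanSpace ℝ (Fin n)) : ContDiff ℝ 1 (fun z => ⟪A (z - w), z - w⟫) :=
  ContDiff.inner ℝ (A.contDiff.comp (contDiff_id.sub contDiff_const))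
    (contDiff_id.sub contDiff_const)

lemma contDiff_inner_sub (q w : EuclideanSpace ℝ (Fin n)) : ContDiff ℝ 1
    (fun z : EuclideanSpace ℝ (Fin n) => ⟪q, z - w⟫) :=
  contDiff_const.inner ℝ (contDiff_id.sub contDiff_const)

lemma contDiff_norm_sub_sq (w : EuclideanSpace ℝ (Fin n)) : ContDiff ℝ 1
    (fun z : EuclideanSpace ℝ (Fin n) => ‖z - w‖ ^ 2) :=
  (contDiff_id.sub contDiff_const).norm_sq ℝ

lemma hasGradientAt_norm_sub_sq (w x : EuclideanSpace ℝ (Fin n)) :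
    HasGradientAt (fun z => ‖z - w‖ ^ 2) ((2 : ℝ) • (x - w)) x := by
  have := hasGradientAt_form (A := ContinuousLinearMap.id ℝ (EuclideanSpace ℝ (Fin n)))
    (fun ξ ζ => real_inner_comm _ _) w x
  simpa [real_inner_self_eq_norm_sq] using this

lemma contDiff_hasGradientAt {φ : EuclideanSpace ℝ (Fin n) → ℝ} (hφ : ContDiff ℝ 1 φ)
    (x : EuclideanSpace ℝ (Fin n)) :
    HasGradientAt φ (∇ φ x) x :=
  (hφ.differentiable one_ne_zero x).hasGradientAt

lemma continuous_gradient {φ : EuclideanSpace ℝ (Fin n) → ℝ} (hφ : ContDiff ℝ 1 φ) : Continuous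
    (∇ φ) :=
  (InnerProductSpace.toDual ℝ (EuclideanSpace ℝ (Fin n))).symm.continuous.comp
      (hφ.continuous_fderiv one_ne_zero)

end Gradient

/-! ### Semicontinuous envelopes -/

variable {Ω : Set (EuclideanSpace ℝ (Fin n))}
    {H : EuclideanSpace ℝ (Fin n) → EuclideanSpace ℝ (Fin n) → ℝ}
    {γ : EuclideanSpace ℝ (Fin n) → EuclideanSpace ℝ (Fin n)} {g : EuclideanSpace ℝ (Fin n) → ℝ}
    {a : ℝ} {u : EuclideanSpace ℝ (Fin n) → ℝ}

/-- A real `limsup` is meaningful only if its defining set is nonempty and bounded below. The lower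
bound is free here because the neighbourhood filter within the closure includes the point itself. -/
lemma uscEnvelope_set_bddBelow {x : EuclideanSpace ℝ (Fin n)} (hx : x ∈ closure Ω) :
    u x ∈ lowerBounds {a | ∀ᶠ z in 𝓝[closure Ω] x, u z ≤ a} := fun _ ha =>
  eventually_pure.1 (ha.filter_mono (pure_le_nhdsWithin hx))

lemma uscEnvelope_set_nonempty (hu : BddAbove (u '' closure Ω)) (x : EuclideanSpace ℝ (Fin n)) :
    {a | ∀ᶠ z in 𝓝[closure Ω] x, u z ≤ a}.Nonempty := by
  obtain ⟨M, hM⟩ := hu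
  exact ⟨M, eventually_mem_nhdsWithin.mono fun z hz => hM (mem_image_of_mem u hz)⟩

lemma le_uscEnvelope (hu : BddAbove (u '' closure Ω)) {x : EuclideanSpace ℝ (Fin n)}
    (hx : x ∈ closure Ω) :
    u x ≤ uscEnvelope Ω u x := by
  rw [uscEnvelope, limsup_eq]
  exact le_csInf (uscEnvelope_set_nonempty hu x) (uscEnvelope_set_bddBelow hx)

lemma uscEnvelope_le {x : EuclideanSpace ℝ (Fin n)} (hx : x ∈ closure Ω) {b : ℝ}
    (hb : ∀ᶠ z in 𝓝[closure Ω] x, u z ≤ b) : uscEnvelope Ω u x ≤ b := by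
  rw [uscEnvelope, limsup_eq]
  exact csInf_le ⟨_, uscEnvelope_set_bddBelow hx⟩ hb

lemma eventually_le_of_uscEnvelope_lt (hu : BddAbove (u '' closure Ω))
    {x : EuclideanSpace ℝ (Fin n)} {b : ℝ}
    (hb : uscEnvelope Ω u x < b) : ∀ᶠ z in 𝓝[closure Ω] x, u z ≤ b := by
  rw [uscEnvelope, limsup_eq] at hb
  obtain ⟨c, hc, hcb⟩ := exists_lt_of_csInf_lt (uscEnvelope_set_nonempty hu x) hb
  exact Eventually.mono (show ∀ᶠ z in 𝓝[closure Ω] x, u z ≤ c from hc) fun z hz => hz.trans hcb.le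

lemma upperSemicontinuousOn_uscEnvelope (hu : BddAbove (u '' closure Ω)) :
    UpperSemicontinuousOn (uscEnvelope Ω u) (closure Ω) := by
  intro x hx b hb
  obtain ⟨c, hc, hcb⟩ := exists_between hb
  have h1 := eventually_eventually_nhdsWithin.2 (eventually_le_of_uscEnvelope_lt hu hc)
  filter_upwards [h1, self_mem_nhdsWithin] with z hz hzX
  exact (uscEnvelope_le hzX hz).trans_lt hcb

lemma bddAbove_uscEnvelope (hu : BddAbove (u '' closure Ω)) :
    BddAbove (uscEnvelope Ω u '' closure Ω) := by
  obtain ⟨M, hM⟩ := hu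
  refine ⟨M, ?_⟩
  rintro _ ⟨x, hx, rfl⟩
  exact uscEnvelope_le hx
    (eventually_mem_nhdsWithin.mono fun z hz => hM (mem_image_of_mem u hz))

lemma uscEnvelope_eq (hu : UpperSemicontinuousOn u (closure Ω)) (hb : BddAbove (u '' closure Ω))
    {x : EuclideanSpace ℝ (Fin n)} (hx : x ∈ closure Ω) : uscEnvelope Ω u x = u x := by
  refine le_antisymm (le_of_forall_gt_imp_ge_of_dense fun b hb => ?_) (le_uscEnvelope hb hx)
  exact uscEnvelope_le hx ((hu x hx b hb).mono fun z hz => hz.le)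

lemma lscEnvelope_eq (hu : ContinuousOn u (closure Ω)) {x : EuclideanSpace ℝ (Fin n)}
    (hx : x ∈ closure Ω) :
    lscEnvelope Ω u x = u x :=
  haveI := nhdsWithin_neBot_of_mem hx
  Tendsto.liminf_eq (hu x hx)

/-! ### Viscosity tests -/

/-- The subsolution inequalities at `x` for a test function with gradient `p`. -/
def SubIneq (Ω : Set (EuclideanSpace ℝ (Fin n)))
    (H : EuclideanSpace ℝ (Fin n) → EuclideanSpace ℝ (Fin n) → ℝ)
    (γ : EuclideanSpace ℝ (Fin n) → EuclideanSpace ℝ (Fin n)) (g : EuclideanSpace ℝ (Fin n) → ℝ)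
    (a : ℝ) (x p : EuclideanSpace ℝ (Fin n)) : Prop :=
  (x ∈ Ω → H x p ≤ a) ∧ (x ∈ frontier Ω → H x p ≤ a ∨ ⟪γ x, p⟫ ≤ g x)

/-- The viscosity subsolution tests for `u` itself, rather than for its envelope. -/
def SubTest (Ω : Set (EuclideanSpace ℝ (Fin n)))
    (H : EuclideanSpace ℝ (Fin n) → EuclideanSpace ℝ (Fin n) → ℝ)
    (γ : EuclideanSpace ℝ (Fin n) → EuclideanSpace ℝ (Fin n)) (g : EuclideanSpace ℝ (Fin n) → ℝ)
    (a : ℝ) (u : EuclideanSpace ℝ (Fin n) → ℝ) : Prop :=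
  ∀ x ∈ closure Ω, ∀ φ : EuclideanSpace ℝ (Fin n) → ℝ, ContDiff ℝ 1 φ →
    IsMaxOn (fun z => u z - φ z) (closure Ω) x → SubIneq Ω H γ g a x (∇ φ x)

lemma SubIneq.mono {b : ℝ} (hab : a ≤ b) {x p : EuclideanSpace ℝ (Fin n)}
    (h : SubIneq Ω H γ g a x p) :
    SubIneq Ω H γ g b x p :=
  ⟨fun hx => (h.1 hx).trans hab, fun hx => (h.2 hx).imp_left fun h => h.trans hab⟩

lemma SubTest.mono {b : ℝ} (hab : a ≤ b) (h : SubTest Ω H γ g a u) : SubTest Ω H γ g b u :=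
  fun x hx φ hφ hm => (h x hx φ hφ hm).mono hab

lemma isMaxOn_congr_closure {u v φ : EuclideanSpace ℝ (Fin n) → ℝ} (h : ∀ z ∈ closure Ω, u z = v z)
    {x : EuclideanSpace ℝ (Fin n)}
    (hx : x ∈ closure Ω) (hm : IsMaxOn (fun z => u z - φ z) (closure Ω) x) :
    IsMaxOn (fun z => v z - φ z) (closure Ω) x := by
  intro z hz
  have := hm hz
  simp only [mem_ofPred_eq, h z hz, h x hx] at this
  exact this

lemma isSubsolution_iff (hu : UpperSemicontinuousOn u (closure Ω)) :
    IsSubsolution Ω H γ g a u ↔ BddAbove (u '' closure Ω) ∧ SubTest Ω H γ g a u := by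
  refine and_congr_right fun hb => forall₂_congr fun x hx => forall₂_congr fun φ _ => ?_
  have h1 : ∀ z ∈ closure Ω, uscEnvelope Ω u z = u z := fun z hz => uscEnvelope_eq hu hb hz
  exact ⟨fun h hm => h (isMaxOn_congr_closure (fun z hz => (h1 z hz).symm) hx hm),
    fun h hm => h (isMaxOn_congr_closure h1 hx hm)⟩

lemma IsSubsolution.envelope (h : IsSubsolution Ω H γ g a u) :
    UpperSemicontinuousOn (uscEnvelope Ω u) (closure Ω) ∧
      BddAbove (uscEnvelope Ω u '' closure Ω) ∧ SubTest Ω H γ g a (uscEnvelope Ω u) :=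
  ⟨upperSemicontinuousOn_uscEnvelope h.1, bddAbove_uscEnvelope h.1, h.2⟩

/-- Test functions need only be `C¹` near the point, and touch from above only locally. -/
lemma SubTest.local (hu : SubTest Ω H γ g a u) (hb : BddAbove (u '' closure Ω))
    {x : EuclideanSpace ℝ (Fin n)}
    (hx : x ∈ closure Ω) {φ : EuclideanSpace ℝ (Fin n) → ℝ} (hφ : ContDiffAt ℝ 1 φ x)
    (hm : ∀ᶠ z in 𝓝[closure Ω] x, u z - φ z ≤ u x - φ x) : SubIneq Ω H γ g a x (∇ φ x) := by
  obtain ⟨M, hM⟩ := hb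
  obtain ⟨r, hr, h1⟩ := Metric.eventually_nhds_iff.1
    ((hφ.eventually (by simp)).and (eventually_nhdsWithin_iff.1 hm))
  let f : ContDiffBump x := ⟨r / 4, r / 2, by positivity, by linarith⟩
  -- This constant makes `u - C` at most `u x - φ x` everywhere on the closure. Blending φ with it
  -- by a bump function turns `u - φ'` into a convex combination of two functions that respect the
  -- same upper bound.
  set C := M - (u x - φ x)
  set φ' : EuclideanSpace ℝ (Fin n) → ℝ := fun z => f z * φ z + (1 - f z) * C
  have hf0 : ∀ z, r / 2 ≤ dist z x → f z = 0 := fun z hz => f.zero_of_le_dist hz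
  have hφ' : ContDiff ℝ 1 φ' := by
    refine ContDiff.add ?_ ((contDiff_const.sub f.contDiff).mul contDiff_const)
    rw [contDiff_iff_contDiffAt]
    intro z
    rcases lt_or_ge (dist z x) r with hz | hz
    · exact f.contDiff.contDiffAt.mul (h1 hz).1
    · have : (fun z => f z * φ z) =ᶠ[𝓝 z] fun _ => 0 := by
        have h2 : ∀ᶠ w in 𝓝 z, r / 2 < dist w x :=
          (continuous_id.dist continuous_const).continuousAt.eventually
            (lt_mem_nhds (by simp only [id]; linarith))
        filter_upwards [h2] with w hw
        rw [hf0 w hw.le, zero_mul]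
      exact contDiffAt_const.congr_of_eventuallyEq this
  have heq : φ' =ᶠ[𝓝 x] φ := by
    filter_upwards [f.eventuallyEq_one] with z hz
    simp only [φ', hz, Pi.one_apply]
    ring
  have hgrad : ∇ φ' x = ∇ φ x := by simp only [gradient, heq.fderiv_eq]
  rw [← hgrad]
  refine hu x hx φ' hφ' fun z hz => ?_
  change u z - φ' z ≤ u x - φ' x
  rw [heq.eq_of_nhds]
  have hMz : u z - C ≤ u x - φ x := by
    have := hM (mem_image_of_mem u hz)
    simp only [C]; linarith
  have h3 : f z * (u z - φ z) ≤ f z * (u x - φ x) := by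
    rcases lt_or_ge (dist z x) (r / 2) with hzr | hzr
    · exact mul_le_mul_of_nonneg_left ((h1 (by linarith)).2 hz) f.nonneg
    · rw [hf0 z hzr]; simp
  have h4 : (1 - f z) * (u z - C) ≤ (1 - f z) * (u x - φ x) :=
    mul_le_mul_of_nonneg_left hMz (by linarith [f.le_one (x := z)])
  calc u z - φ' z = f z * (u z - φ z) + (1 - f z) * (u z - C) := by simp only [φ']; ring
    _ ≤ f z * (u x - φ x) + (1 - f z) * (u x - φ x) := add_le_add h3 h4
    _ = _ := by ring

/-! ### Lipschitz estimates -/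

/-- A family of functions which is locally equi-Lipschitz on a compact connected set is globally
equi-Lipschitz there. -/
lemma exists_lipschitz_of_local {X : Set (EuclideanSpace ℝ (Fin n))} (hX : IsCompact X)
    (hXc : IsPreconnected X)
    (P : (EuclideanSpace ℝ (Fin n) → ℝ) → Prop)
    (h : ∀ x₀ ∈ X, ∃ r > 0, ∃ K, ∀ f, P f → ∀ x ∈ X, dist x x₀ < r → ∀ x' ∈ X, dist x' x₀ < r →
      f x - f x' ≤ K * ‖x - x'‖) :
    ∃ K ≥ 0, ∀ f, P f → ∀ x ∈ X, ∀ x' ∈ X, f x - f x' ≤ K * ‖x - x'‖ := by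
  -- Chaining local estimates through the connected set bounds increments between distant points
  -- uniformly over the family, which no local estimate gives by itself.
  have h1 : ∀ x ∈ X, ∀ x' ∈ X, ∃ C, ∀ f, P f → f x - f x' ≤ C := by
    intro x hx x' hx'
    refine hXc.induction₂' (fun x x' => ∃ C, ∀ f, P f → f x - f x' ≤ C) (fun z hz => ?_)
      (fun x y z _ _ _ ⟨C, hC⟩ ⟨C', hC'⟩ =>
        ⟨C + C', fun f hf => by linarith [hC f hf, hC' f hf]⟩) hx hx'
    obtain ⟨r, hr, K, hK⟩ := h z hz
    filter_upwards [self_mem_nhdsWithin, mem_nhdsWithin_of_mem_nhds (Metric.ball_mem_nhds z hr)]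
      with w hw hwr
    exact ⟨⟨_, fun f hf => hK f hf z hz (by simpa using hr) w hw hwr⟩,
      ⟨_, fun f hf => hK f hf w hw hwr z hz (by simpa using hr)⟩⟩
  have h2 := (hX.prod hX).induction_on (p := fun s => ∃ K ≥ 0, ∀ f, P f → ∀ z ∈ s ∩ X ×ˢ X,
      f z.1 - f z.2 ≤ K * ‖z.1 - z.2‖) ⟨0, le_rfl, by simp⟩
    (fun s t hst ⟨K, hK0, hK⟩ => ⟨K, hK0, fun f hf z hz => hK f hf z ⟨hst hz.1, hz.2⟩⟩)
    (fun s t ⟨K, hK0, hK⟩ ⟨K', hK0', hK'⟩ => ⟨max K K', le_max_of_le_left hK0, ?_⟩)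
    (fun z hz => ?_)
  · obtain ⟨K, hK0, hK⟩ := h2
    exact ⟨K, hK0, fun f hf x hx x' hx' => hK f hf (x, x') ⟨⟨hx, hx'⟩, ⟨hx, hx'⟩⟩⟩
  · rintro f hf z ⟨hz | hz, hzX⟩
    · exact (hK f hf z ⟨hz, hzX⟩).trans
        (mul_le_mul_of_nonneg_right (le_max_left _ _) (norm_nonneg _))
    · exact (hK' f hf z ⟨hz, hzX⟩).trans
        (mul_le_mul_of_nonneg_right (le_max_right _ _) (norm_nonneg _))
  · obtain ⟨x, x'⟩ := z
    obtain ⟨hx, hx'⟩ := hz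
    simp only at hx hx'
    obtain ⟨r, hr, K, hK⟩ := h x hx
    by_cases hxx : x = x'
    · subst hxx
      refine ⟨Metric.ball x r ×ˢ Metric.ball x r, mem_nhdsWithin_of_mem_nhds
        (prod_mem_nhds (Metric.ball_mem_nhds _ hr) (Metric.ball_mem_nhds _ hr)), |K|,
        abs_nonneg _, fun f hf z hz => ?_⟩
      exact (hK f hf z.1 hz.2.1 hz.1.1 z.2 hz.2.2 hz.1.2).trans
        (mul_le_mul_of_nonneg_right (le_abs_self K) (norm_nonneg _))
    · obtain ⟨r', hr', K', hK'⟩ := h x' hx'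
      obtain ⟨C, hC⟩ := h1 x hx x' hx'
      have hd : 0 < dist x x' := dist_pos.2 hxx
      set d := dist x x'
      have hs : 0 < min r (d / 4) := lt_min hr (by positivity)
      have hs' : 0 < min r' (d / 4) := lt_min hr' (by positivity)
      -- Near a pair of distinct points the increments are bounded and the distances are at least `d
      -- / 2`, so their quotient provides a Lipschitz constant.
      refine ⟨Metric.ball x (min r (d / 4)) ×ˢ Metric.ball x' (min r' (d / 4)),
        mem_nhdsWithin_of_mem_nhds
        (prod_mem_nhds (Metric.ball_mem_nhds _ hs) (Metric.ball_mem_nhds _ hs')),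
        (|K| * d + |K'| * d + |C|) / (d / 2), by positivity, fun f hf z hz => ?_⟩
      obtain ⟨⟨hz1, hz2⟩, hz1X, hz2X⟩ := hz
      rw [Metric.mem_ball, lt_min_iff] at hz1 hz2
      have h3 := hK f hf z.1 hz1X hz1.1 x hx (by simpa using hr)
      have h4 := hK' f hf x' hx' (by simpa using hr') z.2 hz2X hz2.1
      have h5 := hC f hf
      rw [← dist_eq_norm] at h3 h4
      rw [dist_comm] at h4
      have h6 : K * dist z.1 x ≤ |K| * d :=
        mul_le_mul (le_abs_self K) (by linarith) dist_nonneg (abs_nonneg _)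
      have h7 : K' * dist z.2 x' ≤ |K'| * d :=
        mul_le_mul (le_abs_self K') (by linarith) dist_nonneg (abs_nonneg _)
      have h8 : d / 2 ≤ ‖z.1 - z.2‖ := by
        rw [← dist_eq_norm]
        have h9 : d ≤ dist x z.1 + dist z.1 z.2 + dist z.2 x' := dist_triangle4 _ _ _ _
        rw [dist_comm x z.1] at h9
        linarith
      calc f z.1 - f z.2 ≤ |K| * d + |K'| * d + |C| := by linarith [le_abs_self C]
        _ = (|K| * d + |K'| * d + |C|) / (d / 2) * (d / 2) := by field_simp
        _ ≤ _ := by gcongr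


end

section

/-! ### The Lipschitz estimate for subsolutions -/

variable {Ω : Set (EuclideanSpace ℝ (Fin n))}
    {H : EuclideanSpace ℝ (Fin n) → EuclideanSpace ℝ (Fin n) → ℝ}
    {γ : EuclideanSpace ℝ (Fin n) → EuclideanSpace ℝ (Fin n)} {g : EuclideanSpace ℝ (Fin n) → ℝ}
    {a : ℝ} {u : EuclideanSpace ℝ (Fin n) → ℝ}

lemma NeumannData.exists_frontier_bound (D : NeumannData Ω H γ g) :
    ∃ G > 0, ∀ z ∈ frontier Ω, |g z| ≤ G ∧ ‖γ z‖ ≤ G := by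
  obtain ⟨C, hC⟩ := D.isCompact_frontier.exists_bound_of_continuousOn D.continuousOn_g
  obtain ⟨C', hC'⟩ := D.isCompact_frontier.exists_bound_of_continuousOn D.continuousOn_γ
  refine ⟨|C| + |C'| + 1, by positivity, fun z hz => ⟨?_, ?_⟩⟩
  · linarith [hC z hz, Real.norm_eq_abs (g z), le_abs_self C, abs_nonneg C']
  · linarith [hC' z hz, le_abs_self C', abs_nonneg C]

lemma NeumannData.exists_sublevel_bound (D : NeumannData Ω H γ g) (a : ℝ) :
    ∃ R > 0, ∀ x ∈ closure Ω, ∀ p, H x p ≤ a → ‖p‖ ≤ R := by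
  obtain ⟨c, hc, C, h⟩ := D.exists_coercive_bound
  refine ⟨|(a + C) / c| + 1, by positivity, fun x hx p hp => ?_⟩
  have := h x hx p
  have h2 : ‖p‖ ≤ (a + C) / c := by
    rw [le_div_iff₀ hc]; linarith
  linarith [le_abs_self ((a + C) / c)]

/-! ### The tilted gauge and the barrier built from it. -/

lemma IsChart.sqrt_form_bounds {x e : EuclideanSpace ℝ (Fin n)}
    {A : EuclideanSpace ℝ (Fin n) →L[ℝ] EuclideanSpace ℝ (Fin n)} {c : ℝ} (h : IsChart Ω γ x A e c)
    (ξ : EuclideanSpace ℝ (Fin n)) : √c * ‖ξ‖ ≤ √⟪A ξ, ξ⟫ ∧ √⟪A ξ, ξ⟫ ≤ √‖A‖ * ‖ξ‖ := by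
  constructor
  · refine Real.le_sqrt_of_sq_le ?_
    rw [mul_pow, Real.sq_sqrt h.pos.le]
    exact h.coercive ξ
  · refine Real.sqrt_le_iff.2 ⟨by positivity, ?_⟩
    rw [mul_pow, Real.sq_sqrt (norm_nonneg _)]
    calc ⟪A ξ, ξ⟫ ≤ ‖A ξ‖ * ‖ξ‖ := real_inner_le_norm _ _
      _ ≤ ‖A‖ * ‖ξ‖ * ‖ξ‖ := by gcongr; exact A.le_opNorm ξ
      _ = _ := by ring

/-- The tilted gauge `ξ ↦ √⟪A ξ, ξ⟫ + δ ⟪e, ξ⟫` attached to a chart. -/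
def tiltedGauge (A : EuclideanSpace ℝ (Fin n) →L[ℝ] EuclideanSpace ℝ (Fin n))
    (e : EuclideanSpace ℝ (Fin n)) (δ : ℝ) (ξ : EuclideanSpace ℝ (Fin n)) : ℝ := √⟪A ξ,
    ξ⟫ + δ * ⟪e, ξ⟫

lemma continuous_tiltedGauge (A : EuclideanSpace ℝ (Fin n) →L[ℝ] EuclideanSpace ℝ (Fin n))
    (e : EuclideanSpace ℝ (Fin n)) (δ : ℝ) :
    Continuous (tiltedGauge A e δ) := by
  unfold tiltedGauge
  fun_prop

lemma hasGradientAt_tiltedGauge {A : EuclideanSpace ℝ (Fin n) →L[ℝ] EuclideanSpace ℝ (Fin n)}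
    (hA : ∀ ξ ζ, ⟪A ξ, ζ⟫ = ⟪A ζ, ξ⟫) (e : EuclideanSpace ℝ (Fin n))
    (δ : ℝ) {w z : EuclideanSpace ℝ (Fin n)} (hz : 0 < ⟪A (z - w), z - w⟫) :
    HasGradientAt (fun z => tiltedGauge A e δ (z - w))
      ((√⟪A (z - w), z - w⟫)⁻¹ • A (z - w) + δ • e) z := by
  refine hasGradientAt_add ?_ (hasGradientAt_const_mul δ (hasGradientAt_inner e w z))
  have := hasGradientAt_comp (h := Real.sqrt) (f₁ := fun z => ⟪A (z - w), z - w⟫)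
    (Real.hasDerivAt_sqrt hz.ne') (hasGradientAt_form hA w z)
  convert! this using 1
  rw [smul_smul]
  congr 1
  field_simp

lemma contDiffAt_tiltedGauge {A : EuclideanSpace ℝ (Fin n) →L[ℝ] EuclideanSpace ℝ (Fin n)}
    (e : EuclideanSpace ℝ (Fin n)) (δ : ℝ) {w z : EuclideanSpace ℝ (Fin n)}
    (hz : 0 < ⟪A (z - w), z - w⟫) :
    ContDiffAt ℝ 1 (fun z => tiltedGauge A e δ (z - w)) z :=
  ((contDiff_form A w).contDiffAt.sqrt hz.ne').add
    (contDiffAt_const.mul (contDiff_inner_sub e w).contDiffAt)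

/-- The right side is the chord, over `[0, R / 2]`, of the convex function on the left. -/
lemma barrier_le {K R t : ℝ} (hK : 0 ≤ K) (hR : 0 < R) (ht : 0 ≤ t) (htR : t ≤ R / 2) :
    K * (R - t)⁻¹ ≤ K / R + 2 * K / R ^ 2 * t := by
  have h2 : 0 < R - t := by linarith
  rw [mul_inv_le_iff₀ h2]
  have h3 : (K / R + 2 * K / R ^ 2 * t) * (R - t) = K + K / R ^ 2 * t * (R - 2 * t) := by
    field_simp
    ring
  have : 0 ≤ K / R ^ 2 * t * (R - 2 * t) := mul_nonneg (by positivity) (by linarith)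
  linarith

/-- The barrier `K / (R - ℓ(z - x'))` blows up where the tilted gauge ℓ reaches `R`, so `u` minus
the barrier is maximal at an interior point of the region. At a maximum other than `x'` the gradient
of the barrier would be too long for `H ≤ a` and its product with γ too large for the boundary
condition. So the maximum is at `x'`, which bounds `u x - u x'` by the increment of the barrier. -/
lemma NeumannData.exists_local_lipschitz (D : NeumannData Ω H γ g) (a : ℝ)
    {x₀ : EuclideanSpace ℝ (Fin n)}
    (hx₀ : x₀ ∈ closure Ω) : ∃ r > 0, ∃ K, ∀ u, (UpperSemicontinuousOn u (closure Ω) ∧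
      BddAbove (u '' closure Ω) ∧ SubTest Ω H γ g a u) → ∀ x ∈ closure Ω, dist x x₀ < r →
        ∀ x' ∈ closure Ω, dist x' x₀ < r → u x - u x' ≤ K * ‖x - x'‖ := by
  obtain ⟨A, e, c, hchart⟩ := exists_isChart D.isOpen D.c1 D.oblique D.continuousOn_γ hx₀
  have hc := hchart.pos
  set c₁ := √c with hc₁
  have hc₁0 : 0 < c₁ := Real.sqrt_pos.2 hc
  set C₁ := √‖A‖
  have hC₁0 : 0 ≤ C₁ := Real.sqrt_nonneg _
  -- The tilt is kept below half of the lower bound of the square root of the form, so that the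
  -- gauge remains comparable with the norm.
  set δ := c₁ / (2 * (‖e‖ + 1)) with hδ
  have hδ0 : 0 < δ := by positivity
  have hδe : δ * ‖e‖ ≤ c₁ / 2 := by
    calc δ * ‖e‖ ≤ δ * (‖e‖ + 1) := by gcongr; linarith
      _ = c₁ / 2 := by rw [hδ]; field_simp
  set ℓ := tiltedGauge A e δ with hℓ
  have hip : ∀ ξ, |δ * ⟪e, ξ⟫| ≤ c₁ / 2 * ‖ξ‖ := by
    intro ξ
    rw [abs_mul, abs_of_pos hδ0]
    calc δ * |⟪e, ξ⟫| ≤ δ * (‖e‖ * ‖ξ‖) := by gcongr; exact abs_real_inner_le_norm _ _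
      _ = δ * ‖e‖ * ‖ξ‖ := by ring
      _ ≤ _ := by gcongr
  have hℓ1 : ∀ ξ, c₁ / 2 * ‖ξ‖ ≤ ℓ ξ := by
    intro ξ
    have h1 := (hchart.sqrt_form_bounds ξ).1
    have h2 := (abs_le.1 (hip ξ)).1
    rw [hℓ, tiltedGauge]
    linarith
  have hℓ2 : ∀ ξ, ℓ ξ ≤ (C₁ + c₁) * ‖ξ‖ := by
    intro ξ
    have h1 := (hchart.sqrt_form_bounds ξ).2
    have h2 := (abs_le.1 (hip ξ)).2
    rw [hℓ, tiltedGauge]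
    have : 0 ≤ c₁ * ‖ξ‖ := by positivity
    linarith
  obtain ⟨rθ, hrθ, hobl⟩ := hchart.oblique (δ * c₁ / 2) (by positivity)
  obtain ⟨R₀, hR₀, hsub⟩ := D.exists_sublevel_bound a
  obtain ⟨G, hG, hbd⟩ := D.exists_frontier_bound
  -- The region `ℓ < R` around `x'` has radius at most `rθ / 2`, so it stays where the chart
  -- inequalities hold.
  set R := rθ * c₁ / 4 with hR
  have hR0 : 0 < R := by positivity
  -- The derivative of the barrier is at least `K / R ^ 2`. The first summand pushes the gradient
  -- beyond `R₀ + 1`, the second pushes its product with γ beyond `G + 1`.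
  set K := R ^ 2 * (2 * (R₀ + 1) / c₁ + 2 * (G + 1) / δ) with hK
  have hK0 : 0 < K := by positivity
  refine ⟨min (rθ / 2) (R / (4 * (C₁ + c₁))), by positivity, 2 * K * (C₁ + c₁) / R ^ 2, ?_⟩
  rintro u ⟨husc, hbdd, hu⟩ x hx hxr x' hx' hxr'
  rw [lt_min_iff] at hxr hxr'
  have hxx : ‖x - x'‖ < R / (2 * (C₁ + c₁)) := by
    calc ‖x - x'‖ = dist x x' := (dist_eq_norm _ _).symm
      _ ≤ dist x x₀ + dist x' x₀ := dist_triangle_right _ _ _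
      _ < R / (4 * (C₁ + c₁)) + R / (4 * (C₁ + c₁)) := add_lt_add hxr.2 hxr'.2
      _ = _ := by field_simp; norm_num
  have hℓx : ℓ (x - x') ≤ R / 2 := by
    calc ℓ (x - x') ≤ (C₁ + c₁) * ‖x - x'‖ := hℓ2 _
      _ ≤ (C₁ + c₁) * (R / (2 * (C₁ + c₁))) := by gcongr
      _ = R / 2 := by field_simp
  obtain ⟨M, hM⟩ := id hbdd
  have hM' : ∀ z ∈ closure Ω, u z ≤ M := fun z hz => hM (mem_image_of_mem u hz)
  have hMx : 0 ≤ M - u x' := by linarith [hM' x' hx']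
  -- a radius at which the barrier exceeds the oscillation of `u`
  set q := K / (M - u x' + K / R + 1 + 2 * K / R) with hq
  have hden : 0 < M - u x' + K / R + 1 + 2 * K / R := by positivity
  have hq0 : 0 < q := by positivity
  have hqR : q ≤ R / 2 := by
    rw [hq, div_le_iff₀ hden]
    have h1 : R / 2 * (2 * K / R) = K := by field_simp
    have h2 : 0 ≤ R / 2 * (M - u x' + K / R + 1) := by positivity
    nlinarith
  have hKq : M - u x' + K / R < K / q := by
    have : K / q = M - u x' + K / R + 1 + 2 * K / R := by rw [hq]; field_simp
    rw [this]
    have : 0 < 2 * K / R := by positivity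
    linarith
  set S := closure Ω ∩ {z | ℓ (z - x') ≤ R - q} with hS
  have hℓc : Continuous fun z => ℓ (z - x') :=
    (continuous_tiltedGauge A e δ).comp (continuous_id.sub continuous_const)
  have hScomp : IsCompact S := D.isCompact.inter_right (isClosed_le hℓc continuous_const)
  set φ : EuclideanSpace ℝ (Fin n) → ℝ := fun z => K * (R - ℓ (z - x'))⁻¹ with hφ
  have hℓ0 : ℓ (x' - x') = 0 := by simp [hℓ, tiltedGauge]
  have hx'S : x' ∈ S := ⟨hx', show ℓ (x' - x') ≤ R - q by rw [hℓ0]; linarith⟩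
  have hxS : x ∈ S := ⟨hx, show ℓ (x - x') ≤ R - q by linarith⟩
  have hφc : ContinuousOn φ S := by
    refine continuousOn_const.mul (ContinuousOn.inv₀
      (continuousOn_const.sub hℓc.continuousOn) fun z hz => ?_)
    have : ℓ (z - x') ≤ R - q := hz.2
    linarith
  have husc' : UpperSemicontinuousOn (fun z => u z + -φ z) S :=
    (husc.mono inter_subset_left).add hφc.neg.upperSemicontinuousOn
  obtain ⟨z, hzS, hzmax⟩ := husc'.exists_isMaxOn ⟨x', hx'S⟩ hScomp
  have hzX : z ∈ closure Ω := hzS.1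
  have hzx' : u x' - K / R ≤ u z - φ z := by
    have h1 : u x' + -φ x' ≤ u z + -φ z := hzmax hx'S
    have h2 : φ x' = K / R := by simp only [hφ, hℓ0]; rw [sub_zero, div_eq_mul_inv]
    linarith
  have hz_eq : z = x' := by
    by_contra hne
    set ξ := z - x' with hξ
    have hξ0 : 0 < ‖ξ‖ := norm_pos_iff.2 (sub_ne_zero.2 hne)
    have hform : 0 < ⟪A ξ, ξ⟫ := lt_of_lt_of_le (by positivity) (hchart.coercive ξ)
    have hzlt : ℓ ξ < R - q := by
      refine lt_of_le_of_ne hzS.2 fun heq => ?_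
      have h1 : φ z = K / q := by
        simp only [hφ]; rw [← hξ, heq, sub_sub_cancel, div_eq_mul_inv]
      have h2 := hM' z hzX
      linarith
    set s := K * ((R - ℓ ξ) ^ 2)⁻¹ with hs
    have hRl : 0 < R - ℓ ξ := by linarith
    have hℓξ0 : 0 < ℓ ξ := lt_of_lt_of_le (by positivity) (hℓ1 ξ)
    have hsK : K / R ^ 2 ≤ s := by
      rw [hs, ← div_eq_mul_inv]
      exact div_le_div_of_nonneg_left hK0.le (by positivity)
        (pow_le_pow_left₀ hRl.le (by linarith) 2)
    have hKR : K / R ^ 2 = 2 * (R₀ + 1) / c₁ + 2 * (G + 1) / δ := by rw [hK]; field_simp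
    have hs1 : 2 * (R₀ + 1) / c₁ ≤ s := by
      have : 0 < 2 * (G + 1) / δ := by positivity
      linarith
    have hs2 : 2 * (G + 1) / δ ≤ s := by
      have : 0 < 2 * (R₀ + 1) / c₁ := by positivity
      linarith
    have hs0 : 0 < s := lt_of_lt_of_le (by positivity) hs1
    set p₁ := (√⟪A ξ, ξ⟫)⁻¹ • A ξ + δ • e with hp₁
    have hgr1 : HasGradientAt (fun z => ℓ (z - x')) p₁ z :=
      hasGradientAt_tiltedGauge hchart.symm e δ hform
    have hder : HasDerivAt (fun t => K * (R - t)⁻¹) s (ℓ (z - x')) := by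
      have h1 : HasDerivAt (fun t => R - t) (-1) (ℓ (z - x')) := by
        simpa using (hasDerivAt_id (ℓ (z - x'))).const_sub R
      have h2 := (h1.inv hRl.ne').const_mul K
      convert! h2 using 1
      rw [hs, ← hξ]
      field_simp
    have hgr : HasGradientAt φ (s • p₁) z :=
      hasGradientAt_comp (h := fun t => K * (R - t)⁻¹) hder hgr1
    have hφd : ContDiffAt ℝ 1 φ z :=
      contDiffAt_const.mul ((contDiffAt_const.sub
        (contDiffAt_tiltedGauge e δ hform)).inv hRl.ne')
    have hloc : ∀ᶠ w in 𝓝[closure Ω] z, u w - φ w ≤ u z - φ z := by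
      have h1 : ∀ᶠ w in 𝓝 z, ℓ (w - x') < R - q :=
        hℓc.continuousAt.eventually (gt_mem_nhds hzlt)
      filter_upwards [self_mem_nhdsWithin, mem_nhdsWithin_of_mem_nhds h1] with w hw hw1
      have h2 : u w + -φ w ≤ u z + -φ z :=
        hzmax ⟨hw, (show ℓ (w - x') ≤ R - q from le_of_lt hw1)⟩
      linarith
    have htest := hu.local hbdd hzX hφd hloc
    rw [hgr.gradient] at htest
    have hp₁n : c₁ / 2 ≤ ‖p₁‖ := by
      have h1 : ⟪p₁, ξ⟫ = ℓ ξ := by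
        rw [hp₁, inner_add_left, real_inner_smul_left, real_inner_smul_left, hℓ, tiltedGauge]
        congr 1
        rw [inv_mul_eq_div, Real.div_sqrt]
      have h2 := real_inner_le_norm p₁ ξ
      rw [h1] at h2
      exact le_of_mul_le_mul_right ((hℓ1 ξ).trans h2) hξ0
    have hHbig : ¬ H z (s • p₁) ≤ a := by
      intro hle
      have h1 := hsub z hzX _ hle
      rw [norm_smul, Real.norm_of_nonneg hs0.le] at h1
      have h2 : R₀ + 1 ≤ s * ‖p₁‖ := by
        calc R₀ + 1 = 2 * (R₀ + 1) / c₁ * (c₁ / 2) := by field_simp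
          _ ≤ s * ‖p₁‖ := by gcongr
      linarith
    rcases mem_or_mem_frontier hzX with hzΩ | hzΓ
    · exact hHbig (htest.1 hzΩ)
    · rcases htest.2 hzΓ with h1 | h1
      · exact hHbig h1
      · have hzd : dist z x₀ < rθ := by
          have h2 : ‖ξ‖ ≤ rθ / 2 := by
            have h3 : c₁ / 2 * ‖ξ‖ ≤ R := by linarith [hℓ1 ξ]
            rw [hR] at h3
            have h4 : c₁ / 2 * ‖ξ‖ ≤ c₁ / 2 * (rθ / 2) := by linarith
            exact le_of_mul_le_mul_left h4 (by positivity)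
          calc dist z x₀ ≤ dist z x' + dist x' x₀ := dist_triangle _ _ _
            _ < rθ / 2 + rθ / 2 := by
              rw [dist_eq_norm z x']
              exact add_lt_add_of_le_of_lt h2 hxr'.1
            _ = rθ := by ring
        obtain ⟨h2, h3⟩ := hobl z hzΓ hzd
        have h4 := h3 x' hx' (hxr'.1.trans (by linarith))
        rw [← hξ] at h4
        have h5 := (hchart.sqrt_form_bounds ξ).1
        have hsq : 0 < √⟪A ξ, ξ⟫ := Real.sqrt_pos.2 hform
        -- The tilt contributes at least `δ`; the chart inequality, used with accuracy `δ * c₁ / 2`,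
        -- lets the gradient of the square root lose at most `δ / 2`.
        have h6 : δ / 2 ≤ ⟪γ z, p₁⟫ := by
          rw [real_inner_comm p₁ (γ z), hp₁, inner_add_left, real_inner_smul_left,
            real_inner_smul_left]
          have h7 : -(δ / 2) ≤ (√⟪A ξ, ξ⟫)⁻¹ * ⟪A ξ, γ z⟫ := by
            rw [inv_mul_eq_div, le_div_iff₀ hsq]
            have : δ / 2 * (c₁ * ‖ξ‖) ≤ δ / 2 * √⟪A ξ, ξ⟫ := by gcongr
            linarith
          have h8 : δ * 1 ≤ δ * ⟪e, γ z⟫ := by gcongr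
          linarith
        rw [real_inner_smul_right] at h1
        have h7 : G + 1 ≤ s * ⟪γ z, p₁⟫ := by
          calc G + 1 = 2 * (G + 1) / δ * (δ / 2) := by field_simp
            _ ≤ _ := by gcongr
        linarith [(abs_le.1 (hbd z hzΓ).1).2]
  have hxz : u x + -φ x ≤ u z + -φ z := hzmax hxS
  rw [hz_eq] at hxz
  have hφx' : φ x' = K / R := by simp only [hφ, hℓ0]; rw [sub_zero, div_eq_mul_inv]
  have hφx : φ x ≤ K / R + 2 * K / R ^ 2 * ℓ (x - x') :=
    barrier_le hK0.le hR0 (le_trans (by positivity) (hℓ1 _)) hℓx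
  calc u x - u x' ≤ 2 * K / R ^ 2 * ℓ (x - x') := by linarith
    _ ≤ 2 * K / R ^ 2 * ((C₁ + c₁) * ‖x - x'‖) := by gcongr; exact hℓ2 _
    _ = _ := by ring

/-- All upper semicontinuous subsolutions with a given level are equi-Lipschitz. -/
lemma NeumannData.exists_lipschitz (D : NeumannData Ω H γ g) (a : ℝ) :
    ∃ K ≥ 0, ∀ u, (UpperSemicontinuousOn u (closure Ω) ∧ BddAbove (u '' closure Ω) ∧
      SubTest Ω H γ g a u) → ∀ x ∈ closure Ω, ∀ x' ∈ closure Ω, u x - u x' ≤ K * ‖x - x'‖ :=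
  exists_lipschitz_of_local D.isCompact D.isConnected.isPreconnected.closure _
    fun _ hx₀ => D.exists_local_lipschitz a hx₀


end

section

/-! ### Stability of subsolutions -/

variable {Ω : Set (EuclideanSpace ℝ (Fin n))}
    {H : EuclideanSpace ℝ (Fin n) → EuclideanSpace ℝ (Fin n) → ℝ}
    {γ : EuclideanSpace ℝ (Fin n) → EuclideanSpace ℝ (Fin n)} {g : EuclideanSpace ℝ (Fin n) → ℝ}
    {a : ℝ} {u w : EuclideanSpace ℝ (Fin n) → ℝ}

lemma continuousOn_of_lipschitz {X : Set (EuclideanSpace ℝ (Fin n))} {K : ℝ}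
    (h : ∀ x ∈ X, ∀ x' ∈ X, u x - u x' ≤ K * ‖x - x'‖) : ContinuousOn u X := by
  refine LipschitzOnWith.continuousOn (K := K.toNNReal) (LipschitzOnWith.of_dist_le_mul ?_)
  intro x hx x' hx'
  rw [Real.dist_eq, dist_eq_norm]
  have h1 : K * ‖x - x'‖ ≤ (K.toNNReal : ℝ) * ‖x - x'‖ :=
    mul_le_mul_of_nonneg_right (Real.le_coe_toNNReal K) (norm_nonneg _)
  have h2 := h x' hx' x hx
  rw [norm_sub_rev] at h2
  exact abs_le.2 ⟨by linarith, by linarith [h x hx x' hx']⟩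

lemma NeumannData.tendsto_boundary (D : NeumannData Ω H γ g) {x : EuclideanSpace ℝ (Fin n)}
    (hx : x ∈ frontier Ω)
    (p : EuclideanSpace ℝ (Fin n)) : Tendsto (fun z : EuclideanSpace ℝ (Fin n) × EuclideanSpace ℝ
        (Fin n) => ⟪γ z.1, z.2⟫ - g z.1) (𝓝[frontier Ω] x ×ˢ 𝓝 p)
      (𝓝 (⟪γ x, p⟫ - g x)) :=
  (((D.continuousOn_γ x hx).tendsto.comp tendsto_fst).inner tendsto_snd).sub
    ((D.continuousOn_g x hx).tendsto.comp tendsto_fst)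

lemma NeumannData.exists_boundary_radius (D : NeumannData Ω H γ g) {x : EuclideanSpace ℝ (Fin n)}
    (hx : x ∈ closure Ω) (p : EuclideanSpace ℝ (Fin n)) {ε : ℝ} (hε : 0 < ε) :
    ∃ r > 0, (x ∈ Ω → ∀ z ∈ frontier Ω, ¬ dist z x < r) ∧
      (x ∈ frontier Ω → ∀ z ∈ frontier Ω, dist z x < r → ∀ q, ‖q - p‖ < r →
        |(⟪γ z, q⟫ - g z) - (⟪γ x, p⟫ - g x)| < ε) := by
  rcases mem_or_mem_frontier hx with h | h
  · obtain ⟨r, hr, -, h1⟩ := exists_ball_disjoint_frontier D.isOpen h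
    exact ⟨r, hr, fun _ => h1, fun h2 => absurd h (notMem_of_mem_frontier D.isOpen h2)⟩
  · have h1 := (Metric.tendsto_nhds.1 (D.tendsto_boundary h p)) ε hε
    rw [(Metric.nhdsWithin_basis_ball.prod Metric.nhds_basis_ball).eventually_iff] at h1
    obtain ⟨⟨r₁, r₂⟩, ⟨hr₁, hr₂⟩, h1⟩ := h1
    simp only at hr₁ hr₂
    refine ⟨min r₁ r₂, lt_min hr₁ hr₂,
      fun h2 => absurd h2 (notMem_of_mem_frontier D.isOpen h), fun _ z hz hzx q hq => ?_⟩
    have := h1 (x := (z, q)) ⟨⟨hzx.trans_le (min_le_left _ _), hz⟩, by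
      rw [Metric.mem_ball, dist_eq_norm]; exact hq.trans_le (min_le_right _ _)⟩
    rwa [Real.dist_eq] at this

/-- The subsolution inequalities are stable under perturbation. -/
lemma NeumannData.subIneq_of_approx (D : NeumannData Ω H γ g) {x p : EuclideanSpace ℝ (Fin n)}
    (hx : x ∈ closure Ω)
    (h : ∀ ε > 0, ∃ x' ∈ closure Ω, ∃ p', dist x' x < ε ∧ ‖p' - p‖ < ε ∧
      SubIneq Ω H γ g (a + ε) x' p') : SubIneq Ω H γ g a x p := by
  -- If both alternatives failed at `(x, p)` with a common margin, they would fail at all nearby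
  -- `(x', p')` as well.
  have key : ∀ η > 0, a + η < H x p → (x ∈ frontier Ω → η < ⟪γ x, p⟫ - g x) → False := by
    intro η hη hH hB
    obtain ⟨δ, hδ, hmod⟩ := D.exists_modulus (‖p‖ + 1) (half_pos hη)
    obtain ⟨r, hr, hr1, hr2⟩ := D.exists_boundary_radius hx p hη
    set ε := min (min δ r) (min (η / 2) 1)
    have hε : 0 < ε := by positivity
    have hε1 : ε ≤ δ := (min_le_left _ _).trans (min_le_left _ _)
    have hε2 : ε ≤ r := (min_le_left _ _).trans (min_le_right _ _)
    have hε3 : ε ≤ η / 2 := (min_le_right _ _).trans (min_le_left _ _)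
    have hε4 : ε ≤ 1 := (min_le_right _ _).trans (min_le_right _ _)
    obtain ⟨x', hx', p', hd, hp, hs⟩ := h ε hε
    have hp' : ‖p'‖ ≤ ‖p‖ + 1 := by
      calc ‖p'‖ = ‖p + (p' - p)‖ := by rw [add_sub_cancel]
        _ ≤ _ := (norm_add_le _ _).trans (by linarith)
    have h1 := hmod x' hx' x hx p' p hp' (by linarith) (hd.trans_le hε1) (hp.trans_le hε1)
    have h2 : ¬ H x' p' ≤ a + ε := by
      have := (abs_lt.1 h1).1
      intro h3
      linarith
    rcases mem_or_mem_frontier hx' with hx'Ω | hx'Γ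
    · exact h2 (hs.1 hx'Ω)
    · rcases hs.2 hx'Γ with h3 | h3
      · exact h2 h3
      · rcases mem_or_mem_frontier hx with hxΩ | hxΓ
        · exact hr1 hxΩ x' hx'Γ (hd.trans_le hε2)
        · have h4 := hr2 hxΓ x' hx'Γ (hd.trans_le hε2) p' (hp.trans_le hε2)
          have := hB hxΓ
          linarith [(abs_lt.1 h4).1]
  refine ⟨fun hxΩ => ?_, fun hxΓ => ?_⟩
  · by_contra! hlt
    exact key ((H x p - a) / 2) (by linarith) (by linarith)
      fun h => absurd hxΩ (notMem_of_mem_frontier D.isOpen h)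
  · by_contra! hlt
    refine key (min ((H x p - a) / 2) ((⟪γ x, p⟫ - g x) / 2)) (lt_min (by linarith) (by linarith))
      ?_ fun _ => ?_
    · linarith [min_le_left ((H x p - a) / 2) ((⟪γ x, p⟫ - g x) / 2)]
    · linarith [min_le_right ((H x p - a) / 2) ((⟪γ x, p⟫ - g x) / 2)]

/-- Suprema and locally uniform limits of subsolutions are subsolutions. -/
lemma NeumannData.subTest_of_approx (D : NeumannData Ω H γ g)
    (h : ∀ x ∈ closure Ω, ∀ ε > 0, ∃ u, UpperSemicontinuousOn u (closure Ω) ∧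
      SubTest Ω H γ g (a + ε) u ∧ (∀ z ∈ closure Ω, u z ≤ w z + ε) ∧ w x - ε ≤ u x) :
    SubTest Ω H γ g a w := by
  intro x hx φ hφ hmax
  refine D.subIneq_of_approx hx fun η hη => ?_
  have hcont := (continuous_gradient hφ).continuousAt (x := x)
  obtain ⟨r, hr, hr1⟩ := Metric.continuousAt_iff.1 hcont (η / 2) (half_pos hη)
  set ρ := min r (η / 4)
  have hρ : 0 < ρ := by positivity
  set ε := min (η / 2) (ρ ^ 2 / 4)
  have hε : 0 < ε := by positivity
  obtain ⟨u, husc, hu, hle, hge⟩ := h x hx ε hε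
  -- The added square makes the maximum strict, forcing maximum points of `u - φ'` to within `√(2ε)`
  -- of `x`.
  set φ' : EuclideanSpace ℝ (Fin n) → ℝ := fun z => φ z + ‖z - x‖ ^ 2
  have hφ' : ContDiff ℝ 1 φ' := hφ.add (contDiff_norm_sub_sq x)
  have husc' : UpperSemicontinuousOn (fun z => u z + -φ' z) (closure Ω) :=
    husc.add (hφ'.continuous.neg.upperSemicontinuous.upperSemicontinuousOn _)
  obtain ⟨z, hz, hzm⟩ := husc'.exists_isMaxOn ⟨x, hx⟩ D.isCompact
  have h1 : u x + -φ' x ≤ u z + -φ' z := hzm hx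
  have h2 : w z - φ z ≤ w x - φ x := hmax hz
  have h3 := hle z hz
  have h4 : ‖z - x‖ ^ 2 ≤ 2 * ε := by
    simp only [φ', sub_self, norm_zero] at h1
    linarith
  have h5 : ‖z - x‖ < ρ := by
    have : ‖z - x‖ ^ 2 < ρ ^ 2 := by
      have : ε ≤ ρ ^ 2 / 4 := min_le_right _ _
      nlinarith [pow_pos hρ 2]
    exact lt_of_pow_lt_pow_left₀ 2 hρ.le this
  have hg : ∇ φ' z = ∇ φ z + (2 : ℝ) • (z - x) :=
    (hasGradientAt_add (contDiff_hasGradientAt hφ z) (hasGradientAt_norm_sub_sq x z)).gradient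
  have htest := hu z hz φ' hφ' fun y hy => by
    have : u y + -φ' y ≤ u z + -φ' z := hzm hy
    change u y - φ' y ≤ u z - φ' z
    linarith
  have hρ1 : ρ ≤ r := min_le_left _ _
  have hρ2 : ρ ≤ η / 4 := min_le_right _ _
  refine ⟨z, hz, ∇ φ' z, by rw [dist_eq_norm]; linarith, ?_, htest.mono ?_⟩
  · rw [hg]
    have h6 := hr1 (by rw [dist_eq_norm]; linarith : dist z x < r)
    rw [dist_eq_norm] at h6
    calc ‖∇ φ z + (2 : ℝ) • (z - x) - ∇ φ x‖ = ‖(∇ φ z - ∇ φ x) + (2 : ℝ) • (z - x)‖ := by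
          congr 1; abel
      _ ≤ ‖∇ φ z - ∇ φ x‖ + 2 * ‖z - x‖ :=
          (norm_add_le _ _).trans (by rw [norm_smul, Real.norm_of_nonneg zero_le_two])
      _ < η := by linarith
  · have : ε ≤ η / 2 := min_le_left _ _
    linarith

lemma SubTest.sub_const (hu : SubTest Ω H γ g a u) (c : ℝ) :
    SubTest Ω H γ g a (fun z => u z - c) := by
  intro x hx φ hφ hm
  refine hu x hx φ hφ fun z hz => ?_
  have : u z - c - φ z ≤ u x - c - φ x := hm hz
  change u z - φ z ≤ u x - φ x
  linarith

/-! ### Existence of critical subsolutions -/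

lemma exists_subsolution_of_criticalValue (hc : criticalValue Ω H γ g = 0) {ε : ℝ} (hε : 0 < ε) :
    ∃ u, UpperSemicontinuousOn u (closure Ω) ∧ BddAbove (u '' closure Ω) ∧
      SubTest Ω H γ g ε u := by
  have h1 : criticalValue Ω H γ g < (ε : EReal) := by
    rw [hc]; exact_mod_cast hε
  obtain ⟨e, ⟨b, ⟨u, hu⟩, rfl⟩, hb⟩ := sInf_lt_iff.1 h1
  have hbε : b ≤ ε := (EReal.coe_lt_coe_iff.1 hb).le
  obtain ⟨h1, h2, h3⟩ := hu.envelope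
  exact ⟨_, h1, h2, h3.mono hbε⟩

/-- The infimum defining the critical value is attained: subsolutions at levels `1 / (k + 1)`,
normalized at one point, are equi-Lipschitz, so they have a limit, and the subsolution property is
stable. -/
lemma NeumannData.exists_critical_subsolution (D : NeumannData Ω H γ g)
    (hc : criticalValue Ω H γ g = 0) :
    ∃ u, UpperSemicontinuousOn u (closure Ω) ∧ BddAbove (u '' closure Ω) ∧
      SubTest Ω H γ g 0 u := by
  obtain ⟨K, hK0, hK⟩ := D.exists_lipschitz 1
  obtain ⟨x₀, hx₀⟩ := D.isConnected.nonempty.closure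
  have hpos : ∀ k : ℕ, (0 : ℝ) < 1 / ((k : ℝ) + 1) := fun k => Nat.one_div_pos_of_nat
  have hle1 : ∀ k : ℕ, 1 / ((k : ℝ) + 1) ≤ 1 := fun k => by
    rw [div_le_one (by positivity)]; linarith [Nat.cast_nonneg (α := ℝ) k]
  choose u husc hub hut using fun k : ℕ => exists_subsolution_of_criticalValue hc (hpos k)
  set v : ℕ → EuclideanSpace ℝ (Fin n) → ℝ := fun k z => u k z - u k x₀ with hv
  have hvL : ∀ k, ∀ x ∈ closure Ω, ∀ x' ∈ closure Ω, v k x - v k x' ≤ K * ‖x - x'‖ := by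
    intro k x hx x' hx'
    have := hK (u k) ⟨husc k, hub k, (hut k).mono (hle1 k)⟩ x hx x' hx'
    simp only [hv]; linarith
  have hv0 : ∀ k, v k x₀ = 0 := fun k => sub_self _
  -- Limits along an ultrafilter exist at all points simultaneously and replace the extraction of a
  -- subsequence.
  let F := hyperfilter ℕ
  have hlim : ∀ z, ∃ l, z ∈ closure Ω → Tendsto (fun k => v k z) F (𝓝 l) := by
    intro z
    by_cases hz : z ∈ closure Ω
    · have hmem : ∀ k, v k z ∈ Icc (-(K * ‖x₀ - z‖)) (K * ‖z - x₀‖) := by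
        intro k
        have h1 := hvL k z hz x₀ hx₀
        have h2 := hvL k x₀ hx₀ z hz
        rw [hv0] at h1 h2
        exact ⟨by linarith, by linarith⟩
      obtain ⟨l, -, hl⟩ := isCompact_Icc.ultrafilter_le_nhds (F.map fun k => v k z)
        (le_principal_iff.2 (mem_map.2 (Eventually.of_forall (f := (F : Filter ℕ)) hmem)))
      exact ⟨l, fun _ => hl⟩
    · exact ⟨0, fun h => absurd h hz⟩
  choose w hw using hlim
  have hwL : ∀ x ∈ closure Ω, ∀ x' ∈ closure Ω, w x - w x' ≤ K * ‖x - x'‖ := fun x hx x' hx' =>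
    le_of_tendsto ((hw x hx).sub (hw x' hx')) (Eventually.of_forall fun k => hvL k x hx x' hx')
  have hwc := continuousOn_of_lipschitz hwL
  refine ⟨w, hwc.upperSemicontinuousOn, (D.isCompact.image_of_continuousOn hwc).bddAbove,
    D.subTest_of_approx fun x hx ε hε => ?_⟩
  -- Closeness on a finite net together with the common Lipschitz constant gives closeness on the
  -- whole closure.
  obtain ⟨t, htX, htf, ht⟩ := D.isCompact.finite_cover_balls
    (show 0 < ε / (3 * (K + 1)) by positivity)
  have hev : ∀ᶠ k in (F : Filter ℕ), ∀ c ∈ t, |v k c - w c| < ε / 3 :=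
    (htf.eventually_all).2 fun c hct => by
      have := (Metric.tendsto_nhds.1 (hw c (htX hct))) (ε / 3) (by positivity)
      simpa only [Real.dist_eq] using this
  have hat : (F : Filter ℕ) ≤ atTop := Nat.hyperfilter_le_atTop
  have hev2 : ∀ᶠ k : ℕ in (F : Filter ℕ), 1 / ((k : ℝ) + 1) < ε :=
    hat (tendsto_one_div_add_atTop_nhds_zero_nat.eventually (gt_mem_nhds hε))
  obtain ⟨k, hk1, hk2⟩ := (hev.and hev2).exists
  have hclose : ∀ z ∈ closure Ω, |v k z - w z| ≤ ε := by
    intro z hz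
    obtain ⟨c, hct, hzc⟩ := mem_iUnion₂.1 (ht hz)
    have hcX := htX hct
    rw [Metric.mem_ball, dist_eq_norm] at hzc
    have hKz : K * ‖z - c‖ ≤ ε / 3 := by
      calc K * ‖z - c‖ ≤ (K + 1) * (ε / (3 * (K + 1))) := by gcongr; linarith
        _ = ε / 3 := by field_simp
    have h1 := hvL k z hz c hcX
    have h2 := hvL k c hcX z hz
    have h3 := hwL z hz c hcX
    have h4 := hwL c hcX z hz
    rw [norm_sub_rev] at h2 h4
    have h5 := abs_lt.1 (hk1 c hct)
    exact abs_le.2 ⟨by linarith [h5.1], by linarith [h5.2]⟩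
  refine ⟨v k, ?_, ?_, fun z hz => ?_, ?_⟩
  · exact (continuousOn_of_lipschitz (hvL k)).upperSemicontinuousOn
  · exact ((hut k).sub_const _).mono (by linarith)
  · linarith [(abs_le.1 (hclose z hz)).2]
  · linarith [(abs_le.1 (hclose x hx)).1]

/-! ### The intrinsic distance -/

/-- The distance function `d(·, y)` is real valued, Lipschitz, and a subsolution. -/
lemma NeumannData.exists_dist (D : NeumannData Ω H γ g) (hc : criticalValue Ω H γ g = 0)
    {y : EuclideanSpace ℝ (Fin n)}
    (hy : y ∈ closure Ω) :
    ∃ d : EuclideanSpace ℝ (Fin n) → ℝ, (∀ x ∈ closure Ω, dist0 Ω H γ g x y = (d x : EReal)) ∧ d y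
        = 0 ∧
      (∃ K ≥ 0, ∀ x ∈ closure Ω, ∀ x' ∈ closure Ω, d x - d x' ≤ K * ‖x - x'‖) ∧
      SubTest Ω H γ g 0 d ∧
      ∀ v, UpperSemicontinuousOn v (closure Ω) → BddAbove (v '' closure Ω) →
        SubTest Ω H γ g 0 v → ∀ x ∈ closure Ω, v x - v y ≤ d x := by
  obtain ⟨K, hK0, hK⟩ := D.exists_lipschitz 0
  obtain ⟨u₀, hu₀⟩ := D.exists_critical_subsolution hc
  let S : Set (EuclideanSpace ℝ (Fin n) → ℝ) :=
      {v | UpperSemicontinuousOn v (closure Ω) ∧ BddAbove (v '' closure Ω) ∧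
      SubTest Ω H γ g 0 v}
  let T : EuclideanSpace ℝ (Fin n) → Set ℝ := fun x =>
      (fun v : EuclideanSpace ℝ (Fin n) → ℝ => v x - v y) '' S
  have hTne : ∀ x, (T x).Nonempty := fun x => ⟨_, mem_image_of_mem _ (show u₀ ∈ S from hu₀)⟩
  have hTbd : ∀ x ∈ closure Ω, BddAbove (T x) := fun x hx => by
    refine ⟨K * ‖x - y‖, ?_⟩
    rintro _ ⟨v, hv, rfl⟩
    exact hK v hv x hx y hy
  set d : EuclideanSpace ℝ (Fin n) → ℝ := fun x => sSup (T x) with hd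
  have hle : ∀ v ∈ S, ∀ x ∈ closure Ω, v x - v y ≤ d x := fun v hv x hx =>
    le_csSup (hTbd x hx) (mem_image_of_mem (fun v : EuclideanSpace ℝ (Fin n) → ℝ => v x - v y) hv)
  have hdL : ∀ x ∈ closure Ω, ∀ x' ∈ closure Ω, d x - d x' ≤ K * ‖x - x'‖ := by
    intro x hx x' hx'
    rw [sub_le_iff_le_add]
    refine csSup_le (hTne x) ?_
    rintro _ ⟨v, hv, rfl⟩
    have h1 := hK v hv x hx x' hx'
    have h2 := hle v hv x' hx'
    simp only
    linarith
  refine ⟨d, fun x hx => ?_, ?_, ⟨K, hK0, hdL⟩, ?_, fun v h1 h2 h3 x hx => hle v ⟨h1, h2, h3⟩ x hx⟩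
  · refine IsLUB.sSup_eq ⟨?_, fun b hb => ?_⟩
    · rintro _ ⟨v, hv1, hv2, rfl⟩
      have hv3 := (isSubsolution_iff hv1).1 hv2
      exact EReal.coe_le_coe_iff.2 (hle v ⟨hv1, hv3⟩ x hx)
    · have hb' : ∀ v ∈ S, ((v x - v y : ℝ) : EReal) ≤ b := fun v hv =>
        hb ⟨v, hv.1, (isSubsolution_iff hv.1).2 hv.2, rfl⟩
      induction b with
      | bot => exact absurd (hb' u₀ hu₀) (by simp [-EReal.coe_sub])
      | top => exact le_top
      | coe b =>
        refine EReal.coe_le_coe_iff.2 (csSup_le (hTne x) ?_)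
        rintro _ ⟨v, hv, rfl⟩
        exact EReal.coe_le_coe_iff.1 (hb' v hv)
  · have : T y = {0} := by
      refine Set.eq_singleton_iff_nonempty_unique_mem.2 ⟨hTne y, ?_⟩
      rintro _ ⟨v, -, rfl⟩
      exact sub_self _
    simp [hd, this]
  · refine D.subTest_of_approx fun x hx ε hε => ?_
    obtain ⟨_, ⟨v, hv, rfl⟩, hlt⟩ := exists_lt_of_lt_csSup (hTne x) (show d x - ε < d x by linarith)
    refine ⟨fun z => v z - v y, ?_, (hv.2.2.sub_const _).mono (by linarith), fun z hz => ?_, hlt.le⟩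
    · simpa only [sub_eq_add_neg] using hv.1.add continuousOn_const.upperSemicontinuousOn
    · linarith [hle v hv z hz]

/-! ### Perron's bump construction -/

lemma eventually_lt_of_deriv_pos {f : ℝ → ℝ} {f' : ℝ} (hf : HasDerivAt f f' 0) (h : 0 < f') :
    ∀ᶠ s in 𝓝[>] (0 : ℝ), f 0 < f s := by
  have h1 := (hasDerivAt_iff_tendsto_slope.1 hf).eventually (lt_mem_nhds h)
  have h2 : 𝓝[>] (0 : ℝ) ≤ 𝓝[≠] 0 := nhdsWithin_mono 0 fun x hx => ne_of_gt hx
  filter_upwards [h2 h1, self_mem_nhdsWithin] with s hs hs0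
  rw [slope_def_field, sub_zero] at hs
  have := (div_pos_iff_of_pos_right hs0).1 hs
  linarith

/-- Comparison of gradients of two `C¹` functions at a maximum of their difference. -/
lemma NeumannData.gradient_of_isMaxOn (D : NeumannData Ω H γ g) {φ ψ : EuclideanSpace ℝ (Fin n) → ℝ}
    (hφ : ContDiff ℝ 1 φ) (hψ : ContDiff ℝ 1 ψ) {z : EuclideanSpace ℝ (Fin n)}
    (hm : IsMaxOn (fun z => φ z - ψ z) (closure Ω) z) :
    (z ∈ Ω → ∇ ψ z = ∇ φ z) ∧ (z ∈ frontier Ω → ⟪γ z, ∇ ψ z⟫ ≤ ⟪γ z, ∇ φ z⟫) := by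
  have hgr := hasGradientAt_sub (contDiff_hasGradientAt hφ z) (contDiff_hasGradientAt hψ z)
  constructor
  · intro hz
    have h1 : IsLocalMax (fun z => φ z - ψ z) z :=
      hm.isLocalMax (mem_of_superset (D.isOpen.mem_nhds hz) subset_closure)
    have h2 := h1.hasFDerivAt_eq_zero hgr.hasFDerivAt
    rw [map_eq_zero_iff _ (LinearIsometryEquiv.injective _), sub_eq_zero] at h2
    exact h2.symm
  · intro hz
    -- Otherwise moving from `z` along `-γ z`, which enters Ω, would increase the difference.
    by_contra! hlt
    have h1 : HasDerivAt (fun s : ℝ => z - s • γ z) (-γ z) 0 := by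
      simpa using ((hasDerivAt_id (0 : ℝ)).smul_const (γ z)).const_sub z
    have h0 : z - (0 : ℝ) • γ z = z := by simp
    have h2 : HasDerivAt (fun s : ℝ => φ (z - s • γ z) - ψ (z - s • γ z))
        (⟪∇ φ z - ∇ ψ z, -γ z⟫) 0 := by
      have h3 := (h0.symm ▸ hgr.hasFDerivAt : HasFDerivAt (fun z => φ z - ψ z)
        (InnerProductSpace.toDual ℝ (EuclideanSpace ℝ (Fin n)) (∇ φ z - ∇ ψ z))
        (z - (0 : ℝ) • γ z)).comp_hasDerivAt (0 : ℝ) h1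
      rwa [InnerProductSpace.toDual_apply_apply] at h3
    have h3 : 0 < ⟪∇ φ z - ∇ ψ z, -γ z⟫ := by
      rw [inner_neg_right, inner_sub_left, real_inner_comm (γ z), real_inner_comm (γ z)]
      linarith
    obtain ⟨s, hs1, hs2⟩ := ((eventually_lt_of_deriv_pos h2 h3).and
      (eventually_sub_smul_mem D.isOpen D.c1 D.oblique hz)).exists
    have h4 : φ (z - s • γ z) - ψ (z - s • γ z) ≤ φ z - ψ z := hm (subset_closure hs2)
    rw [h0] at hs1
    linarith

/-- If a subsolution `w` fails the supersolution test at `x`, it can be replaced by a larger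
subsolution which is smooth and strict near `x`. -/
lemma NeumannData.exists_bump (D : NeumannData Ω H γ g) (hwc : ContinuousOn w (closure Ω))
    (hw : SubTest Ω H γ g 0 w) {x : EuclideanSpace ℝ (Fin n)} (hx : x ∈ closure Ω)
        {φ : EuclideanSpace ℝ (Fin n) → ℝ} (hφ : ContDiff ℝ 1 φ)
    (hm : IsMinOn (fun z => w z - φ z) (closure Ω) x) (hH : H x (∇ φ x) < 0)
    (hB : x ∈ frontier Ω → ⟪γ x, ∇ φ x⟫ < g x) {r₀ : ℝ} (hr₀ : 0 < r₀) :
    ∃ W φ' : EuclideanSpace ℝ (Fin n) → ℝ, ContinuousOn W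
        (closure Ω) ∧ SubTest Ω H γ g 0 W ∧ w x < W x ∧
      (∀ z ∈ closure Ω, r₀ ≤ dist z x → W z = w z) ∧ ContDiff ℝ 1 φ' ∧
      ∃ c > 0, ∀ z ∈ closure Ω, dist z x < c → W z = φ' z ∧
        (∀ q, ‖q - ∇ φ' z‖ ≤ c → H z q ≤ -c) ∧ (z ∈ frontier Ω → ⟪γ z, ∇ φ' z⟫ ≤ g z - c) := by
  set p := ∇ φ x
  obtain ⟨η, hη, hstrict⟩ : ∃ η > 0, ∀ z ∈ closure Ω, dist z x < η → ∀ q, ‖q - p‖ < η →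
      H z q ≤ -η ∧ (z ∈ frontier Ω → ⟪γ z, q⟫ ≤ g z - η) := by
    obtain ⟨b, hb, hb1, hb2⟩ : ∃ b > 0, H x p ≤ -(2 * b) ∧
        (x ∈ frontier Ω → ⟪γ x, p⟫ - g x ≤ -(2 * b)) := by
      by_cases hxΓ : x ∈ frontier Ω
      · have := hB hxΓ
        refine ⟨min (-H x p / 2) ((g x - ⟪γ x, p⟫) / 2), lt_min (by linarith) (by linarith), ?_,
          fun _ => ?_⟩
        · linarith [min_le_left (-H x p / 2) ((g x - ⟪γ x, p⟫) / 2)]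
        · linarith [min_le_right (-H x p / 2) ((g x - ⟪γ x, p⟫) / 2)]
      · exact ⟨-H x p / 2, by linarith, by linarith, fun h => absurd h hxΓ⟩
    obtain ⟨δ, hδ, hmod⟩ := D.exists_modulus (‖p‖ + 1) hb
    obtain ⟨r, hr, hr1, hr2⟩ := D.exists_boundary_radius hx p hb
    refine ⟨min (min δ r) (min b 1), by positivity, fun z hz hzx q hq => ?_⟩
    have hε1 : min (min δ r) (min b 1) ≤ δ := (min_le_left _ _).trans (min_le_left _ _)
    have hε2 : min (min δ r) (min b 1) ≤ r := (min_le_left _ _).trans (min_le_right _ _)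
    have hε3 : min (min δ r) (min b 1) ≤ b := (min_le_right _ _).trans (min_le_left _ _)
    have hε4 : min (min δ r) (min b 1) ≤ 1 := (min_le_right _ _).trans (min_le_right _ _)
    have hq' : ‖q‖ ≤ ‖p‖ + 1 := by
      calc ‖q‖ = ‖p + (q - p)‖ := by rw [add_sub_cancel]
        _ ≤ _ := (norm_add_le _ _).trans (by linarith)
    have h1 := hmod z hz x hx q p hq' (by linarith) (hzx.trans_le hε1) (hq.trans_le hε1)
    refine ⟨by linarith [(abs_lt.1 h1).2], fun hzΓ => ?_⟩
    rcases mem_or_mem_frontier hx with hxΩ | hxΓ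
    · exact absurd (hzx.trans_le hε2) (hr1 hxΩ z hzΓ)
    · have h2 := hr2 hxΓ z hzΓ (hzx.trans_le hε2) q (hq.trans_le hε2)
      linarith [(abs_lt.1 h2).2, hb2 hxΓ]
  obtain ⟨r₁, hr₁, hgrad⟩ := Metric.continuousAt_iff.1
    ((continuous_gradient hφ).continuousAt (x := x)) (η / 4) (by positivity)
  set r := min (min r₀ r₁) (η / 8)
  have hr : 0 < r := by positivity
  have hrr₀ : r ≤ r₀ := (min_le_left _ _).trans (min_le_left _ _)
  have hrr₁ : r ≤ r₁ := (min_le_left _ _).trans (min_le_right _ _)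
  have hrη : r ≤ η / 8 := min_le_right _ _
  -- Lifting φ by `δ` above `w` at `x` and subtracting `‖z - x‖ ^ 2` leaves it below `w` outside the
  -- ball of radius `r`, because `δ < r ^ 2`.
  set δ := r ^ 2 / 2
  have hδ : 0 < δ := by positivity
  set φ' : EuclideanSpace ℝ (Fin n) → ℝ := fun z => φ z + (w x - φ x + δ) - ‖z - x‖ ^ 2 with hφ'def
  have hφ' : ContDiff ℝ 1 φ' := (hφ.add contDiff_const).sub (contDiff_norm_sub_sq x)
  have hgr : ∀ z, ∇ φ' z = ∇ φ z - (2 : ℝ) • (z - x) := fun z => by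
    have h1 : HasGradientAt (fun z => φ z + (w x - φ x + δ)) (∇ φ z) z := by
      have := (contDiff_hasGradientAt hφ z).hasFDerivAt.add_const (w x - φ x + δ)
      exact hasGradientAt_iff_hasFDerivAt.2 this
    exact (hasGradientAt_sub h1 (hasGradientAt_norm_sub_sq x z)).gradient
  have hgr' : ∀ z, dist z x < r → ‖∇ φ' z - p‖ < η / 2 := by
    intro z hz
    have h1 := hgrad (hz.trans_le hrr₁)
    rw [dist_eq_norm] at h1 hz
    rw [hgr]
    calc ‖∇ φ z - (2 : ℝ) • (z - x) - p‖ = ‖(∇ φ z - p) - (2 : ℝ) • (z - x)‖ := by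
          congr 1; abel
      _ ≤ ‖∇ φ z - p‖ + 2 * ‖z - x‖ :=
          (norm_sub_le _ _).trans (by rw [norm_smul, Real.norm_of_nonneg zero_le_two])
      _ < η / 2 := by linarith
  have hlt : ∀ z ∈ closure Ω, r ≤ dist z x → φ' z < w z := by
    intro z hz hzr
    have h1 : w x - φ x ≤ w z - φ z := hm hz
    have h2 : r ^ 2 ≤ ‖z - x‖ ^ 2 := by
      rw [← dist_eq_norm]; exact pow_le_pow_left₀ hr.le hzr 2
    simp only [hφ'def]
    have : δ < r ^ 2 := half_lt_self (by positivity)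
    linarith
  have hφ'x : φ' x = w x + δ := by
    simp only [hφ'def, sub_self, norm_zero]
    ring
  have hnear : ∀ᶠ z in 𝓝[closure Ω] x, w z < φ' z :=
    (hwc x hx).tendsto.eventually_lt
      (hφ'.continuous.continuousAt.tendsto.mono_left nhdsWithin_le_nhds) (by linarith)
  obtain ⟨ρ, hρ, hnear⟩ := Metric.eventually_nhds_iff.1 (eventually_nhdsWithin_iff.1 hnear)
  refine ⟨fun z => max (w z) (φ' z), φ', hwc.sup hφ'.continuous.continuousOn, ?_, ?_, ?_, hφ',
    min (min ρ r) (η / 2), by positivity, ?_⟩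
  · intro z hz ψ hψ hmax
    rcases le_or_gt (φ' z) (w z) with h | h
    · refine hw z hz ψ hψ fun y hy => ?_
      have h1 : max (w y) (φ' y) - ψ y ≤ max (w z) (φ' z) - ψ z := hmax hy
      rw [max_eq_left h] at h1
      change w y - ψ y ≤ w z - ψ z
      linarith [le_max_left (w y) (φ' y)]
    · have hzr : dist z x < r := by
        by_contra! hge
        exact absurd (hlt z hz hge) (not_lt.2 h.le)
      have h2 : IsMaxOn (fun z => φ' z - ψ z) (closure Ω) z := by
        intro y hy
        have h1 : max (w y) (φ' y) - ψ y ≤ max (w z) (φ' z) - ψ z := hmax hy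
        rw [max_eq_right h.le] at h1
        change φ' y - ψ y ≤ φ' z - ψ z
        linarith [le_max_right (w y) (φ' y)]
      -- Where φ' is the larger function, a test function touching the maximum also touches φ', so
      -- its gradient inherits the strict inequalities.
      obtain ⟨h3, h4⟩ := D.gradient_of_isMaxOn hφ' hψ h2
      obtain ⟨h5, h6⟩ := hstrict z hz (by linarith) (∇ φ' z) (by linarith [hgr' z hzr])
      refine ⟨fun hzΩ => ?_, fun hzΓ => Or.inr ?_⟩
      · rw [h3 hzΩ]; linarith
      · linarith [h4 hzΓ, h6 hzΓ]
  · change w x < max (w x) (φ' x)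
    exact lt_max_of_lt_right (by linarith)
  · intro z hz hzr
    exact max_eq_left (hlt z hz (hrr₀.trans hzr)).le
  · intro z hz hzx
    have hz1 : dist z x < ρ := hzx.trans_le ((min_le_left _ _).trans (min_le_left _ _))
    have hz2 : dist z x < r := hzx.trans_le ((min_le_left _ _).trans (min_le_right _ _))
    have hcη : min (min ρ r) (η / 2) ≤ η / 2 := min_le_right _ _
    refine ⟨max_eq_right (hnear hz1 hz).le, fun q hq => ?_, fun hzΓ => ?_⟩
    · have h1 : ‖q - p‖ < η := by
        calc ‖q - p‖ = ‖(q - ∇ φ' z) + (∇ φ' z - p)‖ := by rw [sub_add_sub_cancel]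
          _ ≤ ‖q - ∇ φ' z‖ + ‖∇ φ' z - p‖ := norm_add_le _ _
          _ < η := by linarith [hgr' z hz2]
      linarith [(hstrict z hz (by linarith) q h1).1]
    · linarith [(hstrict z hz (by linarith) (∇ φ' z) (by linarith [hgr' z hz2])).2 hzΓ]


end

section

/-! ### Subsolutions along solutions of the Skorokhod problem -/

section AbsolutelyContinuous

variable {X Y : Type*} [PseudoMetricSpace X] [PseudoMetricSpace Y]

lemma absolutelyContinuousOnInterval_of_dist_le {f : ℝ → X} {h : ℝ → Y} {a b C : ℝ}
    (hf : AbsolutelyContinuousOnInterval f a b)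
    (hC : ∀ s ∈ uIcc a b, ∀ t ∈ uIcc a b, dist (h s) (h t) ≤ C * dist (f s) (f t)) :
    AbsolutelyContinuousOnInterval h a b := by
  unfold AbsolutelyContinuousOnInterval at hf ⊢
  refine squeeze_zero' (Eventually.of_forall fun E => Finset.sum_nonneg fun i _ => dist_nonneg) ?_
    (by simpa using hf.const_mul C)
  rw [eventually_inf_principal]
  filter_upwards with E hE
  rw [Finset.mul_sum]
  exact Finset.sum_le_sum fun i hi => hC _ (hE.1 i hi).1 _ (hE.1 i hi).2

end AbsolutelyContinuous

variable {Ω : Set (EuclideanSpace ℝ (Fin n))}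
    {H : EuclideanSpace ℝ (Fin n) → EuclideanSpace ℝ (Fin n) → ℝ}
    {γ : EuclideanSpace ℝ (Fin n) → EuclideanSpace ℝ (Fin n)} {g : EuclideanSpace ℝ (Fin n) → ℝ}
    {a : ℝ} {u w : EuclideanSpace ℝ (Fin n) → ℝ}
  {η v : ℝ → EuclideanSpace ℝ (Fin n)} {l : ℝ → ℝ}

/-- The running cost along a Skorokhod triple. -/
def runningCost (H : EuclideanSpace ℝ (Fin n) → EuclideanSpace ℝ (Fin n) → ℝ)
    (g : EuclideanSpace ℝ (Fin n) → ℝ) (η v : ℝ → EuclideanSpace ℝ (Fin n)) (l : ℝ → ℝ) (s : ℝ) :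
    ℝ :=
  (lagrangian H (η s) (-v s)).toReal + g (η s) * l s

/-- An arc on `[0, T]`: the restriction to `[0, T]` of a solution of the Skorokhod problem along
which the Lagrangian is integrable. -/
structure IsArc (Ω : Set (EuclideanSpace ℝ (Fin n)))
    (H : EuclideanSpace ℝ (Fin n) → EuclideanSpace ℝ (Fin n) → ℝ)
    (γ : EuclideanSpace ℝ (Fin n) → EuclideanSpace ℝ (Fin n)) (T : ℝ)
    (η v : ℝ → EuclideanSpace ℝ (Fin n)) (l : ℝ → ℝ) :
    Prop where
  ac : AbsolutelyContinuousOnInterval η 0 T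
  integrable_v : IntervalIntegrable v volume 0 T
  integrable_l : IntervalIntegrable l volume 0 T
  integrable_lagrangian :
    IntervalIntegrable (fun s => (lagrangian H (η s) (-v s)).toReal) volume 0 T
  mem_closure : ∀ t ∈ Icc 0 T, η t ∈ closure Ω
  ae_regular : ∀ᵐ t : ℝ, t ∈ Ioo 0 T → lagrangian H (η t) (-v t) ≠ ⊤ ∧ 0 ≤ l t ∧
    (η t ∈ Ω → l t = 0) ∧ ∃ η' : EuclideanSpace ℝ (Fin n), HasDerivAt η η' t ∧ η' + l t • γ (η t) =
        v t

lemma IsSkorokhodTriple.isArc (hS : IsSkorokhodTriple Ω γ η v l) {T : ℝ} (hT : 0 < T)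
    (hfin : ∀ᵐ s : ℝ, s ∈ Ioo 0 T → lagrangian H (η s) (-v s) ≠ ⊤)
    (hint : IntervalIntegrable (fun s => (lagrangian H (η s) (-v s)).toReal) volume 0 T) :
    IsArc Ω H γ T η v l where
  ac := hS.ac T hT
  integrable_v := hS.integrable_v T hT
  integrable_l := hS.integrable_l T hT
  integrable_lagrangian := hint
  mem_closure t ht := hS.mem_closure t ht.1
  ae_regular := by
    filter_upwards [hS.dynamics, hS.l_nonneg, hS.l_eq_zero, hfin] with s h1 h2 h3 h4 hs
    exact ⟨h4 hs, h2 hs.1, h3 hs.1, h1 hs.1⟩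

lemma IsArc.continuousOn {T : ℝ} (hS : IsArc Ω H γ T η v l) (hT : 0 ≤ T) :
    ContinuousOn η (Icc 0 T) := by
  simpa [uIcc_of_le hT] using hS.ac.continuousOn

/-- The function `g` is controlled only on the frontier, so it is replaced by a continuous
extension; this changes nothing almost everywhere, since `l` vanishes where the arc is in Ω. -/
lemma IsArc.intervalIntegrable_running {T : ℝ} (hS : IsArc Ω H γ T η v l)
    (hg : ContinuousOn g (frontier Ω)) (hT : 0 ≤ T) :
    IntervalIntegrable (runningCost H g η v l) volume 0 T := by
  refine hS.integrable_lagrangian.add ?_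
  obtain ⟨g', hg'⟩ := ContinuousMap.exists_restrict_eq (isClosed_frontier (s := Ω))
    ⟨(frontier Ω).domRestrict g, hg.domRestrict⟩
  have hgg : ∀ x ∈ frontier Ω, g' x = g x := fun x hx => DFunLike.congr_fun hg' ⟨x, hx⟩
  have h1 : IntervalIntegrable (fun s => g' (η s) * l s) volume 0 T :=
    hS.integrable_l.continuousOn_mul (g'.continuous.comp_continuousOn hS.ac.continuousOn)
  refine h1.congr_ae ?_
  rw [EventuallyEq, uIoc_of_le hT, ← restrict_Ioo_eq_restrict_Ioc,
    ae_restrict_iff' measurableSet_Ioo]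
  filter_upwards [hS.ae_regular] with s hs hsT
  rcases mem_or_mem_frontier (hS.mem_closure s (Ioo_subset_Icc_self hsT)) with h | h
  · simp [(hs hsT).2.2.1 h]
  · simp [hgg _ h]

/-- The boundary estimates used by doubling arguments in a chart. -/
lemma NeumannData.exists_chart_estimates (D : NeumannData Ω H γ g)
    {x₀ e : EuclideanSpace ℝ (Fin n)} {A : EuclideanSpace ℝ (Fin n) →L[ℝ] EuclideanSpace ℝ (Fin n)}
    {c : ℝ} (hx₀ : x₀ ∈ closure Ω) (hchart : IsChart Ω γ x₀ A e c) {κ C : ℝ} (hκ : 0 < κ)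
    (hC : 0 ≤ C) :
    ∃ r > 0, ∀ z ∈ frontier Ω, dist z x₀ < r → 1 ≤ ⟪γ z, e⟫ ∧
      |⟪γ z, (g x₀ / ‖γ x₀‖ ^ 2) • γ x₀⟫ - g z| ≤ κ ∧
      ∀ z' ∈ closure Ω, dist z' x₀ < r → ∀ ε > 0, ‖z - z'‖ ≤ C * ε →
        -κ ≤ ⟪γ z, ε⁻¹ • A (z - z')⟫ := by
  -- The chart error is proportional to `‖z - z'‖ ≤ C * ε`, so after division by `ε` it is at most
  -- `κ`.
  obtain ⟨r₁, hr₁, h1⟩ := hchart.oblique (κ / (C + 1)) (by positivity)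
  obtain ⟨r₂, hr₂, h2, h3⟩ := D.exists_boundary_radius hx₀ ((g x₀ / ‖γ x₀‖ ^ 2) • γ x₀) hκ
  refine ⟨min r₁ r₂, lt_min hr₁ hr₂, fun z hz hzr => ?_⟩
  rw [lt_min_iff] at hzr
  obtain ⟨h4, h5⟩ := h1 z hz hzr.1
  refine ⟨by rwa [real_inner_comm], ?_, fun z' hz' hzr' ε hε hzz => ?_⟩
  · rcases mem_or_mem_frontier hx₀ with hΩ | hΓ
    · exact absurd hzr.2 (h2 hΩ z hz)
    · have h6 := h3 hΓ z hz hzr.2 ((g x₀ / ‖γ x₀‖ ^ 2) • γ x₀) (by simpa using hr₂)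
      -- The chosen multiple of γ x₀ satisfies the boundary condition exactly at `x₀`; γ x₀ is
      -- nonzero because of its pairing with `e`.
      have h7 : ⟪γ x₀, (g x₀ / ‖γ x₀‖ ^ 2) • γ x₀⟫ = g x₀ := by
        have h8 : γ x₀ ≠ 0 := by
          intro h0
          have := (h1 x₀ hΓ (by simpa using hr₁)).1
          rw [h0, inner_zero_right] at this
          linarith
        rw [real_inner_smul_right, real_inner_self_eq_norm_sq]
        field_simp
      rw [h7, sub_self, sub_zero] at h6
      exact h6.le
  · rw [lt_min_iff] at hzr'
    have h6 := h5 z' hz' hzr'.1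
    rw [real_inner_smul_right, real_inner_comm (A (z - z')), inv_mul_eq_div, le_div_iff₀ hε]
    have h7 : κ / (C + 1) * ‖z - z'‖ ≤ κ * ε := by
      calc κ / (C + 1) * ‖z - z'‖ ≤ κ / (C + 1) * (C * ε) := by gcongr
        _ ≤ κ / (C + 1) * ((C + 1) * ε) := by gcongr; linarith
        _ = κ * ε := by field_simp
    linarith

/-- The quadratic test function of the doubling arguments. -/
def quadTest (A : EuclideanSpace ℝ (Fin n) →L[ℝ] EuclideanSpace ℝ (Fin n))
    (q : EuclideanSpace ℝ (Fin n)) (ε : ℝ) (w z : EuclideanSpace ℝ (Fin n)) : ℝ :=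
  (2 * ε)⁻¹ * ⟪A (z - w), z - w⟫ + ⟪q, z - w⟫

lemma contDiff_quadTest (A : EuclideanSpace ℝ (Fin n) →L[ℝ] EuclideanSpace ℝ (Fin n))
    (q : EuclideanSpace ℝ (Fin n)) (ε : ℝ) (w : EuclideanSpace ℝ (Fin n)) :
    ContDiff ℝ 1 (quadTest A q ε w) :=
  (contDiff_const.mul (contDiff_form A w)).add (contDiff_inner_sub q w)

lemma hasGradientAt_quadTest {A : EuclideanSpace ℝ (Fin n) →L[ℝ] EuclideanSpace ℝ (Fin n)}
    (hA : ∀ ξ ζ, ⟪A ξ, ζ⟫ = ⟪A ζ, ξ⟫) (q : EuclideanSpace ℝ (Fin n))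
    (ε : ℝ) (w z : EuclideanSpace ℝ (Fin n)) : HasGradientAt (quadTest A q ε w)
        (ε⁻¹ • A (z - w) + q) z := by
  have := hasGradientAt_add (hasGradientAt_const_mul (2 * ε)⁻¹ (hasGradientAt_form hA w z))
    (hasGradientAt_inner q w z)
  convert! this using 2
  rw [smul_smul, mul_inv]
  congr 1
  ring

lemma hasGradientAt_quadTest_left {A : EuclideanSpace ℝ (Fin n) →L[ℝ] EuclideanSpace ℝ (Fin n)}
    (hA : ∀ ξ ζ, ⟪A ξ, ζ⟫ = ⟪A ζ, ξ⟫) (q : EuclideanSpace ℝ (Fin n))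
    (ε : ℝ) (w z : EuclideanSpace ℝ (Fin n)) : HasGradientAt (fun w => quadTest A q ε w z)
        (-(ε⁻¹ • A (z - w) + q)) w := by
  have h : (fun w => quadTest A q ε w z) = quadTest A (-q) ε z := by
    funext w
    simp only [quadTest]
    rw [← neg_sub w z, map_neg, inner_neg_neg, inner_neg_right, inner_neg_left]
  rw [h]
  convert! hasGradientAt_quadTest hA (-q) ε z w using 1
  rw [← neg_sub w z, map_neg, smul_neg]
  abel

lemma quadTest_self (A : EuclideanSpace ℝ (Fin n) →L[ℝ] EuclideanSpace ℝ (Fin n))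
    (q : EuclideanSpace ℝ (Fin n)) (ε : ℝ) (w : EuclideanSpace ℝ (Fin n)) : quadTest A q ε w w =
    0 := by
  simp [quadTest]

lemma IsChart.quadTest_ge {x e q : EuclideanSpace ℝ (Fin n)}
    {A : EuclideanSpace ℝ (Fin n) →L[ℝ] EuclideanSpace ℝ (Fin n)} {c ε : ℝ}
    (h : IsChart Ω γ x A e c)
    (hε : 0 < ε) (w z : EuclideanSpace ℝ (Fin n)) :
    (2 * ε)⁻¹ * (c * ‖z - w‖ ^ 2) - ‖q‖ * ‖z - w‖ ≤ quadTest A q ε w z := by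
  have h1 : (2 * ε)⁻¹ * (c * ‖z - w‖ ^ 2) ≤ (2 * ε)⁻¹ * ⟪A (z - w), z - w⟫ :=
    mul_le_mul_of_nonneg_left (h.coercive _) (by positivity)
  have h2 := (abs_le.1 (abs_real_inner_le_norm q (z - w))).1
  simp only [quadTest]
  linarith

/-- Maximum points of `u - Φ` are `O(ε)` close to the centre of `Φ`. -/
lemma IsChart.norm_sub_le_of_quadTest_le {x e q : EuclideanSpace ℝ (Fin n)}
    {A : EuclideanSpace ℝ (Fin n) →L[ℝ] EuclideanSpace ℝ (Fin n)} {c ε K : ℝ}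
    (h : IsChart Ω γ x A e c) (hε : 0 < ε) {w z : EuclideanSpace ℝ (Fin n)}
    (hle : quadTest A q ε w z ≤ K * ‖z - w‖) (hK : 0 ≤ K) :
    ‖z - w‖ ≤ 2 * (K + ‖q‖) / c * ε := by
  have h1 := h.quadTest_ge (q := q) hε w z
  have hc := h.pos
  rcases (norm_nonneg (z - w)).eq_or_lt with h0 | h0
  · rw [← h0]; positivity
  · have h2 : (2 * ε)⁻¹ * (c * ‖z - w‖) * ‖z - w‖ ≤ (K + ‖q‖) * ‖z - w‖ := by
      calc _ = (2 * ε)⁻¹ * (c * ‖z - w‖ ^ 2) := by ring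
        _ ≤ _ := by linarith
    have h3 := le_of_mul_le_mul_right h2 h0
    rw [inv_mul_le_iff₀ (by positivity)] at h3
    rw [div_mul_eq_mul_div, le_div_iff₀ hc]
    linarith

/-- By symmetry the difference of two values of the form is ⟪A(ξ + ξ'), ξ - ξ'⟫, so the dependence
on the centre is Lipschitz for fixed ε. This is what keeps the regularized function absolutely
continuous along arcs. -/
lemma abs_quadTest_sub_le {A : EuclideanSpace ℝ (Fin n) →L[ℝ] EuclideanSpace ℝ (Fin n)}
    (hA : ∀ ξ ζ, ⟪A ξ, ζ⟫ = ⟪A ζ, ξ⟫) (q : EuclideanSpace ℝ (Fin n)) {ε B : ℝ}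
    (hε : 0 < ε) {w w' z : EuclideanSpace ℝ (Fin n)} (hw : ‖z - w‖ ≤ B) (hw' : ‖z - w'‖ ≤ B) :
    |quadTest A q ε w z - quadTest A q ε w' z| ≤ (ε⁻¹ * (‖A‖ * B) + ‖q‖) * ‖w - w'‖ := by
  set ξ := z - w with hξ
  set ξ' := z - w' with hξ'
  have hd : w' - w = ξ - ξ' := by rw [hξ, hξ']; abel
  have h1 : quadTest A q ε w z - quadTest A q ε w' z =
      (2 * ε)⁻¹ * ⟪A (ξ + ξ'), ξ - ξ'⟫ + ⟪q, ξ - ξ'⟫ := by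
    simp only [quadTest, ← hξ, ← hξ']
    have h2 : ⟪A (ξ + ξ'), ξ - ξ'⟫ = ⟪A ξ, ξ⟫ - ⟪A ξ', ξ'⟫ := by
      rw [map_add, inner_add_left, inner_sub_right (A ξ), inner_sub_right (A ξ'), hA ξ' ξ]
      ring
    rw [h2, inner_sub_right q ξ ξ']
    ring
  rw [h1, ← hd, norm_sub_rev w w']
  have h2 : |⟪A (ξ + ξ'), w' - w⟫| ≤ ‖A‖ * (2 * B) * ‖w' - w‖ := by
    refine (abs_real_inner_le_norm _ _).trans ?_
    gcongr
    refine (A.le_opNorm _).trans ?_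
    gcongr
    exact (norm_add_le _ _).trans (by linarith)
  have h3 := abs_real_inner_le_norm q (w' - w)
  calc |(2 * ε)⁻¹ * ⟪A (ξ + ξ'), w' - w⟫ + ⟪q, w' - w⟫| ≤
        (2 * ε)⁻¹ * |⟪A (ξ + ξ'), w' - w⟫| + |⟪q, w' - w⟫| := by
        refine (abs_add_le _ _).trans (le_of_eq ?_)
        rw [abs_mul, abs_of_pos (by positivity : 0 < (2 * ε)⁻¹)]
    _ ≤ (2 * ε)⁻¹ * (‖A‖ * (2 * B) * ‖w' - w‖) + ‖q‖ * ‖w' - w‖ := by gcongr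
    _ = _ := by rw [mul_inv]; ring

/-- For short times, a subsolution decreases at most by a slightly enlarged action along arcs. -/
lemma NeumannData.local_sub_le (D : NeumannData Ω H γ g) {K : ℝ} (hK0 : 0 ≤ K)
    (hK : ∀ x ∈ closure Ω, ∀ x' ∈ closure Ω, u x - u x' ≤ K * ‖x - x'‖)
    (hu : SubTest Ω H γ g 0 u) {T : ℝ} (hS : IsArc Ω H γ T η v l)
    {s₀ : ℝ} (hs₀ : 0 ≤ s₀) (hs₀T : s₀ ≤ T) {κ : ℝ} (hκ : 0 < κ) :
    ∃ σ > 0, ∀ s, s₀ ≤ s → s < s₀ + σ → s ≤ T →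
      u (η s₀) - u (η s) ≤ ∫ t in s₀..s, (runningCost H g η v l t + κ * l t + κ) := by
  have hT := hs₀.trans hs₀T
  set x₀ := η s₀
  have hx₀ : x₀ ∈ closure Ω := hS.mem_closure s₀ ⟨hs₀, hs₀T⟩
  obtain ⟨A, e, c, hchart⟩ := exists_isChart D.isOpen D.c1 D.oblique D.continuousOn_γ hx₀
  obtain ⟨G, hG, hbd⟩ := D.exists_frontier_bound
  -- The tilt `κ₁ • e` must exceed the chart errors at the test point, while at the arc it may raise
  -- the product with γ by no more than `κ` in total.
  set κ₁ := κ / (1 + G * ‖e‖) with hκ₁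
  have hκ₁0 : 0 < κ₁ := by positivity
  have hκ₁' : κ₁ + κ₁ * (G * ‖e‖) = κ := by rw [hκ₁]; field_simp
  set q₀ := (g x₀ / ‖γ x₀‖ ^ 2) • γ x₀ with hq₀
  set q := q₀ + κ₁ • e with hq
  have hc := hchart.pos
  set C₂ := 2 * (K + ‖q‖) / c with hC₂
  have hC₂0 : 0 ≤ C₂ := by positivity
  obtain ⟨r, hr, hest⟩ := D.exists_chart_estimates hx₀ hchart (κ := κ₁ / 4) (by positivity) hC₂0
  set P := ‖A‖ * C₂ + ‖q‖ with hP
  obtain ⟨δ, hδ, hmod⟩ := D.exists_modulus P hκ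
  obtain ⟨σ, hσ, hη⟩ : ∃ σ > 0, ∀ s, s₀ ≤ s → s < s₀ + σ → s ≤ T → dist (η s) x₀ < r / 2 := by
    obtain ⟨σ, hσ, h1⟩ := Metric.continuousOn_iff.1 (hS.continuousOn hT) s₀ ⟨hs₀, hs₀T⟩ (r / 2)
      (by positivity)
    exact ⟨σ, hσ, fun s h2 h3 h4 => h1 s ⟨by linarith, h4⟩ (by
      rw [Real.dist_eq, abs_of_nonneg (by linarith)]; linarith)⟩
  refine ⟨σ, hσ, fun s₁ h01 hs₁σ hs₁T => ?_⟩
  have hηd : ∀ s ∈ Icc s₀ s₁, dist (η s) x₀ < r / 2 := fun s hs =>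
    hη s hs.1 (by linarith [hs.2]) (hs.2.trans hs₁T)
  have hsub : uIcc s₀ s₁ ⊆ uIcc 0 T := by
    rw [uIcc_of_le h01, uIcc_of_le hT]
    exact Icc_subset_Icc hs₀ hs₁T
  have hηX : ∀ s ∈ Icc s₀ s₁, η s ∈ closure Ω := fun s hs =>
    hS.mem_closure s ⟨hs₀.trans hs.1, hs.2.trans hs₁T⟩
  have hFint : IntervalIntegrable (fun t => runningCost H g η v l t + κ * l t + κ) volume s₀ s₁ :=
    ((((hS.intervalIntegrable_running D.continuousOn_g hT).add
      ((hS.integrable_l).const_mul κ)).add intervalIntegrable_const)).mono_set hsub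
  obtain ⟨B, hB⟩ := D.isCompact.isBounded.exists_norm_le
  suffices hmain : ∀ ε > 0, C₂ * ε < min δ (r / 2) → u (η s₀) - u (η s₁) ≤
      (∫ t in s₀..s₁, (runningCost H g η v l t + κ * l t + κ)) + (K + ‖q‖) * (C₂ * ε) by
    have hlim : Tendsto (fun ε : ℝ => (∫ t in s₀..s₁, (runningCost H g η v l t + κ * l t + κ)) +
        (K + ‖q‖) * (C₂ * ε)) (𝓝[>] 0)
        (𝓝 ((∫ t in s₀..s₁, (runningCost H g η v l t + κ * l t + κ)) + (K + ‖q‖) * (C₂ * 0))) :=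
      (Continuous.tendsto (by fun_prop) 0).mono_left nhdsWithin_le_nhds
    rw [mul_zero, mul_zero, add_zero] at hlim
    refine ge_of_tendsto hlim ?_
    have hsm : ∀ᶠ ε : ℝ in 𝓝[>] 0, C₂ * ε < min δ (r / 2) := by
      have : Tendsto (fun ε : ℝ => C₂ * ε) (𝓝[>] 0) (𝓝 (C₂ * 0)) :=
        (Continuous.tendsto (by fun_prop) 0).mono_left nhdsWithin_le_nhds
      refine this.eventually (gt_mem_nhds ?_)
      rw [mul_zero]; positivity
    filter_upwards [hsm, self_mem_nhdsWithin] with ε h1 h2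
    exact hmain ε h2 h1
  intro ε hε hεsm
  set Φ : EuclideanSpace ℝ (Fin n) → EuclideanSpace ℝ (Fin n) → ℝ := fun w z => quadTest A q ε w z
  have huc := continuousOn_of_lipschitz hK
  have hmaxex : ∀ w, ∃ x ∈ closure Ω, IsMaxOn (fun z => u z - Φ w z) (closure Ω) x := fun w =>
    D.isCompact.exists_isMaxOn ⟨x₀, hx₀⟩
      (huc.sub (contDiff_quadTest A q ε w).continuous.continuousOn)
  choose X hXmem hXmax using hmaxex
  -- A regularization of `u` of sup-convolution type: Lipschitz, at least `u`, and within O(ε) of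
  -- it. Unlike `u`, it has, along the arc, a derivative that a test gradient computes.
  set m : EuclideanSpace ℝ (Fin n) → ℝ := fun w => u (X w) - Φ w (X w) with hm
  have hmle : ∀ w, ∀ z ∈ closure Ω, u z - Φ w z ≤ m w := fun w z hz => hXmax w hz
  have hXd : ∀ w ∈ closure Ω, ‖X w - w‖ ≤ C₂ * ε := by
    intro w hw
    refine hchart.norm_sub_le_of_quadTest_le hε ?_ hK0
    have h1 := hmle w w hw
    have h2 : Φ w w = 0 := quadTest_self _ _ _ _
    have h3 := hK (X w) (hXmem w) w hw
    simp only [hm, Φ] at h1 h2 ⊢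
    linarith
  have hmL : ∀ w ∈ closure Ω, ∀ w' ∈ closure Ω,
      m w - m w' ≤ (ε⁻¹ * (‖A‖ * (2 * B)) + ‖q‖) * ‖w - w'‖ := by
    intro w hw w' hw'
    have h1 := hmle w' (X w) (hXmem w)
    have hb : ∀ y ∈ closure Ω, ‖X w - y‖ ≤ 2 * B := fun y hy =>
      (norm_sub_le _ _).trans (by linarith [hB _ (hXmem w), hB y hy])
    have h2 := abs_quadTest_sub_le hchart.symm q hε (hb w hw) (hb w' hw')
    have h3 := (abs_le.1 h2).1
    simp only [hm, Φ] at h1 ⊢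
    linarith
  set M : ℝ → ℝ := fun s => m (η s)
  have hMac : AbsolutelyContinuousOnInterval M s₀ s₁ := by
    refine absolutelyContinuousOnInterval_of_dist_le (hS.ac.mono hsub)
      (C := ε⁻¹ * (‖A‖ * (2 * B)) + ‖q‖) fun s hs t ht => ?_
    rw [uIcc_of_le h01] at hs ht
    rw [Real.dist_eq, dist_eq_norm]
    have h1 := hmL _ (hηX s hs) _ (hηX t ht)
    have h2 := hmL _ (hηX t ht) _ (hηX s hs)
    rw [norm_sub_rev] at h2
    exact abs_le.2 ⟨by simp only [M]; linarith, h1⟩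
  have hderiv : ∀ᵐ s : ℝ, s ∈ Ioo s₀ s₁ →
      -deriv M s ≤ runningCost H g η v l s + κ * l s + κ := by
    filter_upwards [hMac.ae_differentiableAt, hS.ae_regular] with s hMd hreg hs
    have hsI : s ∈ Icc s₀ s₁ := Ioo_subset_Icc_self hs
    have hs0 : 0 < s := hs₀.trans_lt hs.1
    have hMd := (hMd (by rwa [uIcc_of_le h01])).hasDerivAt
    obtain ⟨hL, hl0, hlz, η', hη', hdyn⟩ := hreg ⟨hs0, hs.2.trans_le hs₁T⟩
    set w := η s with hw
    have hwX : w ∈ closure Ω := hηX s hsI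
    set x := X w with hx
    have hxX : x ∈ closure Ω := hXmem w
    set p := ε⁻¹ • A (x - w) + q with hp
    have hxw : ‖x - w‖ ≤ C₂ * ε := hXd w hwX
    have hwd : dist w x₀ < r / 2 := hηd s hsI
    have hxd : dist x x₀ < r := by
      calc dist x x₀ ≤ dist x w + dist w x₀ := dist_triangle _ _ _
        _ < r / 2 + r / 2 := by
          rw [dist_eq_norm x w]
          exact add_lt_add (hxw.trans_lt (hεsm.trans_le (min_le_right _ _))) hwd
        _ = r := by ring
    have hpn : ‖p‖ ≤ P := by
      calc ‖p‖ ≤ ‖ε⁻¹ • A (x - w)‖ + ‖q‖ := norm_add_le _ _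
        _ ≤ ε⁻¹ * (‖A‖ * (C₂ * ε)) + ‖q‖ := by
          rw [norm_smul, Real.norm_of_nonneg (inv_nonneg.2 hε.le)]
          gcongr
          exact (A.le_opNorm _).trans (by gcongr)
        _ = P := by rw [hP]; field_simp
    have hderM : deriv M s = ⟪p, η'⟫ := by
      have h1 : HasDerivAt (fun t => Φ (η t) x) (⟪-p, η'⟫) s := by
        have := (hasGradientAt_quadTest_left hchart.symm q ε w x).hasFDerivAt.comp_hasDerivAt s hη'
        rwa [InnerProductSpace.toDual_apply_apply] at this
      have h2 := hMd.add h1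
      -- With the maximum point `x` frozen, `M t + Φ (η t) x` is at least `u x`, with equality at `t
      -- = s`. Hence its derivative vanishes, which identifies the derivative of `M`.
      have h3 : IsLocalMin (M + fun t => Φ (η t) x) s := by
        refine Eventually.of_forall fun t => ?_
        have h4 := hmle (η t) x hxX
        have h5 : M s = u x - Φ w x := rfl
        simp only [Pi.add_apply, M] at h5 ⊢
        linarith
      have h4 := h3.hasDerivAt_eq_zero h2
      rw [inner_neg_left] at h4
      linarith
    have htest : SubIneq Ω H γ g 0 x p := by
      have := hu x hxX (Φ w) (contDiff_quadTest A q ε w) (hXmax w)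
      rwa [(hasGradientAt_quadTest hchart.symm q ε w x).gradient] at this
    -- On the frontier the three parts of `p` give ⟪γ x, p⟫ ≥ g x - κ₁/2 + κ₁ > g x, which excludes
    -- the boundary alternative.
    have hHx : H x p ≤ 0 := by
      rcases mem_or_mem_frontier hxX with h | h
      · exact htest.1 h
      · refine (htest.2 h).resolve_right fun hle => ?_
        obtain ⟨h1, h2, h3⟩ := hest x h hxd
        have h4 := h3 w hwX (by linarith) ε hε hxw
        rw [hp, hq, inner_add_right, inner_add_right, real_inner_smul_right (γ x) e] at hle
        have h5 := (abs_le.1 h2).1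
        have h6 : κ₁ * 1 ≤ κ₁ * ⟪γ x, e⟫ := by gcongr
        linarith
    have hHw : H w p ≤ κ := by
      have h1 := hmod w hwX x hxX p p hpn hpn
        (by rw [dist_comm, dist_eq_norm]; exact hxw.trans_lt (hεsm.trans_le (min_le_left _ _)))
        (by simpa using hδ)
      linarith [(abs_lt.1 h1).2]
    -- The same chart inequality with the roles of `x` and `w` exchanged now bounds the product with
    -- γ from above at the point of the arc.
    have hlg : l s * ⟪γ w, p⟫ ≤ l s * (g w + κ) := by
      rcases mem_or_mem_frontier hwX with h | h
      · rw [hlz h]; simp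
      · refine mul_le_mul_of_nonneg_left ?_ hl0
        obtain ⟨h1, h2, h3⟩ := hest w h (by linarith)
        have h4 := h3 x hxX hxd ε hε (by rwa [norm_sub_rev])
        have h5 := (abs_le.1 h2).2
        have h6 : ⟪γ w, e⟫ ≤ G * ‖e‖ :=
          (real_inner_le_norm _ _).trans (by gcongr; exact (hbd w h).2)
        have h7 : κ₁ * ⟪γ w, e⟫ ≤ κ₁ * (G * ‖e‖) := by gcongr
        rw [← neg_sub x w, map_neg, smul_neg, inner_neg_right] at h4
        rw [hp, hq, inner_add_right, inner_add_right, real_inner_smul_right (γ w) e]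
        linarith
    have hfen := inner_sub_le_toReal_lagrangian hL p
    rw [hderM]
    have h8 : ⟪p, η'⟫ = ⟪v s, p⟫ - l s * ⟪γ w, p⟫ := by
      have h9 : ⟪v s, p⟫ = ⟪η', p⟫ + l s * ⟪γ w, p⟫ := by
        rw [← hdyn, inner_add_left η' (l s • γ w) p, real_inner_smul_left]
      rw [h9, real_inner_comm η' p]
      ring
    rw [inner_neg_left] at hfen
    simp only [runningCost]
    rw [h8]
    linarith
  have hint2 : (∫ t in s₀..s₁, -deriv M t) ≤
      ∫ t in s₀..s₁, (runningCost H g η v l t + κ * l t + κ) := by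
    refine intervalIntegral.integral_mono_ae_restrict h01 (hMac.intervalIntegrable_deriv.neg)
      hFint ?_
    rw [← restrict_Ioo_eq_restrict_Icc, EventuallyLE, ae_restrict_iff' measurableSet_Ioo]
    exact hderiv
  rw [intervalIntegral.integral_neg, hMac.integral_deriv_eq_sub] at hint2
  have h1 : u (η s₀) ≤ M s₀ := by
    have h2 := hmle (η s₀) (η s₀) hx₀
    have h3 : Φ (η s₀) (η s₀) = 0 := quadTest_self _ _ _ _
    simp only [M]
    linarith
  have hs₁I : s₁ ∈ Icc s₀ s₁ := ⟨h01, le_rfl⟩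
  have h2 : M s₁ ≤ u (η s₁) + (K + ‖q‖) * (C₂ * ε) := by
    have h3 := hchart.quadTest_ge (q := q) hε (η s₁) (X (η s₁))
    have h4 := hK _ (hXmem (η s₁)) _ (hηX s₁ hs₁I)
    have h5 : 0 ≤ (2 * ε)⁻¹ * (c * ‖X (η s₁) - η s₁‖ ^ 2) := by positivity
    have h6 : (K + ‖q‖) * ‖X (η s₁) - η s₁‖ ≤ (K + ‖q‖) * (C₂ * ε) := by
      gcongr
      exact hXd _ (hηX s₁ hs₁I)
    simp only [M, hm, Φ]
    linarith
  linarith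


/-- A subsolution decreases at most by the action along solutions of the Skorokhod problem. -/
lemma NeumannData.sub_le_action (D : NeumannData Ω H γ g) {K : ℝ} (hK0 : 0 ≤ K)
    (hK : ∀ x ∈ closure Ω, ∀ x' ∈ closure Ω, u x - u x' ≤ K * ‖x - x'‖)
    (hu : SubTest Ω H γ g 0 u) {T : ℝ} (hS : IsArc Ω H γ T η v l) {s₀ s₁ : ℝ} (hs₀ : 0 ≤ s₀)
        (h01 : s₀ ≤ s₁) (hs₁ : s₁ ≤ T) :
    u (η s₀) - u (η s₁) ≤ ∫ t in s₀..s₁, runningCost H g η v l t := by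
  have hT : 0 ≤ T := hs₀.trans (h01.trans hs₁)
  have hsub : ∀ a ∈ Icc 0 T, ∀ b ∈ Icc 0 T, uIcc a b ⊆ uIcc 0 T := fun a ha b hb => by
    rw [uIcc_of_le hT]; exact uIcc_subset_Icc ha hb
  have hr := hS.intervalIntegrable_running D.continuousOn_g hT
  have hl := hS.integrable_l
  have huc : ContinuousOn (fun s => u (η s)) (Icc s₀ s₁) :=
    (continuousOn_of_lipschitz hK).comp
      ((hS.continuousOn hT).mono (Icc_subset_Icc hs₀ hs₁)) fun s hs =>
        hS.mem_closure s ⟨hs₀.trans hs.1, hs.2.trans hs₁⟩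
  -- The chart depends on the starting point, so the local estimate is continued in time: the set of
  -- valid times is closed and can always be prolonged to the right. Afterwards `κ` tends to 0.
  have key : ∀ κ > 0, u (η s₀) - u (η s₁) ≤
      ∫ t in s₀..s₁, (runningCost H g η v l t + κ * l t + κ) := by
    intro κ hκ
    have hF : IntervalIntegrable (fun t => runningCost H g η v l t + κ * l t + κ) volume 0 T :=
      (hr.add (hl.const_mul κ)).add intervalIntegrable_const
    have hFc : ContinuousOn (fun s => ∫ t in s₀..s, (runningCost H g η v l t + κ * l t + κ))
        (Icc s₀ s₁) := by
      have := intervalIntegral.continuousOn_primitive_interval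
        ((intervalIntegrable_iff').1
          (hF.mono_set (hsub s₀ ⟨hs₀, h01.trans hs₁⟩ s₁ ⟨hs₀.trans h01, hs₁⟩)))
      rwa [uIcc_of_le h01] at this
    have hcl : IsClosed ({s | u (η s₀) - u (η s) ≤
        ∫ t in s₀..s, (runningCost H g η v l t + κ * l t + κ)} ∩ Icc s₀ s₁) := by
      have := isClosed_Icc.isClosed_le ((continuousOn_const (c := u (η s₀))).sub huc) hFc
      rw [inter_comm]
      exact this
    refine (hcl.Icc_subset_of_forall_exists_gt (by simp) ?_) ⟨h01, le_rfl⟩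
    rintro s ⟨hs, hsI⟩ t ht
    obtain ⟨σ, hσ, h1⟩ := D.local_sub_le hK0 hK hu hS (hs₀.trans hsI.1)
      (hsI.2.le.trans hs₁) hκ
    obtain ⟨t', ht', htt⟩ := exists_between (lt_min (mem_Ioi.1 ht)
        (lt_min (lt_add_of_pos_right s hσ) hsI.2))
    rw [lt_min_iff, lt_min_iff] at htt
    refine ⟨t', ?_, ht', htt.1.le⟩
    have h2 := h1 t' ht'.le htt.2.1 (htt.2.2.le.trans hs₁)
    have hs' : s ∈ Icc 0 T := ⟨hs₀.trans hsI.1, hsI.2.le.trans hs₁⟩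
    have ht'' : t' ∈ Icc 0 T := ⟨hs'.1.trans ht'.le, htt.2.2.le.trans hs₁⟩
    have h3 := intervalIntegral.integral_add_adjacent_intervals
      (hF.mono_set (hsub s₀ ⟨hs₀, h01.trans hs₁⟩ s hs')) (hF.mono_set (hsub s hs' t' ht''))
    have h4 : u (η s₀) - u (η s) ≤ _ := hs
    show u (η s₀) - u (η t') ≤ _
    rw [← h3]
    linarith
  have hsubs := hsub s₀ ⟨hs₀, h01.trans hs₁⟩ s₁ ⟨hs₀.trans h01, hs₁⟩
  have hr' := hr.mono_set hsubs
  have hl' := hl.mono_set hsubs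
  have key2 : ∀ κ > 0, u (η s₀) - u (η s₁) ≤
      (∫ t in s₀..s₁, runningCost H g η v l t) + κ * ((∫ t in s₀..s₁, l t) + (s₁ - s₀)) := by
    intro κ hκ
    refine (key κ hκ).trans (le_of_eq ?_)
    rw [intervalIntegral.integral_add (hr'.add (hl'.const_mul κ)) intervalIntegrable_const,
      intervalIntegral.integral_add hr' (hl'.const_mul κ), intervalIntegral.integral_const_mul,
      intervalIntegral.integral_const, smul_eq_mul]
    ring
  have hlim : Tendsto (fun κ : ℝ => (∫ t in s₀..s₁, runningCost H g η v l t) +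
      κ * ((∫ t in s₀..s₁, l t) + (s₁ - s₀))) (𝓝[>] 0)
      (𝓝 ((∫ t in s₀..s₁, runningCost H g η v l t) + 0 * ((∫ t in s₀..s₁, l t) + (s₁ - s₀)))) :=
    (Continuous.tendsto (by fun_prop) 0).mono_left nhdsWithin_le_nhds
  rw [zero_mul, add_zero] at hlim
  exact ge_of_tendsto hlim (by filter_upwards [self_mem_nhdsWithin] with κ h using key2 κ h)

end

section

/-! ### Concatenation of arcs -/

section Concatenation

variable {X Y : Type*}

/-- A monotone 1-Lipschitz change of time sends disjoint families of intervals to disjoint families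
of no larger total length. -/
lemma absolutelyContinuousOnInterval_comp_monotone [PseudoMetricSpace X] {f : ℝ → X} {φ : ℝ → ℝ}
    {a b c d : ℝ} (hf : AbsolutelyContinuousOnInterval f c d) (hφ : Monotone φ)
    (hφ1 : ∀ s t, dist (φ s) (φ t) ≤ dist s t) (hm : MapsTo φ (uIcc a b) (uIcc c d)) :
    AbsolutelyContinuousOnInterval (f ∘ φ) a b := by
  let Ψ : ℕ × (ℕ → ℝ × ℝ) → ℕ × (ℕ → ℝ × ℝ) := fun E => (E.1, fun i => (φ (E.2 i).1, φ (E.2 i).2))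
  suffices h : Tendsto Ψ
      (AbsolutelyContinuousOnInterval.totalLengthFilter ⊓
        𝓟 (AbsolutelyContinuousOnInterval.disjWithin a b))
      (AbsolutelyContinuousOnInterval.totalLengthFilter ⊓
        𝓟 (AbsolutelyContinuousOnInterval.disjWithin c d)) by
    unfold AbsolutelyContinuousOnInterval at hf
    exact hf.comp h
  refine tendsto_inf.2 ⟨?_, tendsto_principal.2 ?_⟩
  · refine tendsto_comap_iff.2 ?_
    refine squeeze_zero (fun E => Finset.sum_nonneg fun i _ => dist_nonneg)
      (fun E => Finset.sum_le_sum fun i _ => hφ1 _ _) ?_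
    exact tendsto_comap.mono_left inf_le_left
  · rw [eventually_inf_principal]
    filter_upwards with E hE
    refine ⟨fun i hi => ⟨hm (hE.1 i hi).1, hm (hE.1 i hi).2⟩, fun i hi j hj hij => ?_⟩
    have h1 := hE.2 hi hj hij
    simp only [Function.onFun, Ψ] at h1 ⊢
    rw [Set.disjoint_left] at h1 ⊢
    have hlt : ∀ {s t : ℝ}, φ s < φ t → s < t := fun h => lt_of_not_ge fun h' => (hφ h').not_gt h
    have hmin : ∀ s t : ℝ, min (φ s) (φ t) = φ (min s t) := fun s t => (hφ.map_min).symm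
    have hmax : ∀ s t : ℝ, max (φ s) (φ t) = φ (max s t) := fun s t => (hφ.map_max).symm
    intro z hz hz'
    rw [uIoc, mem_Ioc, hmin, hmax] at hz hz'
    -- If two image intervals meet, the smaller of the original right endpoints lies in both
    -- original intervals.
    refine h1 (a := min (max (E.2 i).1 (E.2 i).2) (max (E.2 j).1 (E.2 j).2)) ?_ ?_
    · exact ⟨lt_min (hlt (hz.1.trans_le hz.2)) (hlt (hz.1.trans_le hz'.2)), min_le_left _ _⟩
    · exact ⟨lt_min (hlt (hz'.1.trans_le hz.2)) (hlt (hz'.1.trans_le hz'.2)), min_le_right _ _⟩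

/-- Follow `f₁` until time `T` and then `f₂`. -/
def concat (T : ℝ) (f₁ f₂ : ℝ → X) (s : ℝ) : X := if s ≤ T then f₁ s else f₂ (s - T)

lemma concat_of_le {T s : ℝ} (f₁ f₂ : ℝ → X) (h : s ≤ T) : concat T f₁ f₂ s = f₁ s := if_pos h

lemma concat_of_lt {T s : ℝ} (f₁ f₂ : ℝ → X) (h : T < s) : concat T f₁ f₂ s = f₂ (s - T) :=
  if_neg h.not_ge

lemma concat_add {T s : ℝ} {f₁ f₂ : ℝ → X} (hg : f₁ T = f₂ 0) (hs : 0 ≤ s) :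
    concat T f₁ f₂ (T + s) = f₂ s := by
  rcases hs.eq_or_lt with rfl | h
  · rw [add_zero, concat_of_le _ _ le_rfl, hg]
  · rw [concat_of_lt _ _ (by linarith), add_sub_cancel_left]

/-- The concatenation equals `f₁ (min s T₁) + f₂ (max (s - T₁) 0) - f₂ 0`, a sum of reparametrized
pieces. -/
lemma absolutelyContinuousOnInterval_concat {E : Type*} [NormedAddCommGroup E] {f₁ f₂ : ℝ → E}
    {T₁ T₂ : ℝ} (hT₁ : 0 ≤ T₁) (hT₂ : 0 ≤ T₂) (hg : f₁ T₁ = f₂ 0)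
    (h₁ : AbsolutelyContinuousOnInterval f₁ 0 T₁) (h₂ : AbsolutelyContinuousOnInterval f₂ 0 T₂) :
    AbsolutelyContinuousOnInterval (concat T₁ f₁ f₂) 0 (T₁ + T₂) := by
  have h3 := absolutelyContinuousOnInterval_comp_monotone h₁ (φ := fun s => min s T₁) (a := 0)
      (b := T₁ + T₂)
    (fun s t h => min_le_min_right _ h)
    (fun s t => by
      simp only [Real.dist_eq]
      exact (abs_min_sub_min_le_max s T₁ t T₁).trans (by simp))
    (fun s hs => by
      rw [uIcc_of_le (by linarith)] at hs
      rw [uIcc_of_le hT₁]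
      exact ⟨le_min hs.1 hT₁, min_le_right _ _⟩)
  have h4 := absolutelyContinuousOnInterval_comp_monotone h₂ (φ := fun s => max (s - T₁) 0)
      (a := 0) (b := T₁ + T₂)
    (fun s t h => max_le_max_right _ (by linarith))
    (fun s t => by
      simp only [Real.dist_eq]
      exact (abs_max_sub_max_le_max _ 0 _ 0).trans (by simp))
    (fun s hs => by
      rw [uIcc_of_le (by linarith)] at hs
      rw [uIcc_of_le hT₂]
      exact ⟨le_max_right _ _, max_le (by linarith [hs.2]) hT₂⟩)
  have h5 : AbsolutelyContinuousOnInterval (fun _ : ℝ => -f₂ 0) 0 (T₁ + T₂) :=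
    (LipschitzWith.const _).lipschitzOnWith.absolutelyContinuousOnInterval
  convert! (h3.add h4).add h5 using 1
  funext s
  rcases le_or_gt s T₁ with h | h
  · simp [concat_of_le _ _ h, h]
  · simp [concat_of_lt _ _ h, h.le, hg]

lemma intervalIntegrable_concat {E : Type*} [NormedAddCommGroup E] {f₁ f₂ : ℝ → E}
    {T₁ T₂ : ℝ} (hT₁ : 0 ≤ T₁) (hT₂ : 0 ≤ T₂) (h₁ : IntervalIntegrable f₁ volume 0 T₁)
    (h₂ : IntervalIntegrable f₂ volume 0 T₂) :
    IntervalIntegrable (concat T₁ f₁ f₂) volume 0 T₁ ∧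
      IntervalIntegrable (concat T₁ f₁ f₂) volume T₁ (T₁ + T₂) := by
  refine ⟨h₁.congr fun s hs => ?_, ?_⟩
  · rw [uIoc_of_le hT₁] at hs
    exact (concat_of_le _ _ hs.2).symm
  · have := h₂.comp_sub_right T₁
    rw [zero_add, add_comm T₂] at this
    refine this.congr fun s hs => ?_
    rw [uIoc_of_le (by linarith)] at hs
    exact (concat_of_lt _ _ hs.1).symm

lemma integral_concat {f₁ f₂ : ℝ → ℝ} {T₁ T₂ : ℝ} (hT₁ : 0 ≤ T₁) (hT₂ : 0 ≤ T₂)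
    (h₁ : IntervalIntegrable f₁ volume 0 T₁) (h₂ : IntervalIntegrable f₂ volume 0 T₂) :
    ∫ s in (0 : ℝ)..(T₁ + T₂), concat T₁ f₁ f₂ s =
      (∫ s in (0 : ℝ)..T₁, f₁ s) + ∫ s in (0 : ℝ)..T₂, f₂ s := by
  obtain ⟨h3, h4⟩ := intervalIntegrable_concat hT₁ hT₂ h₁ h₂
  rw [← intervalIntegral.integral_add_adjacent_intervals h3 h4]
  congr 1
  · refine intervalIntegral.integral_congr fun s hs => ?_
    rw [uIcc_of_le hT₁] at hs
    exact concat_of_le _ _ hs.2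
  · have h5 : ∫ s in T₁..(T₁ + T₂), concat T₁ f₁ f₂ s = ∫ s in T₁..(T₁ + T₂), f₂ (s - T₁) := by
      refine intervalIntegral.integral_congr_ae (Eventually.of_forall fun s hs => ?_)
      rw [uIoc_of_le (by linarith)] at hs
      exact concat_of_lt _ _ hs.1
    rw [h5, intervalIntegral.integral_comp_sub_right]
    simp

lemma ae_concat {P Q : ℝ → Prop} {T₁ T₂ : ℝ} (hP : ∀ᵐ s : ℝ, s ∈ Ioo 0 T₁ → P s)
    (hQ : ∀ᵐ s : ℝ, s ∈ Ioo 0 T₂ → Q s) :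
    ∀ᵐ s : ℝ, s ∈ Ioo 0 (T₁ + T₂) → (s < T₁ ∧ P s) ∨ (T₁ < s ∧ Q (s - T₁)) := by
  have h1 : ∀ᵐ s : ℝ, s - T₁ ∈ Ioo 0 T₂ → Q (s - T₁) :=
    (measurePreserving_sub_right volume T₁).quasiMeasurePreserving.ae hQ
  have h2 : ∀ᵐ s : ℝ, s ≠ T₁ := by simp [ae_iff]
  filter_upwards [hP, h1, h2] with s h3 h4 h5 hs
  rcases lt_or_gt_of_ne h5 with h | h
  · exact Or.inl ⟨h, h3 ⟨hs.1, h⟩⟩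
  · exact Or.inr ⟨h, h4 ⟨by linarith, by linarith [hs.2]⟩⟩

end Concatenation

variable {Ω : Set (EuclideanSpace ℝ (Fin n))}
    {H : EuclideanSpace ℝ (Fin n) → EuclideanSpace ℝ (Fin n) → ℝ}
    {γ : EuclideanSpace ℝ (Fin n) → EuclideanSpace ℝ (Fin n)} {g : EuclideanSpace ℝ (Fin n) → ℝ}

lemma concat_map₂ {η₁ v₁ η₂ v₂ : ℝ → EuclideanSpace ℝ (Fin n)} {l₁ l₂ : ℝ → ℝ} {T : ℝ}
    (F : EuclideanSpace ℝ (Fin n) → EuclideanSpace ℝ (Fin n) → ℝ → ℝ) :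
    (fun s => F (concat T η₁ η₂ s) (concat T v₁ v₂ s) (concat T l₁ l₂ s)) =
      concat T (fun s => F (η₁ s) (v₁ s) (l₁ s)) (fun s => F (η₂ s) (v₂ s) (l₂ s)) := by
  funext s
  simp only [concat]
  split_ifs <;> rfl

lemma runningCost_concat {η₁ v₁ η₂ v₂ : ℝ → EuclideanSpace ℝ (Fin n)} {l₁ l₂ : ℝ → ℝ} {T : ℝ} :
    runningCost H g (concat T η₁ η₂) (concat T v₁ v₂) (concat T l₁ l₂) =
      concat T (runningCost H g η₁ v₁ l₁) (runningCost H g η₂ v₂ l₂) :=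
  concat_map₂ fun x v l => (lagrangian H x (-v)).toReal + g x * l

lemma IsArc.concat {η₁ v₁ η₂ v₂ : ℝ → EuclideanSpace ℝ (Fin n)} {l₁ l₂ : ℝ → ℝ} {T₁ T₂ : ℝ}
    (h₁ : IsArc Ω H γ T₁ η₁ v₁ l₁) (h₂ : IsArc Ω H γ T₂ η₂ v₂ l₂) (hT₁ : 0 ≤ T₁) (hT₂ : 0 ≤ T₂)
    (hg : η₁ T₁ = η₂ 0) :
    IsArc Ω H γ (T₁ + T₂) (concat T₁ η₁ η₂) (concat T₁ v₁ v₂) (concat T₁ l₁ l₂) where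
  ac := absolutelyContinuousOnInterval_concat hT₁ hT₂ hg h₁.ac h₂.ac
  integrable_v := by
    obtain ⟨h3, h4⟩ := intervalIntegrable_concat hT₁ hT₂ h₁.integrable_v h₂.integrable_v
    exact h3.trans h4
  integrable_l := by
    obtain ⟨h3, h4⟩ := intervalIntegrable_concat hT₁ hT₂ h₁.integrable_l h₂.integrable_l
    exact h3.trans h4
  integrable_lagrangian := by
    obtain ⟨h3, h4⟩ := intervalIntegrable_concat hT₁ hT₂ h₁.integrable_lagrangian
      h₂.integrable_lagrangian
    have := h3.trans h4
    rwa [← concat_map₂ (l₁ := l₁) (l₂ := l₂)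
      (fun x v _ => (lagrangian H x (-v)).toReal)] at this
  mem_closure t ht := by
    rcases le_or_gt t T₁ with h | h
    · rw [concat_of_le _ _ h]
      exact h₁.mem_closure t ⟨ht.1, h⟩
    · rw [concat_of_lt _ _ h]
      exact h₂.mem_closure _ ⟨by linarith, by linarith [ht.2]⟩
  ae_regular := by
    filter_upwards [ae_concat h₁.ae_regular h₂.ae_regular] with t ht htT
    rcases ht htT with ⟨h, hr⟩ | ⟨h, hr⟩
    · rw [concat_of_le _ _ h.le, concat_of_le _ _ h.le, concat_of_le _ _ h.le]
      refine ⟨hr.1, hr.2.1, hr.2.2.1, ?_⟩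
      obtain ⟨η', h3, h4⟩ := hr.2.2.2
      refine ⟨η', h3.congr_of_eventuallyEq ?_, h4⟩
      filter_upwards [gt_mem_nhds h] with s hs
      exact concat_of_le _ _ hs.le
    · rw [concat_of_lt _ _ h, concat_of_lt _ _ h, concat_of_lt _ _ h]
      refine ⟨hr.1, hr.2.1, hr.2.2.1, ?_⟩
      obtain ⟨η', h3, h4⟩ := hr.2.2.2
      refine ⟨η', (h3.comp_sub_const t T₁).congr_of_eventuallyEq ?_, h4⟩
      filter_upwards [lt_mem_nhds h] with s hs
      exact concat_of_lt _ _ hs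

/-- Smooth arcs with constant reflection rate. -/
lemma NeumannData.isArc_of_hasDerivWithinAt (D : NeumannData Ω H γ g) {T b l₀ : ℝ}
    {η η' : ℝ → EuclideanSpace ℝ (Fin n)}
    (hT : 0 ≤ T)
    (hη : ∀ s ∈ Icc 0 T, HasDerivWithinAt η (η' s) (Icc 0 T) s) (hη' : ContinuousOn η' (Icc 0 T))
    (hX : ∀ s ∈ Icc 0 T, η s ∈ closure Ω) (hl₀ : 0 ≤ l₀)
    (hl : l₀ = 0 ∨ ∀ s ∈ Icc 0 T, η s ∈ frontier Ω)
    (hb : ∀ s ∈ Icc 0 T, ∀ p, ⟪-(η' s + l₀ • γ (η s)), p⟫ - H (η s) p ≤ b) :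
    IsArc Ω H γ T η (fun s => η' s + l₀ • γ (η s)) (fun _ => l₀) := by
  set v : ℝ → EuclideanSpace ℝ (Fin n) := fun s => η' s + l₀ • γ (η s) with hv
  have hηc : ContinuousOn η (Icc 0 T) := fun s hs => (hη s hs).continuousWithinAt
  have hvc : ContinuousOn v (Icc 0 T) := by
    refine hη'.add ?_
    rcases hl with h | h
    · simpa [h] using continuousOn_const
    · exact (D.continuousOn_γ.comp hηc h).const_smul l₀
  have hL : ∀ s ∈ Icc 0 T, lagrangian H (η s) (-v s) ≠ ⊤ ∧
      (lagrangian H (η s) (-v s)).toReal ≤ b := fun s hs =>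
    toReal_lagrangian_le (hb s hs)
  obtain ⟨Kη, hKη⟩ := isCompact_Icc.exists_bound_of_continuousOn hη'
  refine ⟨?_, ?_, intervalIntegrable_const, ?_, hX, ?_⟩
  · refine LipschitzOnWith.absolutelyContinuousOnInterval (K := Real.toNNReal Kη) ?_
    rw [uIcc_of_le hT]
    refine (convex_Icc 0 T).lipschitzOnWith_of_nnnorm_hasDerivWithin_le hη fun s hs => ?_
    rw [← NNReal.coe_le_coe, coe_nnnorm]
    exact (hKη s hs).trans (Real.le_coe_toNNReal _)
  · refine ContinuousOn.intervalIntegrable ?_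
    rwa [uIcc_of_le hT]
  -- Projecting time onto `[0, T]` makes the data continuous on the whole line. The Lagrangian is
  -- then a supremum of continuous functions, hence measurable, and it lies between `-H (η s) 0` and
  -- `b`.
  · have hpc : Continuous fun s => ((projIcc 0 T hT s : Icc 0 T) : ℝ) :=
      continuous_subtype_val.comp continuous_projIcc
    have hpm : ∀ s, ((projIcc 0 T hT s : Icc 0 T) : ℝ) ∈ Icc 0 T := fun s => (projIcc 0 T hT s).2
    have hmeas : Measurable fun s => lagrangian H (η (projIcc 0 T hT s)) (-v (projIcc 0 T hT s)) :=
        by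
      refine LowerSemicontinuous.measurable (lowerSemicontinuous_iSup fun p => ?_)
      refine Continuous.lowerSemicontinuous (continuous_coe_real_ereal.comp ?_)
      refine Continuous.sub ?_ ?_
      · exact (hvc.comp_continuous hpc hpm).neg.inner continuous_const
      · have : ContinuousOn (fun s => H (η s) p) (Icc 0 T) :=
          D.continuousOn_H.comp (hηc.prodMk continuousOn_const) fun s hs => ⟨hX s hs, mem_univ _⟩
        exact this.comp_continuous hpc hpm
    have hcong : ∀ s ∈ Icc 0 T, (lagrangian H (η (projIcc 0 T hT s))
        (-v (projIcc 0 T hT s))).toReal = (lagrangian H (η s) (-v s)).toReal := fun s hs => by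
      rw [projIcc_of_mem hT hs]
    have hH0 : ContinuousOn (fun s => H (η s) 0) (Icc 0 T) :=
      D.continuousOn_H.comp (hηc.prodMk continuousOn_const) fun s hs => ⟨hX s hs, mem_univ _⟩
    obtain ⟨B, hB⟩ := isCompact_Icc.exists_bound_of_continuousOn hH0
    have h1 : IntervalIntegrable (fun s => (lagrangian H (η (projIcc 0 T hT s))
        (-v (projIcc 0 T hT s))).toReal) volume 0 T := by
      refine (intervalIntegrable_const (c := max |b| B)).mono_fun
        (hmeas.ereal_toReal.aestronglyMeasurable) ?_
      rw [EventuallyLE, ae_restrict_iff' measurableSet_uIoc]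
      refine Eventually.of_forall fun s hs => ?_
      rw [uIoc_of_le hT] at hs
      have hs := Ioc_subset_Icc_self hs
      rw [hcong s hs, Real.norm_eq_abs, Real.norm_eq_abs, abs_of_nonneg (a := max |b| B)
        (le_max_of_le_left (abs_nonneg _))]
      have h2 := inner_sub_le_toReal_lagrangian (hL s hs).1 0
      rw [inner_zero_right, zero_sub] at h2
      have h3 := (abs_le.1 (hB s hs)).2
      refine abs_le.2 ⟨?_, ?_⟩
      · have := le_max_right |b| B
        linarith
      · exact (hL s hs).2.trans ((le_abs_self b).trans (le_max_left _ _))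
    refine h1.congr fun s hs => ?_
    rw [uIoc_of_le hT] at hs
    exact hcong s (Ioc_subset_Icc_self hs)
  · refine Eventually.of_forall fun s hs => ?_
    have hs' := Ioo_subset_Icc_self hs
    refine ⟨(hL s hs').1, hl₀, fun hΩ => ?_, η' s, (hη s hs').hasDerivAt (Icc_mem_nhds hs.1 hs.2),
        rfl⟩
    rcases hl with h | h
    · exact h
    · exact absurd hΩ (notMem_of_mem_frontier D.isOpen (h s hs'))

lemma NeumannData.isArc_const (D : NeumannData Ω H γ g) {x : EuclideanSpace ℝ (Fin n)}
    (hx : x ∈ closure Ω) {T : ℝ}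
    (hT : 0 ≤ T) : IsArc Ω H γ T (fun _ => x) (fun _ => 0) (fun _ => 0) := by
  obtain ⟨c, hc, C, hC⟩ := D.exists_coercive_bound
  have := D.isArc_of_hasDerivWithinAt (T := T) (b := C) (l₀ := 0) (η := fun _ => x)
    (η' := fun _ => 0) hT (fun s _ => hasDerivWithinAt_const _ _ _) continuousOn_const
    (fun _ _ => hx) le_rfl (Or.inl rfl) (fun s _ p => by
      have h1 := hC x hx p
      have h2 : 0 ≤ c * ‖p‖ := by positivity
      simp only [zero_smul, add_zero, neg_zero, inner_zero_left]
      linarith)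
  simpa using this

/-- Every arc extends to a solution of the Skorokhod problem. -/
lemma IsArc.exists_isSkorokhodTriple (D : NeumannData Ω H γ g) {T : ℝ} (hT : 0 < T)
    {η v : ℝ → EuclideanSpace ℝ (Fin n)} {l : ℝ → ℝ} (h : IsArc Ω H γ T η v l) :
    ∃ η₁ v₁ l₁, IsSkorokhodTriple Ω γ η₁ v₁ l₁ ∧ η₁ 0 = η 0 ∧ η₁ T = η T ∧
      action H g η₁ v₁ l₁ T = ((∫ s in (0 : ℝ)..T, runningCost H g η v l s : ℝ) : EReal) := by
  have hηT := h.mem_closure T ⟨hT.le, le_rfl⟩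
  -- The extension rests at the endpoint, with zero velocity and zero reflection, for an arbitrary
  -- further time.
  have harc : ∀ S, 0 ≤ S → IsArc Ω H γ (T + S) (NeumannHJ.concat T η fun _ => η T)
      (NeumannHJ.concat T v fun _ => 0) (NeumannHJ.concat T l fun _ => 0) := fun S hS =>
    h.concat (D.isArc_const hηT hS) hT.le hS rfl
  set η₁ := NeumannHJ.concat T η fun _ => η T
  set v₁ : ℝ → EuclideanSpace ℝ (Fin n) := NeumannHJ.concat T v fun _ => 0
  set l₁ : ℝ → ℝ := NeumannHJ.concat T l fun _ => 0
  have hreg : ∀ᵐ t : ℝ, 0 < t → lagrangian H (η₁ t) (-v₁ t) ≠ ⊤ ∧ 0 ≤ l₁ t ∧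
      (η₁ t ∈ Ω → l₁ t = 0) ∧ ∃ η' : EuclideanSpace ℝ (Fin n), HasDerivAt η₁ η' t ∧ η' + l₁ t • γ
          (η₁ t) = v₁ t := by
    have := ae_all_iff.2 fun k : ℕ => (harc k k.cast_nonneg).ae_regular
    filter_upwards [this] with t ht ht0
    obtain ⟨k, hk⟩ := exists_nat_gt t
    exact ht k ⟨ht0, by linarith⟩
  have hsub : ∀ S : ℝ, 0 < S → uIcc 0 S ⊆ uIcc 0 (T + S) := fun S hS => by
    rw [uIcc_of_le hS.le, uIcc_of_le (by linarith)]
    exact Icc_subset_Icc le_rfl (by linarith)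
  refine ⟨η₁, v₁, l₁, ⟨fun S hS => (harc S hS.le).ac.mono (hsub S hS),
    fun S hS => (harc S hS.le).integrable_v.mono_set (hsub S hS),
    fun S hS => (harc S hS.le).integrable_l.mono_set (hsub S hS),
    fun t ht => (harc t ht).mem_closure t ⟨ht, by linarith⟩,
    hreg.mono fun t ht h0 => (ht h0).2.2.2, hreg.mono fun t ht h0 => (ht h0).2.1,
    hreg.mono fun t ht h0 => (ht h0).2.2.1⟩, concat_of_le _ _ hT.le, concat_of_le _ _ le_rfl, ?_⟩
  have h0 := harc 0 le_rfl
  rw [add_zero] at h0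
  rw [action, if_pos ⟨h0.ae_regular.mono fun t ht h1 => (ht h1).1, h0.integrable_lagrangian⟩]
  congr 1
  refine intervalIntegral.integral_congr fun s hs => ?_
  rw [uIcc_of_le hT.le] at hs
  simp only [runningCost, η₁, v₁, l₁, concat_of_le _ _ hs.2]

/-- `x'` can be reached from `x` in time `T` at cost `c`. -/
def Reach (Ω : Set (EuclideanSpace ℝ (Fin n)))
    (H : EuclideanSpace ℝ (Fin n) → EuclideanSpace ℝ (Fin n) → ℝ)
    (γ : EuclideanSpace ℝ (Fin n) → EuclideanSpace ℝ (Fin n)) (g : EuclideanSpace ℝ (Fin n) → ℝ)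
    (x x' : EuclideanSpace ℝ (Fin n)) (T c : ℝ) : Prop :=
  0 ≤ T ∧ ∃ η v l, IsArc Ω H γ T η v l ∧ η 0 = x ∧ η T = x' ∧
    ∫ s in (0 : ℝ)..T, runningCost H g η v l s = c

lemma Reach.trans (D : NeumannData Ω H γ g) {x x' x'' : EuclideanSpace ℝ (Fin n)} {T₁ T₂ c₁ c₂ : ℝ}
    (h₁ : Reach Ω H γ g x x' T₁ c₁) (h₂ : Reach Ω H γ g x' x'' T₂ c₂) :
    Reach Ω H γ g x x'' (T₁ + T₂) (c₁ + c₂) := by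
  obtain ⟨hT₁, η₁, v₁, l₁, ha₁, rfl, hx₁, rfl⟩ := h₁
  obtain ⟨hT₂, η₂, v₂, l₂, ha₂, hx₂, rfl, rfl⟩ := h₂
  have hg : η₁ T₁ = η₂ 0 := hx₁.trans hx₂.symm
  refine ⟨add_nonneg hT₁ hT₂, _, _, _, ha₁.concat ha₂ hT₁ hT₂ hg, concat_of_le _ _ hT₁,
    concat_add hg hT₂, ?_⟩
  rw [runningCost_concat]
  exact integral_concat hT₁ hT₂ (ha₁.intervalIntegrable_running D.continuousOn_g hT₁)
    (ha₂.intervalIntegrable_running D.continuousOn_g hT₂)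

lemma NeumannData.reach_of_hasDerivWithinAt (D : NeumannData Ω H γ g) {T b b' l₀ : ℝ}
    {η η' : ℝ → EuclideanSpace ℝ (Fin n)} (hT : 0 ≤ T)
    (hη : ∀ s ∈ Icc 0 T, HasDerivWithinAt η (η' s) (Icc 0 T) s) (hη' : ContinuousOn η' (Icc 0 T))
    (hX : ∀ s ∈ Icc 0 T, η s ∈ closure Ω) (hl₀ : 0 ≤ l₀)
    (hl : l₀ = 0 ∨ ∀ s ∈ Icc 0 T, η s ∈ frontier Ω)
    (hb : ∀ s ∈ Icc 0 T, ∀ p, ⟪-(η' s + l₀ • γ (η s)), p⟫ - H (η s) p ≤ b)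
    (hb' : ∀ s ∈ Icc 0 T, g (η s) * l₀ ≤ b') :
    ∃ c ≤ (b + b') * T, Reach Ω H γ g (η 0) (η T) T c := by
  have h := D.isArc_of_hasDerivWithinAt hT hη hη' hX hl₀ hl hb
  refine ⟨_, ?_, hT, η, _, _, h, rfl, rfl, rfl⟩
  calc _ ≤ ∫ s in (0 : ℝ)..T, (b + b') := by
        refine intervalIntegral.integral_mono_on hT
          (h.intervalIntegrable_running D.continuousOn_g hT) intervalIntegrable_const fun s hs => ?_
        exact add_le_add (toReal_lagrangian_le (hb s hs)).2 (hb' s hs)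
    _ = (b + b') * T := by rw [intervalIntegral.integral_const, smul_eq_mul, sub_zero, mul_comm]

end

section

/-! ### Construction of arcs -/

variable {Ω : Set (EuclideanSpace ℝ (Fin n))}
    {H : EuclideanSpace ℝ (Fin n) → EuclideanSpace ℝ (Fin n) → ℝ}
    {γ : EuclideanSpace ℝ (Fin n) → EuclideanSpace ℝ (Fin n)} {g : EuclideanSpace ℝ (Fin n) → ℝ}

/-- Dual form of coercivity: slow motion has bounded cost per unit time. All explicit connecting
paths are therefore traversed at speed at most `c`. -/
lemma NeumannData.exists_lagrangian_bound (D : NeumannData Ω H γ g) :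
    ∃ c > 0, ∃ C ≥ 0, ∀ x ∈ closure Ω, ∀ ξ : EuclideanSpace ℝ (Fin n), ‖ξ‖ ≤ c → ∀ p, ⟪ξ,
        p⟫ - H x p ≤ C := by
  obtain ⟨c, hc, C, hC⟩ := D.exists_coercive_bound
  refine ⟨c, hc, max C 0, le_max_right _ _, fun x hx ξ hξ p => ?_⟩
  have h1 := hC x hx p
  have h2 : ⟪ξ, p⟫ ≤ c * ‖p‖ := (real_inner_le_norm _ _).trans (by gcongr)
  exact le_max_of_le_left (by linarith)

/-- Waiting at a point. -/
lemma NeumannData.exists_reach_self (D : NeumannData Ω H γ g) :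
    ∃ C ≥ 0, ∀ x ∈ closure Ω, ∀ T ≥ 0, ∃ c ≤ C * T, Reach Ω H γ g x x T c := by
  obtain ⟨c, hc, C, hC0, hC⟩ := D.exists_lagrangian_bound
  refine ⟨C, hC0, fun x hx T hT => ?_⟩
  have := D.reach_of_hasDerivWithinAt (T := T) (b := C) (b' := 0) (l₀ := 0) (η := fun _ => x)
    (η' := fun _ => 0) hT (fun s _ => hasDerivWithinAt_const _ _ _) continuousOn_const
    (fun _ _ => hx) le_rfl (Or.inl rfl) (fun s _ => hC x hx _ (by simpa using hc.le))
    (by simp)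
  simpa using this

lemma NeumannData.exists_reach_segment (D : NeumannData Ω H γ g) :
    ∃ K ≥ 0, ∀ x x', segment ℝ x x' ⊆ closure Ω →
      ∃ T c, Reach Ω H γ g x x' T c ∧ c ≤ K * ‖x - x'‖ := by
  obtain ⟨c₀, hc₀, C, hC0, hC⟩ := D.exists_lagrangian_bound
  refine ⟨C / c₀, by positivity, fun x x' hseg => ?_⟩
  set T := ‖x - x'‖ / c₀ with hT
  have hT0 : 0 ≤ T := by positivity
  -- If the endpoints coincide, then `T = 0` and the convention `0⁻¹ = 0` makes the velocity zero,
  -- as it should be.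
  set u : EuclideanSpace ℝ (Fin n) := T⁻¹ • (x' - x) with hu
  have hTu : T • u = x' - x := by
    rcases hT0.eq_or_lt with h | h
    · have : ‖x - x'‖ = 0 := by
        rw [hT, eq_comm, div_eq_zero_iff] at h
        exact h.resolve_right hc₀.ne'
      rw [norm_sub_eq_zero_iff] at this
      simp [this, hu]
    · rw [hu, smul_smul, mul_inv_cancel₀ h.ne', one_smul]
  have hun : ‖u‖ ≤ c₀ := by
    rw [hu, norm_smul, norm_inv, Real.norm_of_nonneg hT0, norm_sub_rev x' x, hT]
    rcases (norm_nonneg (x - x')).eq_or_lt with h | h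
    · rw [← h]; simp [hc₀.le]
    · rw [inv_div, div_mul_cancel₀ _ h.ne']
  have hmem : ∀ s ∈ Icc 0 T, x + s • u ∈ closure Ω := by
    intro s hs
    refine hseg ?_
    rcases hT0.eq_or_lt with h | h
    · have hs0 : s = 0 := le_antisymm (hs.2.trans h.symm.le) hs.1
      rw [hs0, zero_smul, add_zero]
      exact left_mem_segment ℝ x x'
    · rw [segment_eq_image']
      refine ⟨s / T, ⟨div_nonneg hs.1 hT0, div_le_one_of_le₀ hs.2 hT0⟩, ?_⟩
      simp only [hu, smul_smul, div_eq_mul_inv]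
  obtain ⟨c, hc, h⟩ := D.reach_of_hasDerivWithinAt (T := T) (b := C) (b' := 0) (l₀ := 0)
    (η := fun s => x + s • u) (η' := fun _ => u) hT0
    (fun s _ => by
      simpa using ((hasDerivAt_id s).smul_const u).hasDerivWithinAt.const_add x)
    continuousOn_const hmem le_rfl (Or.inl rfl)
    (fun s hs => hC _ (hmem s hs) _ (by simpa using hun)) (by simp)
  simp only [zero_smul, add_zero, hTu, add_sub_cancel] at h hc
  refine ⟨T, c, h, hc.trans (le_of_eq ?_)⟩
  rw [hT]; ring

/-- Nearby points can be joined at a cost proportional to their distance. -/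
lemma NeumannData.exists_local_reach (D : NeumannData Ω H γ g) {x₀ : EuclideanSpace ℝ (Fin n)}
    (hx₀ : x₀ ∈ closure Ω) :
    ∃ r > 0, ∃ K, ∀ x ∈ closure Ω, dist x x₀ < r → ∀ x' ∈ closure Ω, dist x' x₀ < r →
      ∃ T c, Reach Ω H γ g x x' T c ∧ c ≤ K * ‖x - x'‖ := by
  obtain ⟨K, hK0, hK⟩ := D.exists_reach_segment
  obtain ⟨w, r, hr, κ, hκ, hcone⟩ := exists_interior_cone D.isOpen D.c1 hx₀
  refine ⟨min r (κ * r / 2), by positivity, K * (2 * ‖w‖ / κ + 1), fun x hx hxr x' hx' hxr' => ?_⟩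
  rcases eq_or_ne x x' with rfl | hne
  · obtain ⟨T, c, h⟩ := hK x x (by simpa using hx)
    exact ⟨T, c, by simpa using h⟩
  have hpos : 0 < ‖x - x'‖ := norm_sub_pos_iff.2 hne
  -- The height at which the interior cone is wide enough to contain the displacement `x' - x`. The
  -- path goes up to that height, across, and back down.
  set s := ‖x - x'‖ / κ with hs
  have hs0 : 0 < s := by positivity
  have hsr : s < r := by
    rw [hs, div_lt_iff₀ hκ, ← dist_eq_norm]
    rw [lt_min_iff] at hxr hxr'
    linarith [dist_triangle_right x x' x₀]
  rw [lt_min_iff] at hxr hxr'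
  have hκs : κ * s = ‖x - x'‖ := by rw [hs]; field_simp
  have hray : ∀ z ∈ closure Ω, dist z x₀ < r → segment ℝ z (z + s • w) ⊆ closure Ω := by
    intro z hz hzr
    rw [segment_eq_image']
    rintro _ ⟨θ, hθ, rfl⟩
    rcases hθ.1.eq_or_lt with rfl | hθ0
    · simpa using hz
    · refine subset_closure ?_
      have := hcone z hz hzr (θ * s) ⟨by positivity, by nlinarith [hθ.2]⟩ 0 (by
        rw [norm_zero]; positivity)
      simpa [smul_smul] using this
  obtain ⟨T₁, c₁, h₁, hc₁⟩ := hK x (x + s • w) (hray x hx hxr.1)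
  obtain ⟨T₂, c₂, h₂, hc₂⟩ := hK (x + s • w) (x' + s • w) (by
    rw [segment_eq_image']
    rintro _ ⟨θ, hθ, rfl⟩
    refine subset_closure ?_
    have := hcone x hx hxr.1 s ⟨hs0, hsr⟩ (θ • (x' - x)) (by
      rw [norm_smul, Real.norm_of_nonneg hθ.1, hκs, norm_sub_rev x' x]
      exact mul_le_of_le_one_left (norm_nonneg _) hθ.2)
    simpa using this)
  obtain ⟨T₃, c₃, h₃, hc₃⟩ := hK (x' + s • w) x' (by
    rw [segment_symm]; exact hray x' hx' hxr'.1)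
  refine ⟨_, _, (h₁.trans D h₂).trans D h₃, ?_⟩
  rw [sub_add_cancel_left, norm_neg, norm_smul, Real.norm_of_nonneg hs0.le] at hc₁
  rw [add_sub_add_right_eq_sub] at hc₂
  rw [add_sub_cancel_left, norm_smul, Real.norm_of_nonneg hs0.le] at hc₃
  have : K * (2 * ‖w‖ / κ + 1) * ‖x - x'‖ = K * (s * ‖w‖) + K * ‖x - x'‖ + K * (s * ‖w‖) := by
    rw [hs]; ring
  linarith

lemma NeumannData.exists_reach (D : NeumannData Ω H γ g) {x x' : EuclideanSpace ℝ (Fin n)}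
    (hx : x ∈ closure Ω)
    (hx' : x' ∈ closure Ω) : ∃ T c, Reach Ω H γ g x x' T c := by
  refine D.isConnected.isPreconnected.closure.induction₂'
      (fun x x' => ∃ T c, Reach Ω H γ g x x' T c)
    (fun z hz => ?_) (fun x y z _ _ _ ⟨T, c, h⟩ ⟨T', c', h'⟩ => ⟨_, _, h.trans D h'⟩) hx hx'
  obtain ⟨r, hr, K, hK⟩ := D.exists_local_reach hz
  filter_upwards [self_mem_nhdsWithin, mem_nhdsWithin_of_mem_nhds (Metric.ball_mem_nhds z hr)]
    with z' hz' hzr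
  obtain ⟨T, c, h, -⟩ := hK z hz (by simpa using hr) z' hz' hzr
  obtain ⟨T', c', h', -⟩ := hK z' hz' hzr z hz (by simpa using hr)
  exact ⟨⟨T, c, h⟩, ⟨T', c', h'⟩⟩

/-! ### Curves lying in the boundary. -/

namespace IsLocalDefiningFunction

variable {x : EuclideanSpace ℝ (Fin n)} {ψ : EuclideanSpace ℝ (Fin n) → ℝ}

/-- A nearby zero of ψ is not in Ω, but small steps against the gradient make ψ negative, so it is a
limit of points of Ω. -/
lemma exists_mem_frontier (h : IsLocalDefiningFunction Ω x ψ) (hΩ : IsOpen Ω) :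
    ∃ r > 0, ∀ z, dist z x < r → ψ z = 0 → z ∈ frontier Ω := by
  have hN : 0 < ‖∇ ψ x‖ := norm_pos_iff.2 h.gradient_ne_zero
  obtain ⟨r, hr, h1, -, -, h4⟩ := h.exists_radius hΩ (θ := ‖∇ ψ x‖ / 2) (by positivity)
  refine ⟨r, hr, fun z hz hz0 => ?_⟩
  rw [hΩ.frontier_eq]
  refine ⟨?_, fun hzΩ => by have := (h1 z hz).1 hzΩ; linarith⟩
  have hlim : Tendsto (fun ε : ℝ => z - ε • ∇ ψ x) (𝓝[>] 0) (𝓝 z) := by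
    have : Tendsto (fun ε : ℝ => z - ε • ∇ ψ x) (𝓝 0) (𝓝 (z - (0 : ℝ) • ∇ ψ x)) :=
      Continuous.tendsto (by fun_prop) 0
    rw [zero_smul, sub_zero] at this
    exact this.mono_left nhdsWithin_le_nhds
  refine mem_closure_of_tendsto hlim ?_
  filter_upwards [self_mem_nhdsWithin, hlim.eventually (Metric.isOpen_ball.mem_nhds hz)]
    with ε hε hεr
  have hε : 0 < ε := hε
  refine (h1 _ hεr).2 ?_
  have h5 := (abs_le.1 (h4 z _ hz hεr)).1
  rw [sub_sub_cancel, real_inner_smul_right, real_inner_self_eq_norm_sq, norm_smul,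
    Real.norm_of_nonneg hε.le, hz0] at h5
  have h6 : 0 < ε * ‖∇ ψ x‖ ^ 2 := by positivity
  nlinarith

/-- Tangent vectors of the boundary are velocities of curves in the boundary. -/
lemma exists_curve (h : IsLocalDefiningFunction Ω x ψ) (hΩ : IsOpen Ω) (hx : x ∈ frontier Ω)
    {ζ : EuclideanSpace ℝ (Fin n)} (hζ : ⟪∇ ψ x, ζ⟫ = 0) :
    ∃ T > 0, ∃ η η' : ℝ → EuclideanSpace ℝ (Fin n),
        (∀ s ∈ Icc 0 T, HasDerivWithinAt η (η' s) (Icc 0 T) s) ∧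
      ContinuousOn η' (Icc 0 T) ∧ η 0 = x ∧ η' 0 = ζ ∧ ∀ s ∈ Icc 0 T, η s ∈ frontier Ω := by
  set N := ∇ ψ x with hN
  have hN0 : N ≠ 0 := h.gradient_ne_zero
  obtain ⟨r, hr, hfr⟩ := h.exists_mem_frontier hΩ
  obtain ⟨r', hr', -, -, h3, -⟩ := h.exists_radius hΩ one_pos
  have hψx : ψ x = 0 := h3 x hx (by simpa using hr')
  let Λ : ℝ × ℝ →L[ℝ] EuclideanSpace ℝ (Fin n) := (ContinuousLinearMap.fst ℝ ℝ ℝ).smulRight ζ +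
    (ContinuousLinearMap.snd ℝ ℝ ℝ).smulRight N
  have hΛ : ∀ u, Λ u = u.1 • ζ + u.2 • N := fun u => rfl
  let F : ℝ × ℝ → ℝ := fun u => ψ (x + Λ u)
  have hF0 : F (0, 0) = 0 := by simp [F, hΛ, hψx]
  have hpt : x + Λ (0, 0) = x := by simp [hΛ]
  have hψ1 : ContDiffAt ℝ 1 ψ (x + Λ (0, 0)) := by rw [hpt]; exact h.contDiffAt
  have hFc : ContDiffAt ℝ 1 F (0, 0) :=
    hψ1.comp (0, 0) (contDiffAt_const.add Λ.contDiff.contDiffAt)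
  have hFd : fderiv ℝ F (0, 0) = (InnerProductSpace.toDual ℝ
      (EuclideanSpace ℝ (Fin n)) N).comp Λ := by
    have h1 : HasFDerivAt ψ (InnerProductSpace.toDual ℝ (EuclideanSpace ℝ (Fin n)) N)
        (x + Λ (0, 0)) := by
      rw [hpt]
      exact (h.contDiffAt.differentiableAt one_ne_zero).hasGradientAt.hasFDerivAt
    exact (h1.comp (0, 0) (Λ.hasFDerivAt.const_add x)).fderiv
  have ha : ‖N‖ ^ 2 ≠ 0 := by simpa using hN0
  have hinr : fderiv ℝ F (0, 0) ∘L .inr ℝ ℝ ℝ =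
      (ContinuousLinearEquiv.unitsEquivAut ℝ (Units.mk0 _ ha) : ℝ →L[ℝ] ℝ) := by
    ext
    rw [hFd]
    simp [hΛ]
  have hinl : fderiv ℝ F (0, 0) ∘L .inl ℝ ℝ ℝ = 0 := by
    ext
    rw [hFd]
    simp [hΛ, hζ]
  have hinv : (fderiv ℝ F (0, 0) ∘L .inr ℝ ℝ ℝ).IsInvertible := ⟨_, hinr.symm⟩
  -- The correction `ρ s` along the normal `N` keeps `x + s • ζ + ρ s • N` on the zero set of ψ. Its
  -- derivative at 0 vanishes because ζ is tangent, so the initial velocity is exactly ζ.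
  set ρ := hFc.implicitFunction one_ne_zero hinv
  have hρ0 : ρ 0 = 0 := hFc.implicitFunction_apply_self one_ne_zero hinv
  have hρF : ∀ᶠ s in 𝓝 (0 : ℝ), F (s, ρ s) = F (0, 0) :=
    hFc.eventually_apply_implicitFunction one_ne_zero hinv
  have hρd : HasStrictFDerivAt ρ (0 : ℝ →L[ℝ] ℝ) 0 := by
    have := hFc.hasStrictFDerivAt_implicitFunction one_ne_zero hinv
    rwa [hinl, ContinuousLinearMap.comp_zero, neg_zero] at this
  have hρc : ContDiffAt ℝ 1 ρ 0 := hFc.contDiffAt_implicitFunction one_ne_zero hinv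
  set η : ℝ → EuclideanSpace ℝ (Fin n) := fun s => x + (s • ζ + ρ s • N) with hη
  have hηc : ContDiffAt ℝ 1 η 0 :=
    contDiffAt_const.add ((contDiffAt_id.smul contDiffAt_const).add (hρc.smul contDiffAt_const))
  have hη0 : η 0 = x := by simp [hη, hρ0]
  have hηd : deriv η 0 = ζ := by
    have h1 : HasDerivAt ρ 0 0 := by simpa using hρd.hasFDerivAt.hasDerivAt
    have h2 := (((hasDerivAt_id (0 : ℝ)).smul_const ζ).add (h1.smul_const N)).const_add x
    have h3 : HasDerivAt η ((1 : ℝ) • ζ + (0 : ℝ) • N) 0 := h2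
    simpa using h3.deriv
  obtain ⟨U, hU, hUc⟩ := hηc.contDiffOn le_rfl (by simp)
  have hU : U ∈ 𝓝 (0 : ℝ) := by simpa using hU
  have hηb : ∀ᶠ s in 𝓝 (0 : ℝ), dist (η s) x < r :=
    (hη0 ▸ hηc.continuousAt.tendsto).eventually (Metric.ball_mem_nhds x hr)
  obtain ⟨δ, hδ, hδs⟩ := Metric.eventually_nhds_iff_ball.1
    ((eventually_mem_set.2 hU).and (hρF.and hηb))
  have hball : ∀ s ∈ Icc 0 (δ / 2), s ∈ Metric.ball (0 : ℝ) δ := fun s hs => by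
    rw [mem_ball_zero_iff, Real.norm_of_nonneg hs.1]
    linarith [hs.2]
  have hcd : ContDiffOn ℝ 1 η (Metric.ball 0 δ) := hUc.mono fun s hs => (hδs s hs).1
  refine ⟨δ / 2, by positivity, η, deriv η, fun s hs => ?_, ?_, hη0, hηd, fun s hs => ?_⟩
  · exact (((hcd.differentiableOn one_ne_zero) s (hball s hs)).differentiableAt
      (Metric.isOpen_ball.mem_nhds (hball s hs))).hasDerivAt.hasDerivWithinAt
  · exact (hcd.continuousOn_deriv_of_isOpen Metric.isOpen_ball le_rfl).mono hball
  · obtain ⟨-, h5, h6⟩ := hδs s (hball s hs)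
    refine hfr _ h6 ?_
    rw [hF0] at h5
    exact h5

end IsLocalDefiningFunction

end

section

/-! ### Short arcs that decrease a strict supersolution -/

variable {Ω : Set (EuclideanSpace ℝ (Fin n))}
    {H : EuclideanSpace ℝ (Fin n) → EuclideanSpace ℝ (Fin n) → ℝ}
    {γ : EuclideanSpace ℝ (Fin n) → EuclideanSpace ℝ (Fin n)} {g : EuclideanSpace ℝ (Fin n) → ℝ}
    {φ : EuclideanSpace ℝ (Fin n) → ℝ}

/-- With initial Skorokhod velocity -ξ the Lagrangian is about at most ⟪ξ, p⟫ - b', while φ changes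
at rate -⟪ξ, p⟫ - l₀⟪γ x, p⟫. Adding the boundary cost `g x * l₀` leaves at most -b' plus small
errors, as ⟪γ x, p⟫ ≥ g x whenever `l₀` is nonzero. -/
lemma NeumannData.exists_reach_of_curve (D : NeumannData Ω H γ g) (hφ : ContDiff ℝ 1 φ)
    {x ξ : EuclideanSpace ℝ (Fin n)} {b b' ρ : ℝ} (hbb : b < b') (hρ : 0 < ρ)
    (hξ : ∀ x' ∈ closure Ω, dist x' x < ρ → ∀ ξ', ‖ξ' - ξ‖ ≤ ρ → ∀ q,
      b' + ⟪ξ', q - ∇ φ x⟫ ≤ H x' q)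
    {T l₀ : ℝ} {η η' : ℝ → EuclideanSpace ℝ (Fin n)} (hT : 0 < T)
    (hη : ∀ s ∈ Icc 0 T, HasDerivWithinAt η (η' s) (Icc 0 T) s) (hη' : ContinuousOn η' (Icc 0 T))
    (hX : ∀ s ∈ Icc 0 T, η s ∈ closure Ω) (hl₀ : 0 ≤ l₀)
    (hl : l₀ = 0 ∨ ∀ s ∈ Icc 0 T, η s ∈ frontier Ω) (hη0 : η 0 = x)
    (hv : η' 0 + l₀ • γ x = -ξ) (hg : x ∈ frontier Ω → g x ≤ ⟪γ x, ∇ φ x⟫) {h₀ : ℝ} (hh₀ : 0 < h₀) :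
    ∃ h, 0 < h ∧ h < h₀ ∧ ∃ x' ∈ closure Ω, ∃ c, Reach Ω H γ g x x' h c ∧
      c + φ x' - φ x + b * h < 0 := by
  set p := ∇ φ x with hp
  -- Three errors of size ε occur, in the Lagrangian, in the boundary cost and in the expansion of
  -- φ; together they must stay below `b' - b`.
  set ε := (b' - b) / 4 with hε
  have hε0 : 0 < ε := by rw [hε]; linarith
  have h0I : (0 : ℝ) ∈ Icc 0 T := ⟨le_rfl, hT.le⟩
  have hηc : ContinuousOn η (Icc 0 T) := fun s hs => (hη s hs).continuousWithinAt
  have hvc : ContinuousOn (fun s => η' s + l₀ • γ (η s)) (Icc 0 T) := by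
    refine hη'.add ?_
    rcases hl with h | h
    · simpa [h] using continuousOn_const
    · exact (D.continuousOn_γ.comp hηc h).const_smul l₀
  have hgc : ContinuousOn (fun s => g (η s) * l₀) (Icc 0 T) := by
    rcases hl with h | h
    · simpa [h] using continuousOn_const
    · exact (D.continuousOn_g.comp hηc h).mul continuousOn_const
  have hlg : l₀ * (g x - ⟪γ x, p⟫) ≤ 0 := by
    rcases hl with h | h
    · simp [h]
    · exact mul_nonpos_of_nonneg_of_nonpos hl₀
        (sub_nonpos.2 (hg (by rw [← hη0]; exact h 0 h0I)))
  have e1 : ∀ᶠ s in 𝓝[Icc 0 T] 0, dist (η s) x < ρ := by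
    have := (hηc 0 h0I).tendsto.eventually (Metric.ball_mem_nhds _ hρ)
    rwa [hη0] at this
  have e2 : ∀ᶠ s in 𝓝[Icc 0 T] 0, dist (η' s + l₀ • γ (η s)) (-ξ) < ρ := by
    have := (hvc 0 h0I).tendsto.eventually (Metric.ball_mem_nhds _ hρ)
    rwa [hη0, hv] at this
  have e3 : ∀ᶠ s in 𝓝[Icc 0 T] 0, ⟪-(η' s + l₀ • γ (η s)), p⟫ < ⟪ξ, p⟫ + ε := by
    have h1 : ContinuousOn (fun s => ⟪-(η' s + l₀ • γ (η s)), p⟫) (Icc 0 T) :=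
      hvc.neg.inner continuousOn_const
    have := (h1 0 h0I).tendsto.eventually (gt_mem_nhds (lt_add_of_pos_right _ hε0))
    rwa [hη0, hv, neg_neg] at this
  have e4 : ∀ᶠ s in 𝓝[Icc 0 T] 0, g (η s) * l₀ < g x * l₀ + ε := by
    have := (hgc 0 h0I).tendsto.eventually (gt_mem_nhds (lt_add_of_pos_right _ hε0))
    rwa [hη0] at this
  have e5 : ∀ᶠ s in 𝓝[Icc 0 T] 0, φ (η s) - φ x ≤ s * (⟪p, η' 0⟫ + ε) := by
    have h1 : HasDerivWithinAt (φ ∘ η) (⟪p, η' 0⟫) (Icc 0 T) 0 := by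
      have := (contDiff_hasGradientAt hφ (η 0)).hasFDerivAt.comp_hasDerivWithinAt (0 : ℝ) (hη 0 h0I)
      rwa [InnerProductSpace.toDual_apply_apply, hη0] at this
    filter_upwards [(hasDerivWithinAt_iff_isLittleO.1 h1).def hε0,
        self_mem_nhdsWithin] with s hs hsI
    rw [sub_zero, Function.comp_apply, Function.comp_apply, hη0, Real.norm_eq_abs,
      Real.norm_of_nonneg hsI.1, smul_eq_mul] at hs
    linarith [(abs_le.1 hs).2]
  obtain ⟨δ, hδ, hδs⟩ := Metric.mem_nhdsWithin_iff.1 (e1.and (e2.and (e3.and (e4.and e5))))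
  obtain ⟨h, hh, hhlt⟩ := exists_between (lt_min hδ (lt_min hT hh₀))
  rw [lt_min_iff, lt_min_iff] at hhlt
  have hsub : Icc 0 h ⊆ Icc 0 T := Icc_subset_Icc le_rfl hhlt.2.1.le
  have hall : ∀ s ∈ Icc 0 h, _ := fun s hs => hδs ⟨by
    rw [mem_ball_zero_iff, Real.norm_of_nonneg hs.1]
    exact hs.2.trans_lt hhlt.1, hsub hs⟩
  obtain ⟨c, hc, hr⟩ := D.reach_of_hasDerivWithinAt (T := h) (b := ⟪ξ, p⟫ + ε - b')
    (b' := g x * l₀ + ε) (l₀ := l₀) (η := η) (η' := η') hh.le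
    (fun s hs => (hη s (hsub hs)).mono hsub) (hη'.mono hsub) (fun s hs => hX s (hsub hs)) hl₀
    (hl.imp id fun h s hs => h s (hsub hs)) (fun s hs q => by
      obtain ⟨h1, h2, h3, -⟩ := hall s hs
      have h4 := hξ _ (hX s (hsub hs)) h1 (-(η' s + l₀ • γ (η s))) (by
        rw [← norm_neg, neg_sub, sub_neg_eq_add, add_comm, ← sub_neg_eq_add, ← dist_eq_norm]
        exact h2.le) q
      rw [inner_sub_right] at h4
      linarith) (fun s hs => (hall s hs).2.2.2.1.le)
  rw [hη0] at hr
  refine ⟨h, hh, hhlt.2.2, η h, hX h (hsub ⟨hh.le, le_rfl⟩), c, hr, ?_⟩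
  have h5 : φ (η h) - φ x ≤ h * (⟪p, η' 0⟫ + ε) := (hall h ⟨hh.le, le_rfl⟩).2.2.2.2
  have h6 : ⟪p, η' 0⟫ = -⟪ξ, p⟫ - l₀ * ⟪γ x, p⟫ := by
    rw [eq_sub_of_add_eq hv, inner_sub_right, inner_neg_right, real_inner_smul_right,
      real_inner_comm ξ p, real_inner_comm (γ x) p]
  rw [h6] at h5
  have h7 : h * (l₀ * (g x - ⟪γ x, p⟫) + 3 * ε - (b' - b)) < 0 :=
    mul_neg_of_pos_of_neg hh (by rw [hε]; linarith)
  linarith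

lemma hasDerivWithinAt_line (x ζ : EuclideanSpace ℝ (Fin n)) (s : ℝ) (S : Set ℝ) :
    HasDerivWithinAt (fun s : ℝ => x + s • ζ) ζ S s := by
  simpa using ((hasDerivAt_id s).smul_const ζ).hasDerivWithinAt.const_add x

/-- Moving with velocity -ξ, where ξ is a stable supporting slope, lowers φ plus cost at a rate
better than -b. The straight line is used if it stays in the closure; at a frontier point where -ξ
does not point strictly inwards, the arc slides along the boundary instead. -/
lemma NeumannData.exists_reach_of_lt (D : NeumannData Ω H γ g) (hφ : ContDiff ℝ 1 φ)
    {x : EuclideanSpace ℝ (Fin n)} (hx : x ∈ closure Ω) {b : ℝ} (hb : b < H x (∇ φ x))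
    (hg : x ∈ frontier Ω → g x ≤ ⟪γ x, ∇ φ x⟫) {h₀ : ℝ} (hh₀ : 0 < h₀) :
    ∃ h, 0 < h ∧ h < h₀ ∧ ∃ x' ∈ closure Ω, ∃ c, Reach Ω H γ g x x' h c ∧
      c + φ x' - φ x + b * h < 0 := by
  obtain ⟨b', hbb, hb'⟩ := exists_between hb
  obtain ⟨ξ, ρ, hρ, hξ⟩ := D.exists_stable_slope hx hb'
  have hline : ∀ T : ℝ, 0 < T → (∀ s ∈ Icc 0 T, x + s • (-ξ) ∈ closure Ω) →
      ∃ h, 0 < h ∧ h < h₀ ∧ ∃ x' ∈ closure Ω, ∃ c, Reach Ω H γ g x x' h c ∧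
        c + φ x' - φ x + b * h < 0 := fun T hT hmem =>
    D.exists_reach_of_curve (T := T) hφ hbb hρ hξ (η := fun s => x + s • (-ξ)) (η' := fun _ => -ξ)
      (l₀ := 0) hT (fun s _ => hasDerivWithinAt_line _ _ _ _) continuousOn_const hmem le_rfl
      (Or.inl rfl) (by simp) (by simp) hg hh₀
  rcases mem_or_mem_frontier hx with hΩ | hΓ
  · have h1 : ∀ᶠ s in 𝓝 (0 : ℝ), x + s • (-ξ) ∈ Ω := by
      have h2 : Tendsto (fun s : ℝ => x + s • (-ξ)) (𝓝 0) (𝓝 (x + (0 : ℝ) • (-ξ))) :=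
        Continuous.tendsto (by fun_prop) 0
      rw [zero_smul, add_zero] at h2
      exact h2.eventually (D.isOpen.mem_nhds hΩ)
    obtain ⟨δ, hδ, h2⟩ := Metric.eventually_nhds_iff_ball.1 h1
    refine hline (δ / 2) (by positivity) fun s hs => subset_closure (h2 s ?_)
    rw [mem_ball_zero_iff, Real.norm_of_nonneg hs.1]
    linarith [hs.2]
  · obtain ⟨ψ, hψ⟩ := D.c1 x hΓ
    rcases lt_or_ge ⟪∇ ψ x, -ξ⟫ 0 with h | h
    · obtain ⟨r, hr, κ, hκ, hcone⟩ := hψ.exists_cone D.isOpen h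
      refine hline (r / 2) (by positivity) fun s hs => ?_
      rcases hs.1.eq_or_lt with rfl | hs0
      · simpa using hx
      · have := hcone x hx (by simpa using hr) s ⟨hs0, by linarith [hs.2]⟩ 0
          (by rw [norm_zero]; positivity)
        rw [add_zero] at this
        exact subset_closure this
    · have hpos := hψ.inner_gradient_pos D.oblique hΓ
      -- The reflection rate that removes the normal component of -ξ; it is nonnegative because -ξ
      -- does not point strictly inwards.
      set l₀ := ⟪∇ ψ x, -ξ⟫ / ⟪∇ ψ x, γ x⟫ with hl₀
      obtain ⟨T, hT, η, η', h1, h2, h3, h4, h5⟩ := hψ.exists_curve D.isOpen hΓ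
        (ζ := -ξ - l₀ • γ x) (by
          rw [inner_sub_right, real_inner_smul_right, hl₀, div_mul_cancel₀ _ hpos.ne', sub_self])
      exact D.exists_reach_of_curve hφ hbb hρ hξ hT h1 h2
        (fun s hs => mem_closure_of_mem_frontier (h5 s hs)) (div_nonneg h hpos.le) (Or.inr h5) h3
        (by rw [h4, sub_add_cancel]) hg hh₀

/-! ### The minimal action -/

/-- The infimum of the costs of going from `x` to `y` in time larger than `τ`. -/
def minAction (Ω : Set (EuclideanSpace ℝ (Fin n)))
    (H : EuclideanSpace ℝ (Fin n) → EuclideanSpace ℝ (Fin n) → ℝ)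
    (γ : EuclideanSpace ℝ (Fin n) → EuclideanSpace ℝ (Fin n)) (g : EuclideanSpace ℝ (Fin n) → ℝ)
    (y : EuclideanSpace ℝ (Fin n)) (τ : ℝ) (x : EuclideanSpace ℝ (Fin n)) : ℝ :=
  sInf {c | ∃ t, τ < t ∧ Reach Ω H γ g x y t c}

section MinAction

variable {y : EuclideanSpace ℝ (Fin n)} {u : EuclideanSpace ℝ (Fin n) → ℝ}

lemma NeumannData.sub_le_of_reach (D : NeumannData Ω H γ g) {K : ℝ} (hK0 : 0 ≤ K)
    (hK : ∀ x ∈ closure Ω, ∀ x' ∈ closure Ω, u x - u x' ≤ K * ‖x - x'‖)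
    (hu : SubTest Ω H γ g 0 u) {x x' : EuclideanSpace ℝ (Fin n)} {T c : ℝ}
        (h : Reach Ω H γ g x x' T c) :
    u x - u x' ≤ c := by
  obtain ⟨hT, η, v, l, ha, rfl, rfl, rfl⟩ := h
  exact D.sub_le_action hK0 hK hu ha le_rfl hT le_rfl

lemma NeumannData.bddBelow_costs (D : NeumannData Ω H γ g) (hc : criticalValue Ω H γ g = 0)
    (y : EuclideanSpace ℝ (Fin n)) (τ : ℝ) (x : EuclideanSpace ℝ (Fin n)) : BddBelow
        {c | ∃ t, τ < t ∧ Reach Ω H γ g x y t c} := by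
  obtain ⟨u, hu⟩ := D.exists_critical_subsolution hc
  obtain ⟨K, hK0, hK⟩ := D.exists_lipschitz 0
  refine ⟨u x - u y, ?_⟩
  rintro c ⟨t, -, h⟩
  exact D.sub_le_of_reach hK0 (hK u hu) hu.2.2 h

lemma NeumannData.nonempty_costs (D : NeumannData Ω H γ g) (hy : y ∈ closure Ω) (τ : ℝ)
    {x : EuclideanSpace ℝ (Fin n)}
    (hx : x ∈ closure Ω) : {c | ∃ t, τ < t ∧ Reach Ω H γ g x y t c}.Nonempty := by
  obtain ⟨C, hC0, hC⟩ := D.exists_reach_self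
  obtain ⟨T, c, h⟩ := D.exists_reach hx hy
  obtain ⟨c', -, h'⟩ := hC x hx (|τ| + 1) (by positivity)
  refine ⟨_, _, ?_, h'.trans D h⟩
  linarith [le_abs_self τ, h.1]

lemma NeumannData.minAction_le (D : NeumannData Ω H γ g) (hc : criticalValue Ω H γ g = 0)
    {τ t c : ℝ} {x : EuclideanSpace ℝ (Fin n)} (ht : τ < t) (h : Reach Ω H γ g x y t c) :
    minAction Ω H γ g y τ x ≤ c :=
  csInf_le (D.bddBelow_costs hc y τ x) ⟨t, ht, h⟩

/-- The dynamic programming inequality. -/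
lemma NeumannData.minAction_le_add (D : NeumannData Ω H γ g) (hc : criticalValue Ω H γ g = 0)
    (hy : y ∈ closure Ω) {σ τ t c : ℝ} {x x' : EuclideanSpace ℝ (Fin n)} (hx' : x' ∈ closure Ω)
        (hτ : τ ≤ σ + t)
    (h : Reach Ω H γ g x x' t c) :
    minAction Ω H γ g y τ x ≤ c + minAction Ω H γ g y σ x' := by
  rw [← sub_le_iff_le_add']
  refine le_csInf (D.nonempty_costs hy σ hx') ?_
  rintro c' ⟨t', ht', h'⟩
  rw [sub_le_iff_le_add']
  exact D.minAction_le hc (by linarith) (h.trans D h')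

/-- The duration is required to be strictly larger than τ, so an almost optimal arc remains
admissible for all nearby values of τ. -/
lemma NeumannData.upperSemicontinuous_minAction (D : NeumannData Ω H γ g)
    (hc : criticalValue Ω H γ g = 0) (hy : y ∈ closure Ω) {x : EuclideanSpace ℝ (Fin n)}
        (hx : x ∈ closure Ω) :
    UpperSemicontinuous fun τ => minAction Ω H γ g y τ x := by
  intro τ b hb
  obtain ⟨c, ⟨t, ht, hr⟩, hcb⟩ := exists_lt_of_csInf_lt (D.nonempty_costs hy τ hx) hb
  filter_upwards [gt_mem_nhds ht] with σ hσ
  exact (D.minAction_le hc hσ hr).trans_lt hcb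

/-- Prepending a short connecting arc only lengthens the duration, so its cost bounds the increment
with a constant independent of τ. -/
lemma NeumannData.exists_lipschitz_minAction (D : NeumannData Ω H γ g)
    (hc : criticalValue Ω H γ g = 0) (hy : y ∈ closure Ω) :
    ∃ K ≥ 0, ∀ τ, ∀ x ∈ closure Ω, ∀ x' ∈ closure Ω,
      minAction Ω H γ g y τ x - minAction Ω H γ g y τ x' ≤ K * ‖x - x'‖ := by
  obtain ⟨K, hK0, hK⟩ := exists_lipschitz_of_local D.isCompact D.isConnected.isPreconnected.closure
    (fun f => ∃ τ, f = minAction Ω H γ g y τ) fun x₀ hx₀ => by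
      obtain ⟨r, hr, K, hK⟩ := D.exists_local_reach hx₀
      refine ⟨r, hr, K, ?_⟩
      rintro _ ⟨τ, rfl⟩ x hx hxr x' hx' hxr'
      obtain ⟨T, c, h, hcK⟩ := hK x hx hxr x' hx' hxr'
      have := D.minAction_le_add hc hy hx' (σ := τ) (τ := τ) (by linarith [h.1]) h
      linarith
  exact ⟨K, hK0, fun τ => hK _ ⟨τ, rfl⟩⟩

lemma NeumannData.minAction_zero_self_le (D : NeumannData Ω H γ g)
    (hc : criticalValue Ω H γ g = 0) (hy : y ∈ closure Ω) : minAction Ω H γ g y 0 y ≤ 0 := by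
  obtain ⟨C, hC0, hC⟩ := D.exists_reach_self
  refine le_of_forall_pos_le_add fun ε hε => ?_
  obtain ⟨c, hcle, h⟩ := hC y hy (ε / (C + 1)) (by positivity)
  refine (D.minAction_le hc (by positivity) h).trans (hcle.trans ?_)
  rw [zero_add, mul_div_assoc', div_le_iff₀ (by positivity)]
  nlinarith

/-- If a test function touches from above, at `x`, a function which satisfies the dynamic
programming inequality for short arcs with discount rate `b`, then it is a strict subsolution. -/
lemma NeumannData.subIneq_of_dynamic (D : NeumannData Ω H γ g) {W : EuclideanSpace ℝ (Fin n) → ℝ}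
    {b h₀ : ℝ}
    (hh₀ : 0 < h₀) {x : EuclideanSpace ℝ (Fin n)} (hx : x ∈ closure Ω)
    (hW : ∀ x' ∈ closure Ω, ∀ h c, 0 < h → h < h₀ → Reach Ω H γ g x x' h c →
      W x ≤ c + W x' + b * h) (hφ : ContDiff ℝ 1 φ)
    (hmax : IsMaxOn (fun z => W z - φ z) (closure Ω) x) : SubIneq Ω H γ g b x (∇ φ x) := by
  have key : (x ∈ frontier Ω → g x ≤ ⟪γ x, ∇ φ x⟫) → H x (∇ φ x) ≤ b := by
    intro hg
    by_contra! hb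
    obtain ⟨h, hh, hhh, x', hx', c, hr, hlt⟩ := D.exists_reach_of_lt hφ hx hb hg hh₀
    have h1 := hW x' hx' h c hh hhh hr
    have h2 : W x' - φ x' ≤ W x - φ x := hmax hx'
    linarith
  refine ⟨fun hΩ => key fun hΓ => absurd hΩ (notMem_of_mem_frontier D.isOpen hΓ), fun hΓ => ?_⟩
  rcases le_total ⟪γ x, ∇ φ x⟫ (g x) with h | h
  · exact Or.inr h
  · exact Or.inl (key fun _ => h)

lemma NeumannData.subTest_minAction_zero (D : NeumannData Ω H γ g)
    (hc : criticalValue Ω H γ g = 0) (hy : y ∈ closure Ω) :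
    SubTest Ω H γ g 0 (minAction Ω H γ g y 0) := fun x hx φ hφ hmax =>
  D.subIneq_of_dynamic one_pos hx (fun x' hx' h c hh _ hr => by
    have := D.minAction_le_add hc hy hx' (σ := 0) (τ := 0) (by linarith) hr
    linarith) hφ hmax

end MinAction

end

section

/-! ### Comparison and the Aubry set -/

variable {Ω : Set (EuclideanSpace ℝ (Fin n))}
    {H : EuclideanSpace ℝ (Fin n) → EuclideanSpace ℝ (Fin n) → ℝ}
    {γ : EuclideanSpace ℝ (Fin n) → EuclideanSpace ℝ (Fin n)} {g : EuclideanSpace ℝ (Fin n) → ℝ}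
    {a : ℝ} {W d w : EuclideanSpace ℝ (Fin n) → ℝ} {y : EuclideanSpace ℝ (Fin n)}

/-- The viscosity supersolution tests for `w` itself, rather than for its envelope. -/
def SuperTest (Ω : Set (EuclideanSpace ℝ (Fin n)))
    (H : EuclideanSpace ℝ (Fin n) → EuclideanSpace ℝ (Fin n) → ℝ)
    (γ : EuclideanSpace ℝ (Fin n) → EuclideanSpace ℝ (Fin n)) (g : EuclideanSpace ℝ (Fin n) → ℝ)
    (a : ℝ) (w : EuclideanSpace ℝ (Fin n) → ℝ) : Prop :=
  ∀ x ∈ closure Ω, ∀ φ : EuclideanSpace ℝ (Fin n) → ℝ, ContDiff ℝ 1 φ →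
    IsMinOn (fun z => w z - φ z) (closure Ω) x →
      (x ∈ Ω → a ≤ H x (∇ φ x)) ∧ (x ∈ frontier Ω → a ≤ H x (∇ φ x) ∨ g x ≤ ⟪γ x, ∇ φ x⟫)

lemma isSupersolution_iff (hw : ContinuousOn w (closure Ω)) :
    IsSupersolution Ω H γ g a w ↔ BddBelow (w '' closure Ω) ∧ SuperTest Ω H γ g a w := by
  refine and_congr_right fun _ => forall₂_congr fun x hx => forall₂_congr fun φ _ => ?_
  have h : IsMinOn (fun z => lscEnvelope Ω w z - φ z) (closure Ω) x ↔
      IsMinOn (fun z => w z - φ z) (closure Ω) x := by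
    simp only [isMinOn_iff]
    exact forall₂_congr fun z hz => by rw [lscEnvelope_eq hw hx, lscEnvelope_eq hw hz]
  rw [h]

lemma SuperTest.congr (hw : SuperTest Ω H γ g a w) (h : ∀ x ∈ closure Ω, w x = d x) :
    SuperTest Ω H γ g a d := fun x hx φ hφ hm =>
  hw x hx φ hφ (isMinOn_iff.2 fun z hz => by
    simpa only [h x hx, h z hz] using isMinOn_iff.1 hm z hz)

/-- Comparison between a function that is a strict subsolution wherever it exceeds `d` and a
supersolution `d`. -/
lemma NeumannData.le_of_strict (D : NeumannData Ω H γ g) {K δ : ℝ} (hK0 : 0 ≤ K) (hδ : 0 < δ)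
    (hWK : ∀ x ∈ closure Ω, ∀ x' ∈ closure Ω, W x - W x' ≤ K * ‖x - x'‖)
    (hdK : ∀ x ∈ closure Ω, ∀ x' ∈ closure Ω, d x - d x' ≤ K * ‖x - x'‖)
    (hW : ∀ x ∈ closure Ω, d x < W x → ∀ φ : EuclideanSpace ℝ (Fin n) → ℝ, ContDiff ℝ 1 φ →
      IsMaxOn (fun z => W z - φ z) (closure Ω) x → SubIneq Ω H γ g (-δ) x (∇ φ x))
    (hd : SuperTest Ω H γ g 0 d) : ∀ x ∈ closure Ω, W x ≤ d x := by
  have hWc := continuousOn_of_lipschitz hWK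
  have hdc := continuousOn_of_lipschitz hdK
  by_contra! hex
  obtain ⟨x₁, hx₁, hlt⟩ := hex
  obtain ⟨x₀, hx₀, hmax₀⟩ := D.isCompact.exists_isMaxOn ⟨x₁, hx₁⟩ (hWc.sub hdc)
  set m := W x₀ - d x₀ with hm
  have hmle : ∀ x ∈ closure Ω, W x - d x ≤ m := fun x hx => hmax₀ hx
  have hm0 : 0 < m := by linarith [hmle x₁ hx₁]
  obtain ⟨A, e, c, hchart⟩ := exists_isChart D.isOpen D.c1 D.oblique D.continuousOn_γ hx₀
  have hc := hchart.pos
  set q := (g x₀ / ‖γ x₀‖ ^ 2) • γ x₀ with hq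
  set C₂ := 2 * (K + ‖e‖ + ‖q‖) / c with hC₂
  have hC₂0 : 0 ≤ C₂ := by positivity
  -- Chosen so that, from distance `r / 2` on, the penalty of strength β dominates the linear tilts
  -- with a margin `κ * ρ`.
  set C₁ := 4 * (2 * ‖e‖ + 1) / c with hC₁
  have hC₁0 : 0 < C₁ := by positivity
  set P := ‖A‖ * C₂ + ‖q‖ + ‖e‖ + C₁ * ‖A‖ with hP
  obtain ⟨δ', hδ', hmod⟩ := D.exists_modulus P hδ
  -- The second smallness condition keeps the two test gradients within the modulus of continuity of
  -- `H`; the third preserves the positivity of `W - d` at the maximum point.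
  obtain ⟨κ, hκ, hκ1, hκ2, hκ3⟩ : ∃ κ > 0, κ ≤ 1 ∧ κ * (2 * ‖e‖ + C₁ * ‖A‖) < δ' ∧
      κ * (2 * ‖e‖) < m / 2 := by
    have h : ∀ C ≥ (0 : ℝ), ∀ b > 0, ∀ᶠ κ : ℝ in 𝓝[>] 0, κ * C < b := fun C _ b hb => by
      have : Tendsto (fun κ : ℝ => κ * C) (𝓝[>] 0) (𝓝 (0 * C)) :=
        (Continuous.tendsto (by fun_prop) 0).mono_left nhdsWithin_le_nhds
      rw [zero_mul] at this
      exact this.eventually (gt_mem_nhds hb)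
    obtain ⟨κ, h1, h2, h3, h4⟩ := ((h 1 zero_le_one 1 one_pos).and
      ((h (2 * ‖e‖ + C₁ * ‖A‖) (by positivity) δ' hδ').and
        ((h (2 * ‖e‖) (by positivity) (m / 2) (by positivity)).and self_mem_nhdsWithin))).exists
    exact ⟨κ, h4, by linarith, h2, h3⟩
  obtain ⟨r₁, hr₁, hest₁⟩ := D.exists_chart_estimates hx₀ hchart (κ := κ / 4) (C := max C₁ C₂)
    (by positivity) (le_max_of_le_right hC₂0)
  set r := min r₁ 1 with hr_def
  have hr : 0 < r := lt_min hr₁ one_pos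
  have hest := fun z hz (hzr : dist z x₀ < r) => hest₁ z hz (hzr.trans_le (min_le_left _ _))
  -- The localization has to beat tilts of size κ at distance of order `r`, yet its gradient there
  -- is only O(κ).
  set β := C₁ * κ / r with hβ
  have hβ0 : 0 < β := by positivity
  have hβr : β * r = C₁ * κ := by rw [hβ]; field_simp
  set C₃ := (K + ‖q‖ + ‖e‖) * C₂ with hC₃
  have hC₃0 : 0 ≤ C₃ := by positivity
  obtain ⟨ε, hε, hε2, hε3⟩ : ∃ ε > 0, C₂ * ε < min δ' (r / 2) ∧
      C₃ * ε < min (r * κ / 2) (m / 2) := by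
    have h : ∀ C b : ℝ, 0 < b → ∀ᶠ κ : ℝ in 𝓝[>] 0, C * κ < b := fun C b hb => by
      have : Tendsto (fun κ : ℝ => C * κ) (𝓝[>] 0) (𝓝 (C * 0)) :=
        (Continuous.tendsto (by fun_prop) 0).mono_left nhdsWithin_le_nhds
      rw [mul_zero] at this
      exact this.eventually (gt_mem_nhds hb)
    obtain ⟨ε, h1, h2, h3⟩ := ((h C₂ (min δ' (r / 2)) (by positivity)).and
      ((h C₃ (min (r * κ / 2) (m / 2)) (by positivity)).and self_mem_nhdsWithin)).exists
    exact ⟨ε, h3, h1, h2⟩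
  rw [lt_min_iff] at hε2 hε3
  let φ₁ : EuclideanSpace ℝ (Fin n) → EuclideanSpace ℝ (Fin n) → ℝ :=
      fun x' x => quadTest A q ε x' x + ⟪κ • e, x - x₀⟫
  -- Besides localizing near `x₀`, this carries a second tilt: the gradient tested on `W` is shifted
  -- by `κ • e` and the one tested on `d` by `-κ • e`, so each boundary alternative fails at its own
  -- point.
  let φ₂ : EuclideanSpace ℝ (Fin n) → ℝ := fun x' => quadTest A (κ • e) β⁻¹ x₀ x'
  have hφ₁c : Continuous fun z : EuclideanSpace ℝ (Fin n) × EuclideanSpace ℝ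
      (Fin n) => φ₁ z.2 z.1 := by
    simp only [φ₁, quadTest]
    fun_prop
  have hφ₂c : Continuous φ₂ := (contDiff_quadTest A (κ • e) β⁻¹ x₀).continuous
  obtain ⟨⟨x, x'⟩, hxx, hmax⟩ := (D.isCompact.prod D.isCompact).exists_isMaxOn
    (f := fun z : EuclideanSpace ℝ (Fin n) × EuclideanSpace ℝ
        (Fin n) => W z.1 - d z.2 - φ₁ z.2 z.1 - φ₂ z.2) ⟨(x₀, x₀), hx₀, hx₀⟩
    ((((hWc.comp continuousOn_fst fun z hz => hz.1).sub
      (hdc.comp continuousOn_snd fun z hz => hz.2)).sub hφ₁c.continuousOn).sub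
      (hφ₂c.comp continuous_snd).continuousOn)
  obtain ⟨hx, hx'⟩ : x ∈ closure Ω ∧ x' ∈ closure Ω := hxx
  have hmx : ∀ z ∈ closure Ω, ∀ z' ∈ closure Ω,
      W z - d z' - φ₁ z' z - φ₂ z' ≤ W x - d x' - φ₁ x' x - φ₂ x' := fun z hz z' hz' =>
    hmax (show (z, z') ∈ closure Ω ×ˢ closure Ω from ⟨hz, hz'⟩)
  have hκe : ∀ ξ : EuclideanSpace ℝ (Fin n), |⟪κ • e, ξ⟫| ≤ κ * ‖e‖ * ‖ξ‖ := fun ξ => by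
    refine (abs_real_inner_le_norm _ _).trans (le_of_eq ?_)
    rw [norm_smul, Real.norm_of_nonneg hκ.le]
  have hκe1 : κ * ‖e‖ ≤ ‖e‖ := mul_le_of_le_one_left (norm_nonneg _) hκ1
  have hquad0 : ∀ z, quadTest A q ε z z = 0 := quadTest_self A q ε
  have hclose : ‖x - x'‖ ≤ C₂ * ε := by
    have h1 := hmx x' hx' x' hx'
    have h2 := hWK x hx x' hx'
    have h3 : ⟪κ • e, x' - x₀⟫ - ⟪κ • e, x - x₀⟫ ≤ ‖e‖ * ‖x - x'‖ := by
      rw [← inner_sub_right, sub_sub_sub_cancel_right, norm_sub_rev]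
      exact (le_abs_self _).trans ((hκe _).trans (by gcongr))
    have h4 : quadTest A q ε x' x ≤ (K + ‖e‖) * ‖x - x'‖ := by
      simp only [φ₁, hquad0] at h1
      linarith
    exact hchart.norm_sub_le_of_quadTest_le hε h4 (by positivity)
  have hquad : -(‖q‖ * ‖x - x'‖) ≤ quadTest A q ε x' x := by
    have h1 := hchart.quadTest_ge (q := q) hε x' x
    have h2 : 0 ≤ (2 * ε)⁻¹ * (c * ‖x - x'‖ ^ 2) := by positivity
    linarith
  set ρ := ‖x' - x₀‖ with hρ
  have hquad2 : β / 2 * (c * ρ ^ 2) - κ * ‖e‖ * ρ ≤ φ₂ x' := by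
    have h1 := hchart.quadTest_ge (q := κ • e) (inv_pos.2 hβ0) x₀ x'
    rw [norm_smul, Real.norm_of_nonneg hκ.le] at h1
    have h2 : (2 * β⁻¹)⁻¹ = β / 2 := by rw [mul_inv, inv_inv]; ring
    rwa [h2] at h1
  have hge : m ≤ W x - d x' - φ₁ x' x - φ₂ x' := by
    have h1 := hmx x₀ hx₀ x₀ hx₀
    have h2 : φ₁ x₀ x₀ = 0 := by simp [φ₁, hquad0]
    have h3 : φ₂ x₀ = 0 := quadTest_self _ _ _ _
    linarith
  have hlin : -(κ * ‖e‖ * (ρ + ‖x - x'‖)) ≤ ⟪κ • e, x - x₀⟫ := by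
    have h1 := (abs_le.1 (hκe (x - x₀))).1
    have h2 : ‖x - x₀‖ ≤ ρ + ‖x - x'‖ := by
      rw [add_comm]
      exact norm_sub_le_norm_sub_add_norm_sub x x' x₀
    have h3 : κ * ‖e‖ * ‖x - x₀‖ ≤ κ * ‖e‖ * (ρ + ‖x - x'‖) := by gcongr
    linarith
  have hC₃ε : (K + ‖q‖ + κ * ‖e‖) * ‖x - x'‖ ≤ C₃ * ε := by
    calc (K + ‖q‖ + κ * ‖e‖) * ‖x - x'‖ ≤ (K + ‖q‖ + ‖e‖) * (C₂ * ε) := by gcongr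
      _ = C₃ * ε := by rw [hC₃]; ring
  have hρr : ρ < r / 2 := by
    by_contra! hρr
    have h1 := hmle x' hx'
    have h2 := hWK x hx x' hx'
    have h3 : β / 2 * (c * ρ ^ 2) ≤ 2 * (κ * ‖e‖ * ρ) + C₃ * ε := by
      simp only [φ₁] at hge
      linarith
    have h4 : β / 2 * c * (r / 2) = κ * (2 * ‖e‖ + 1) := by
      calc β / 2 * c * (r / 2) = β * r * c / 4 := by ring
        _ = _ := by rw [hβr, hC₁]; field_simp
    have h5 : κ * (2 * ‖e‖ + 1) * ρ ≤ β / 2 * (c * ρ ^ 2) := by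
      rw [← h4]
      calc β / 2 * c * (r / 2) * ρ ≤ β / 2 * c * ρ * ρ := by gcongr
        _ = _ := by ring
    have h6 : κ * (r / 2) ≤ κ * ρ := by gcongr
    linarith [hε3.1]
  have hx'd : dist x' x₀ < r := by rw [dist_eq_norm]; linarith
  have hxd : dist x x₀ < r := by
    calc dist x x₀ ≤ dist x x' + dist x' x₀ := dist_triangle _ _ _
      _ < r / 2 + r / 2 := by
        rw [dist_eq_norm, dist_eq_norm]
        exact add_lt_add (hclose.trans_lt hε2.2) hρr
      _ = r := by ring
  -- The strict inequality for `W` is available only where `W` exceeds `d`, so this has to be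
  -- checked at the perturbed maximum point.
  have hgt : d x < W x := by
    have h1 := hdK x hx x' hx'
    have h2 : κ * ‖e‖ * ρ ≤ κ * ‖e‖ * 1 := by
      gcongr
      linarith [min_le_right r₁ 1]
    have h3 : 0 ≤ β / 2 * (c * ρ ^ 2) := by positivity
    simp only [φ₁] at hge
    linarith [hε3.2]
  set s := ε⁻¹ • A (x - x') with hs
  have hsn : ‖s‖ ≤ ‖A‖ * C₂ := by
    rw [hs, norm_smul, Real.norm_of_nonneg (inv_nonneg.2 hε.le), inv_mul_le_iff₀ hε]
    calc ‖A (x - x')‖ ≤ ‖A‖ * ‖x - x'‖ := A.le_opNorm _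
      _ ≤ ‖A‖ * (C₂ * ε) := by gcongr
      _ = ε * (‖A‖ * C₂) := by ring
  set b := β • A (x' - x₀) with hb
  have hbn : ‖b‖ ≤ C₁ * κ * ‖A‖ := by
    rw [hb, norm_smul, Real.norm_of_nonneg hβ0.le]
    calc β * ‖A (x' - x₀)‖ ≤ β * (‖A‖ * r) := by
          gcongr
          exact (A.le_opNorm _).trans (by gcongr; linarith)
      _ = β * r * ‖A‖ := by ring
      _ = _ := by rw [hβr]
  have hs1 : x ∈ frontier Ω → -(κ / 4) ≤ ⟪γ x, s⟫ := fun h =>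
    (hest x h hxd).2.2 x' hx' (hx'd.trans_le (min_le_left _ _)) ε hε
      (hclose.trans (by gcongr; exact le_max_right _ _))
  have hs2 : x' ∈ frontier Ω → ⟪γ x', s⟫ ≤ κ / 4 := fun h => by
    have := (hest x' h hx'd).2.2 x hx (hxd.trans_le (min_le_left _ _)) ε hε
      (by rw [norm_sub_rev]; exact hclose.trans (by gcongr; exact le_max_right _ _))
    rw [← neg_sub x x', map_neg, smul_neg, inner_neg_right] at this
    linarith
  -- The localizing gradient has the same form as the doubling gradient, with parameter β⁻¹ and
  -- centre `x₀`, so the same chart estimate applies.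
  have hb2 : x' ∈ frontier Ω → -(κ / 4) ≤ ⟪γ x', b⟫ := fun h => by
    have := (hest x' h hx'd).2.2 x₀ hx₀ (by simpa using hr₁) β⁻¹ (inv_pos.2 hβ0) (by
      rw [← div_eq_mul_inv, le_div_iff₀ hβ0]
      calc ρ * β ≤ β * r := by rw [mul_comm]; gcongr; linarith
        _ = C₁ * κ := hβr
        _ ≤ C₁ := mul_le_of_le_one_right hC₁0.le hκ1
        _ ≤ _ := le_max_left _ _)
    rwa [inv_inv] at this
  have hg₁ : HasGradientAt (φ₁ x') (s + q + κ • e) x :=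
    hasGradientAt_add (hasGradientAt_quadTest hchart.symm q ε x' x)
      (hasGradientAt_inner (κ • e) x₀ x)
  have hc₁ : ContDiff ℝ 1 (φ₁ x') :=
    (contDiff_quadTest A q ε x').add (contDiff_inner_sub (κ • e) x₀)
  have htest₁ : SubIneq Ω H γ g (-δ) x (s + q + κ • e) := by
    have := hW x hx hgt (φ₁ x') hc₁ fun z hz => by
      have h1 := hmx z hz x' hx'
      show W z - φ₁ x' z ≤ W x - φ₁ x' x
      linarith
    rwa [hg₁.gradient] at this
  have hH₁ : H x (s + q + κ • e) ≤ -δ := by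
    rcases mem_or_mem_frontier hx with h | h
    · exact htest₁.1 h
    · refine (htest₁.2 h).resolve_right fun hle => ?_
      obtain ⟨h1, h2, -⟩ := hest x h hxd
      rw [inner_add_right, inner_add_right, real_inner_smul_right (γ x) e] at hle
      have h4 := hs1 h
      have h5 := (abs_le.1 h2).1
      have h6 : κ * 1 ≤ κ * ⟪γ x, e⟫ := by gcongr
      linarith
  let φ₃ : EuclideanSpace ℝ (Fin n) → ℝ := fun z' => -1 * (quadTest A q ε z' x + φ₂ z')
  have hquad_symm : (fun z' => quadTest A q ε z' x) = quadTest A (-q) ε x := by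
    funext z
    simp only [quadTest]
    rw [← neg_sub z x, map_neg, inner_neg_neg, inner_neg_right, inner_neg_left]
  have hc₃ : ContDiff ℝ 1 φ₃ := by
    refine contDiff_const.mul (ContDiff.add ?_ (contDiff_quadTest A (κ • e) β⁻¹ x₀))
    rw [hquad_symm]
    exact contDiff_quadTest A (-q) ε x
  have hg₃ : HasGradientAt φ₃ (s + q - κ • e - b) x' := by
    have := hasGradientAt_const_mul (-1) (hasGradientAt_add
      (hasGradientAt_quadTest_left hchart.symm q ε x' x)
      (hasGradientAt_quadTest hchart.symm (κ • e) β⁻¹ x₀ x'))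
    convert! this using 1
    rw [inv_inv, ← hs, ← hb, neg_one_smul]
    abel
  have htest₃ := hd x' hx' φ₃ hc₃ fun z' hz' => by
    have h1 := hmx x hx z' hz'
    show d x' - φ₃ x' ≤ d z' - φ₃ z'
    simp only [φ₁, φ₃] at h1 ⊢
    linarith
  rw [hg₃.gradient] at htest₃
  -- On the frontier the errors from `s`, `q` and `b` total at most 3κ/4, whereas the tilt lowers
  -- the product with γ by at least κ; hence it is below `g x'`.
  have hH₃ : 0 ≤ H x' (s + q - κ • e - b) := by
    rcases mem_or_mem_frontier hx' with h | h
    · exact htest₃.1 h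
    · refine (htest₃.2 h).resolve_right fun hle => ?_
      obtain ⟨h1, h2, -⟩ := hest x' h hx'd
      rw [inner_sub_right, inner_sub_right, inner_add_right, real_inner_smul_right (γ x') e] at hle
      have h4 := hs2 h
      have h5 := (abs_le.1 h2).2
      have h6 : κ * 1 ≤ κ * ⟪γ x', e⟫ := by gcongr
      have h7 := hb2 h
      linarith
  have hκn : ‖κ • e‖ = κ * ‖e‖ := by rw [norm_smul, Real.norm_of_nonneg hκ.le]
  have hC₁κ : C₁ * κ * ‖A‖ ≤ C₁ * ‖A‖ := by
    gcongr
    exact mul_le_of_le_one_right hC₁0.le hκ1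
  have h1 := hmod x hx x' hx' (s + q + κ • e) (s + q - κ • e - b)
    (by
      have h1 : ‖s + q + κ • e‖ ≤ ‖s‖ + ‖q‖ + ‖κ • e‖ := norm_add₃_le
      rw [hκn] at h1
      have : 0 ≤ C₁ * ‖A‖ := by positivity
      linarith)
    (by
      have h1 : ‖s + q - κ • e - b‖ ≤ ‖s‖ + ‖q‖ + ‖κ • e‖ + ‖b‖ :=
        (norm_sub_le _ _).trans (add_le_add_left ((norm_sub_le _ _).trans
          (add_le_add_left (norm_add_le _ _) _)) _)
      rw [hκn] at h1
      linarith)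
    (by rw [dist_eq_norm]; exact hclose.trans_lt hε2.1)
    (by
      have h1 : s + q + κ • e - (s + q - κ • e - b) = κ • e + κ • e + b := by abel
      rw [h1]
      have h2 : ‖κ • e + κ • e + b‖ ≤ ‖κ • e‖ + ‖κ • e‖ + ‖b‖ := norm_add₃_le
      rw [hκn] at h2
      linarith)
  linarith [(abs_lt.1 h1).1]

end

section

/-! ### Characterization of the Aubry set by loops -/

variable {Ω : Set (EuclideanSpace ℝ (Fin n))}
    {H : EuclideanSpace ℝ (Fin n) → EuclideanSpace ℝ (Fin n) → ℝ}
    {γ : EuclideanSpace ℝ (Fin n) → EuclideanSpace ℝ (Fin n)} {g : EuclideanSpace ℝ (Fin n) → ℝ}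
    {d W φ : EuclideanSpace ℝ (Fin n) → ℝ} {y : EuclideanSpace ℝ (Fin n)}

/-- If the infimum over long loops were positive, maximizing `S t x - δ * t` over `t` in `[0, τ]`
would give a function that is a strict subsolution wherever it exceeds `d`, yet is positive at `y`,
where `d` vanishes. -/
lemma NeumannData.minAction_self_nonpos (D : NeumannData Ω H γ g)
    (hc : criticalValue Ω H γ g = 0) (hy : y ∈ closure Ω) (hdy : d y = 0)
    (hdL : ∃ K ≥ 0, ∀ x ∈ closure Ω, ∀ x' ∈ closure Ω, d x - d x' ≤ K * ‖x - x'‖)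
    (hdmax : ∀ v, UpperSemicontinuousOn v (closure Ω) → BddAbove (v '' closure Ω) →
      SubTest Ω H γ g 0 v → ∀ x ∈ closure Ω, v x - v y ≤ d x)
    (hd : SuperTest Ω H γ g 0 d) {τ : ℝ} (hτ : 0 < τ) : minAction Ω H γ g y τ y ≤ 0 := by
  by_contra! hpos
  obtain ⟨Kd, hKd0, hKd⟩ := hdL
  obtain ⟨KS, hKS0, hKS⟩ := D.exists_lipschitz_minAction hc hy
  set S : ℝ → EuclideanSpace ℝ (Fin n) → ℝ := minAction Ω H γ g y with hS
  -- Half of the assumed positive value is spent on the discount, so that the maximum at `y` remains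
  -- at least `S τ y / 2`.
  set δ := S τ y / (2 * τ) with hδ
  have hδ0 : 0 < δ := by positivity
  have hex : ∀ x ∈ closure Ω, ∃ t ∈ Icc 0 τ, ∀ t' ∈ Icc 0 τ, S t' x - δ * t' ≤ S t x - δ * t := by
    intro x hx
    have h1 : UpperSemicontinuousOn (fun t => S t x + -(δ * t)) (Icc 0 τ) :=
      ((D.upperSemicontinuous_minAction hc hy hx).upperSemicontinuousOn _).add
        (Continuous.continuousOn (by fun_prop)).upperSemicontinuousOn
    obtain ⟨t, ht, hm⟩ := UpperSemicontinuousOn.exists_isMaxOn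
        (nonempty_Icc.2 hτ.le) isCompact_Icc h1
    exact ⟨t, ht, fun t' ht' => hm ht'⟩
  choose! θ hθ hθmax using hex
  set W : EuclideanSpace ℝ (Fin n) → ℝ := fun x => S (θ x) x - δ * θ x with hW
  have hWK : ∀ x ∈ closure Ω, ∀ x' ∈ closure Ω, W x - W x' ≤ KS * ‖x - x'‖ := by
    intro x hx x' hx'
    have h1 := hθmax x' hx' (θ x) (hθ x hx)
    have h2 := hKS (θ x) x hx x' hx'
    simp only [hW]
    linarith
  have hS0 : ∀ x ∈ closure Ω, S 0 x ≤ d x := by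
    intro x hx
    have hL := continuousOn_of_lipschitz (hKS 0)
    have h1 := hdmax (S 0) hL.upperSemicontinuousOn (D.isCompact.image_of_continuousOn hL).bddAbove
      (D.subTest_minAction_zero hc hy) x hx
    linarith [D.minAction_zero_self_le hc hy]
  have hle := D.le_of_strict (W := W) (d := d) (K := max Kd KS) (le_max_of_le_left hKd0) hδ0
    (fun x hx x' hx' => (hWK x hx x' hx').trans (by gcongr; exact le_max_right _ _))
    (fun x hx x' hx' => (hKd x hx x' hx').trans (by gcongr; exact le_max_left _ _))
    (fun x hx hlt φ hφ hmax => by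
      -- If the maximum were at time 0, the value of `W` at `x` would be `S 0 x ≤ d x`. A positive
      -- maximizer leaves room to shorten the remaining time by `h` in the dynamic programming
      -- inequality.
      have hθ0 : 0 < θ x := by
        refine (hθ x hx).1.lt_of_ne fun h0 => ?_
        have h1 := hS0 x hx
        simp only [hW, ← h0] at hlt
        linarith
      refine D.subIneq_of_dynamic hθ0 hx (fun x' hx' h c hh hhθ hr => ?_) hφ hmax
      have h1 := D.minAction_le_add hc hy hx' (σ := θ x - h) (τ := θ x) (by linarith) hr
      have h2 := hθmax x' hx' (θ x - h) ⟨by linarith, by linarith [(hθ x hx).2]⟩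
      simp only [hW, hS] at h2 ⊢
      linarith) hd y hy
  have h1 := hθmax y hy τ ⟨hτ.le, le_rfl⟩
  have h2 : δ * τ = S τ y / 2 := by rw [hδ]; field_simp
  simp only [hW] at hle
  linarith

lemma abs_deriv_norm_sub_le {η : ℝ → EuclideanSpace ℝ (Fin n)} {η' : EuclideanSpace ℝ (Fin n)}
    {N' s : ℝ} (y : EuclideanSpace ℝ (Fin n)) (hη : HasDerivAt η η' s)
    (hN : HasDerivAt (fun t => ‖η t - y‖) N' s) : |N'| ≤ ‖η'‖ := by
  have h1 := (hasDerivAt_iff_tendsto_slope.1 hN).abs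
  have h2 := (hasDerivAt_iff_tendsto_slope.1 hη).norm
  refine le_of_tendsto_of_tendsto' h1 h2 fun t => ?_
  rw [slope_def_field, slope_def_module, norm_smul, norm_inv, abs_div, div_eq_inv_mul,
    Real.norm_eq_abs]
  gcongr
  exact (abs_norm_sub_norm_le _ _).trans (by rw [sub_sub_sub_cancel_right])

/-- Along an arc that stays where `φ` is a strict subsolution, the action exceeds the decrease of
`φ` by an amount controlled by the elapsed time and the distance travelled. -/
lemma NeumannData.sub_add_le_action (D : NeumannData Ω H γ g) (hφ : ContDiff ℝ 1 φ) {c : ℝ}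
    (hc : 0 < c) (hstrict : ∀ z ∈ closure Ω, dist z y < c →
      (∀ q, ‖q - ∇ φ z‖ ≤ c → H z q ≤ -c) ∧ (z ∈ frontier Ω → ⟪γ z, ∇ φ z⟫ ≤ g z - c))
    {c' G : ℝ} (hG : ∀ z ∈ frontier Ω, ‖γ z‖ ≤ G) (hc' : 0 ≤ c') (hc'1 : c' ≤ c)
    (hc'G : c' * G ≤ c)
    {T t : ℝ} {η v : ℝ → EuclideanSpace ℝ (Fin n)} {l : ℝ → ℝ} (h : IsArc Ω H γ T η v l)
        (ht : 0 ≤ t) (htT : t ≤ T)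
    (hη0 : η 0 = y) (hηy : ∀ s ∈ Icc 0 t, dist (η s) y < c) :
    φ y - φ (η t) + c' * dist (η t) y + c * t ≤ ∫ s in (0 : ℝ)..t, runningCost H g η v l s := by
  have hsub : uIcc 0 t ⊆ uIcc 0 T := by
    rw [uIcc_of_le ht, uIcc_of_le (ht.trans htT)]
    exact Icc_subset_Icc le_rfl htT
  have hac := h.ac.mono hsub
  obtain ⟨Kφ, hKφ⟩ := hφ.contDiffOn.exists_lipschitzOnWith one_ne_zero
    (convex_closedBall y c) (isCompact_closedBall y c)
  have hball : ∀ s ∈ uIcc 0 t, η s ∈ Metric.closedBall y c := fun s hs => by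
    rw [uIcc_of_le ht] at hs
    exact (hηy s hs).le
  have hF : AbsolutelyContinuousOnInterval (fun s => φ (η s)) 0 t :=
    absolutelyContinuousOnInterval_of_dist_le hac fun s hs s' hs' =>
      hKφ.dist_le_mul _ (hball s hs) _ (hball s' hs')
  have hN : AbsolutelyContinuousOnInterval (fun s => ‖η s - y‖) 0 t :=
    absolutelyContinuousOnInterval_of_dist_le (C := 1) hac fun s _ s' _ => by
      rw [one_mul, Real.dist_eq, dist_eq_norm]
      exact (abs_norm_sub_norm_le _ _).trans (by rw [sub_sub_sub_cancel_right])
  have hM := hF.sub (hN.const_mul c')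
  have hr : IntervalIntegrable (runningCost H g η v l) volume 0 t :=
    (h.intervalIntegrable_running D.continuousOn_g (ht.trans htT)).mono_set hsub
  have hderiv : ∀ᵐ s : ℝ, s ∈ Ioo 0 t →
      -deriv ((fun s => φ (η s)) - fun s => c' * ‖η s - y‖) s ≤ runningCost H g η v l s - c := by
    filter_upwards [hN.ae_differentiableAt, h.ae_regular] with s hNd hreg hs
    have hsI := Ioo_subset_Icc_self hs
    obtain ⟨hL, hl0, hlz, η', hη', hdyn⟩ := hreg ⟨hs.1, hs.2.trans_le htT⟩
    have hNd := (hNd (by rwa [uIcc_of_le ht])).hasDerivAt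
    have hFd : HasDerivAt (fun s => φ (η s)) ⟪∇ φ (η s), η'⟫ s := by
      have := (contDiff_hasGradientAt hφ (η s)).hasFDerivAt.comp_hasDerivAt s hη'
      rwa [InnerProductSpace.toDual_apply_apply] at this
    rw [(hFd.sub (hNd.const_mul c')).deriv]
    have hN' := (abs_le.1 (abs_deriv_norm_sub_le y hη' hNd)).2
    have hsX := h.mem_closure s ⟨hs.1.le, hs.2.le.trans htT⟩
    obtain ⟨h1, h2⟩ := hstrict _ hsX (hηy s hsI)
    set p := ∇ φ (η s) with hp
    -- Shifting the gradient by length `c` against the velocity keeps `H ≤ -c` and gains `c * ‖v s‖`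
    -- in the Fenchel inequality; for zero velocity the shift is zero by the convention on division.
    have hv : ‖(c / ‖v s‖) • v s‖ ≤ c ∧ ⟪v s, (c / ‖v s‖) • v s⟫ = c * ‖v s‖ := by
      rcases eq_or_ne (v s) 0 with h0 | h0
      · simp [h0, hc.le]
      · have : ‖v s‖ ≠ 0 := norm_ne_zero_iff.2 h0
        rw [norm_smul, norm_div, norm_norm, Real.norm_of_nonneg hc.le, real_inner_smul_right,
          real_inner_self_eq_norm_sq]
        constructor
        · rw [div_mul_cancel₀ _ this]
        · field_simp
    have h3 := h1 (p - (c / ‖v s‖) • v s) (by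
      rw [sub_sub_cancel_left, norm_neg]
      exact hv.1)
    have h4 := inner_sub_le_toReal_lagrangian hL (p - (c / ‖v s‖) • v s)
    rw [inner_neg_left, inner_sub_right, hv.2] at h4
    have h5 : ⟪v s, p⟫ = ⟪p, η'⟫ + l s * ⟪γ (η s), p⟫ := by
      rw [← hdyn, inner_add_left η' (l s • γ (η s)) p, real_inner_smul_left, real_inner_comm η' p]
    have h6 : l s * ⟪γ (η s), p⟫ ≤ l s * (g (η s) - c) ∧ c' * (l s * ‖γ (η s)‖) ≤ l s * c := by
      rcases mem_or_mem_frontier hsX with hΩ | hΓ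
      · simp [hlz hΩ]
      · refine ⟨mul_le_mul_of_nonneg_left (h2 hΓ) hl0, ?_⟩
        calc c' * (l s * ‖γ (η s)‖) ≤ c' * (l s * G) := by gcongr; exact hG _ hΓ
          _ = l s * (c' * G) := by ring
          _ ≤ l s * c := by gcongr
    have h7 : ‖η'‖ ≤ ‖v s‖ + l s * ‖γ (η s)‖ := by
      rw [eq_sub_of_add_eq hdyn]
      refine (norm_sub_le _ _).trans ?_
      rw [norm_smul, Real.norm_of_nonneg hl0]
    have h8 : c' * ‖η'‖ ≤ c * ‖v s‖ + l s * c := by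
      calc c' * ‖η'‖ ≤ c' * (‖v s‖ + l s * ‖γ (η s)‖) := by gcongr
        _ = c' * ‖v s‖ + c' * (l s * ‖γ (η s)‖) := by ring
        _ ≤ _ := add_le_add (by gcongr) h6.2
    have h9 : c' * deriv (fun t => ‖η t - y‖) s ≤ c' * ‖η'‖ := by gcongr
    simp only [runningCost]
    -- The gains `c * ‖v s‖` and `l s * c` together pay for `c'` times the speed, and the strictness
    -- of `H` supplies the remaining `c` per unit time.
    linarith [h6.1]
  have hint : (∫ s in (0 : ℝ)..t, -deriv ((fun s => φ (η s)) - fun s => c' * ‖η s - y‖) s) ≤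
      ∫ s in (0 : ℝ)..t, (runningCost H g η v l s - c) := by
    refine intervalIntegral.integral_mono_ae_restrict ht hM.intervalIntegrable_deriv.neg
      (hr.sub intervalIntegrable_const) ?_
    rw [← restrict_Ioo_eq_restrict_Icc, EventuallyLE, ae_restrict_iff' measurableSet_Ioo]
    exact hderiv
  rw [intervalIntegral.integral_neg, hM.integral_deriv_eq_sub,
    intervalIntegral.integral_sub hr intervalIntegrable_const,
        intervalIntegral.integral_const] at hint
  simp only [Pi.sub_apply, hη0, sub_self, norm_zero, mul_zero, sub_zero, smul_eq_mul] at hint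
  rw [dist_eq_norm]
  linarith

/-- A loop at `y` of duration larger than `τ` costs a fixed positive amount if some subsolution is
smooth and strict near `y`. -/
lemma NeumannData.exists_le_of_reach_self (D : NeumannData Ω H γ g) (hy : y ∈ closure Ω)
    (hWc : ContinuousOn W (closure Ω)) (hW : SubTest Ω H γ g 0 W) (hφ : ContDiff ℝ 1 φ) {c : ℝ}
    (hc : 0 < c) (hstrict : ∀ z ∈ closure Ω, dist z y < c → W z = φ z ∧
      (∀ q, ‖q - ∇ φ z‖ ≤ c → H z q ≤ -c) ∧ (z ∈ frontier Ω → ⟪γ z, ∇ φ z⟫ ≤ g z - c))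
    {τ : ℝ} (hτ : 0 < τ) :
    ∃ ε > 0, ∀ t b, τ < t → Reach Ω H γ g y y t b → ε ≤ b := by
  obtain ⟨G, hG, hbd⟩ := D.exists_frontier_bound
  obtain ⟨K, hK0, hK⟩ := D.exists_lipschitz 0
  have hWL := hK W ⟨hWc.upperSemicontinuousOn, (D.isCompact.image_of_continuousOn hWc).bddAbove, hW⟩
  set c' := c / (1 + G) with hc'
  have hc'0 : 0 < c' := by positivity
  have hc'1 : c' ≤ c := div_le_self hc.le (by linarith)
  have hc'G : c' * G ≤ c := by
    rw [hc', div_mul_eq_mul_div, div_le_iff₀ (by positivity)]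
    gcongr
    linarith
  refine ⟨min (c * τ) (c' * (c / 2)), by positivity, fun t b ht hr => ?_⟩
  obtain ⟨ht0, η, v, l, ha, hη0, hηt, rfl⟩ := hr
  have hηc := ha.continuousOn ht0
  have hdc : ContinuousOn (fun s => dist (η s) y) (Icc 0 t) :=
      (continuous_id.dist continuous_const).comp_continuousOn hηc
  -- The loop is cut at time τ or at its first arrival at distance `c / 2` from `y`, whichever comes
  -- first.
  obtain ⟨t₁, ht₁0, ht₁τ, hin, hout⟩ : ∃ t₁, 0 ≤ t₁ ∧ t₁ ≤ τ ∧
      (∀ s ∈ Icc 0 t₁, dist (η s) y < c) ∧ (t₁ = τ ∨ c / 2 ≤ dist (η t₁) y) := by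
    by_cases hstay : ∀ s ∈ Icc 0 τ, dist (η s) y < c / 2
    · exact ⟨τ, hτ.le, le_rfl, fun s hs => (hstay s hs).trans (by linarith), Or.inl rfl⟩
    · push Not at hstay
      obtain ⟨s₁, hs₁, hs₁d⟩ := hstay
      have hsub : Icc 0 s₁ ⊆ Icc 0 t := Icc_subset_Icc le_rfl (hs₁.2.trans ht.le)
      have hcl : IsCompact {s ∈ Icc 0 s₁ | c / 2 ≤ dist (η s) y} :=
        isCompact_Icc.of_isClosed_subset
          (isClosed_Icc.isClosed_le continuousOn_const (hdc.mono hsub)) fun s hs => hs.1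
      obtain ⟨t₁, ht₁, hmin⟩ := hcl.exists_isLeast ⟨s₁, ⟨hs₁.1, le_rfl⟩, hs₁d⟩
      have hle : dist (η t₁) y ≤ c / 2 := by
        by_contra! hgt
        obtain ⟨s, hs, hsd⟩ := intermediate_value_Icc ht₁.1.1
          (hdc.mono (Icc_subset_Icc le_rfl (ht₁.1.2.trans (hs₁.2.trans ht.le))))
          (show c / 2 ∈ Icc (dist (η 0) y) (dist (η t₁) y) from
            ⟨by rw [hη0, dist_self]; positivity, hgt.le⟩)
        have hsd : dist (η s) y = c / 2 := hsd
        have h1 := hmin ⟨⟨hs.1, hs.2.trans ht₁.1.2⟩, hsd.ge⟩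
        rw [le_antisymm hs.2 h1] at hsd
        linarith
      refine ⟨t₁, ht₁.1.1, ht₁.1.2.trans hs₁.2, fun s hs => ?_, Or.inr ht₁.2⟩
      rcases hs.2.eq_or_lt with h | h
      · rw [h]; linarith
      · by_contra! hge
        exact (hmin ⟨⟨hs.1, hs.2.trans ht₁.1.2⟩, by linarith⟩).not_gt h
  have ht₁t : t₁ ≤ t := ht₁τ.trans ht.le
  have h1 := D.sub_add_le_action hφ hc (fun z hz hzc => (hstrict z hz hzc).2)
    (fun z hz => (hbd z hz).2) hc'0.le hc'1 hc'G ha ht₁0 ht₁t hη0 hin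
  -- After the cut only the subsolution inequality for `W` is used. Since `W` and φ agree near `y`,
  -- the increments over the two pieces cancel around the loop and only the gain of the first piece
  -- remains.
  have h2 := D.sub_le_action hK0 hWL hW ha ht₁0 ht₁t le_rfl
  have hri := ha.intervalIntegrable_running D.continuousOn_g ht0
  have h3 := intervalIntegral.integral_add_adjacent_intervals
    (hri.mono_set (by
      rw [uIcc_of_le ht₁0, uIcc_of_le ht0]; exact Icc_subset_Icc le_rfl ht₁t :
          uIcc 0 t₁ ⊆ uIcc 0 t))
    (hri.mono_set (by
      rw [uIcc_of_le ht₁t, uIcc_of_le ht0]; exact Icc_subset_Icc ht₁0 le_rfl :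
          uIcc t₁ t ⊆ uIcc 0 t))
  have h4 : W (η t₁) = φ (η t₁) :=
    (hstrict _ (ha.mem_closure t₁ ⟨ht₁0, ht₁t⟩) (hin t₁ ⟨ht₁0, le_rfl⟩)).1
  have h5 : W y = φ y := (hstrict y hy (by simpa using hc)).1
  rw [hηt] at h2
  have h6 : min (c * τ) (c' * (c / 2)) ≤ c' * dist (η t₁) y + c * t₁ := by
    rcases hout with h | h
    · rw [h]
      have : 0 ≤ c' * dist (η τ) y := by positivity
      linarith [min_le_left (c * τ) (c' * (c / 2))]
    · have h7 : c' * (c / 2) ≤ c' * dist (η t₁) y := by gcongr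
      have : 0 ≤ c * t₁ := by positivity
      linarith [min_le_right (c * τ) (c' * (c / 2))]
  linarith

/-- A critical subsolution takes the same value at both ends of a loop, so no loop has negative cost
and the infimum is zero exactly when cheap loops exist. Infinite actions play no role, and an arc on
a bounded interval extends to all times by resting. -/
lemma NeumannData.sInf_action_eq_zero_iff (D : NeumannData Ω H γ g)
    (hc : criticalValue Ω H γ g = 0) {τ : ℝ} (hτ : 0 < τ) (y : EuclideanSpace ℝ (Fin n)) :
    sInf {e : EReal | ∃ (t : ℝ) (η v : ℝ → EuclideanSpace ℝ (Fin n)) (l : ℝ → ℝ),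
        τ < t ∧ IsSkorokhodTriple Ω γ η v l ∧ η 0 = y ∧ η t = y ∧ e = action H g η v l t} = 0 ↔
      ∀ ε > 0, ∃ t b, τ < t ∧ b < ε ∧ Reach Ω H γ g y y t b := by
  obtain ⟨u, hu⟩ := D.exists_critical_subsolution hc
  obtain ⟨K, hK0, hK⟩ := D.exists_lipschitz 0
  have hreach : ∀ t, τ < t → ∀ η v l, IsSkorokhodTriple Ω γ η v l → η 0 = y → η t = y →
      action H g η v l t = ⊤ ∨ ∃ b : ℝ, action H g η v l t = b ∧ Reach Ω H γ g y y t b := by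
    intro t ht η v l hS h0 h1
    rw [action]
    split_ifs with h
    · exact Or.inr ⟨_, rfl, (hτ.trans ht).le, η, v, l, hS.isArc (hτ.trans ht) h.1 h.2, h0, h1, rfl⟩
    · exact Or.inl rfl
  constructor
  · intro h ε hε
    have h1 : sInf {e : EReal | ∃ (t : ℝ) (η v : ℝ → EuclideanSpace ℝ (Fin n)) (l : ℝ → ℝ),
        τ < t ∧ IsSkorokhodTriple Ω γ η v l ∧ η 0 = y ∧ η t = y ∧ e = action H g η v l t} <
        (ε : EReal) := by
      rw [h]; exact_mod_cast hε
    obtain ⟨_, ⟨t, η, v, l, ht, hS, h0, h1, rfl⟩, hlt⟩ := sInf_lt_iff.1 h1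
    rcases hreach t ht η v l hS h0 h1 with h2 | ⟨b, h2, hr⟩
    · rw [h2] at hlt
      exact absurd hlt not_top_lt
    · rw [h2] at hlt
      exact ⟨t, b, ht, EReal.coe_lt_coe_iff.1 hlt, hr⟩
  · intro h
    refine le_antisymm ?_ (le_sInf ?_)
    · refine EReal.le_of_forall_lt_iff_le.1 fun ε hε => ?_
      obtain ⟨t, b, ht, hb, -, η, v, l, ha, h0, h1, rfl⟩ := h ε (by exact_mod_cast hε)
      obtain ⟨η₁, v₁, l₁, hS, h2, h3, h4⟩ := ha.exists_isSkorokhodTriple D (hτ.trans ht)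
      refine le_trans (sInf_le ⟨t, η₁, v₁, l₁, ht, hS, h2.trans h0, h3.trans h1, rfl⟩) ?_
      rw [h4]
      exact_mod_cast hb.le
    · rintro _ ⟨t, η, v, l, ht, hS, h0, h1, rfl⟩
      rcases hreach t ht η v l hS h0 h1 with h2 | ⟨b, h2, hr⟩
      · rw [h2]; exact le_top
      · rw [h2]
        have := D.sub_le_of_reach hK0 (hK u hu) hu.2.2 hr
        rw [sub_self] at this
        exact_mod_cast this

theorem NeumannData.mem_aubrySet_iff (D : NeumannData Ω H γ g)
    (hc : criticalValue Ω H γ g = 0) {τ : ℝ} (hτ : 0 < τ) (hy : y ∈ closure Ω) :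
    y ∈ aubrySet Ω H γ g ↔ ∀ ε > 0, ∃ t b, τ < t ∧ b < ε ∧ Reach Ω H γ g y y t b := by
  obtain ⟨d, hd, hdy, ⟨K, hK0, hK⟩, hdsub, hdmax⟩ := D.exists_dist hc hy
  have hdc := continuousOn_of_lipschitz hK
  have hbdd := D.isCompact.image_of_continuousOn hdc
  constructor
  · rintro ⟨-, w, hw, -, hsup⟩ ε hε
    have hwd : ∀ x ∈ closure Ω, w x = d x := fun x hx =>
      EReal.coe_eq_coe_iff.1 ((hw x hx).symm.trans (hd x hx))
    have hsuper : SuperTest Ω H γ g 0 d :=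
      ((isSupersolution_iff (hdc.congr hwd)).1 hsup).2.congr hwd
    have h1 := D.minAction_self_nonpos hc hy hdy ⟨K, hK0, hK⟩ hdmax hsuper hτ
    obtain ⟨b, ⟨t, ht, hr⟩, hb⟩ := exists_lt_of_csInf_lt (D.nonempty_costs hy τ hy)
      (h1.trans_lt hε)
    exact ⟨t, b, ht, hb, hr⟩
  · intro h
    refine ⟨hy, d, hd, (isSubsolution_iff hdc.upperSemicontinuousOn).2 ⟨hbdd.bddAbove, hdsub⟩,
      (isSupersolution_iff hdc).2 ⟨hbdd.bddBelow, fun x hx φ hφ hm => ?_⟩⟩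
    have key : ¬(H x (∇ φ x) < 0 ∧ (x ∈ frontier Ω → ⟪γ x, ∇ φ x⟫ < g x)) := by
      rintro ⟨hH, hB⟩
      rcases eq_or_ne x y with rfl | hne
      -- At `y` itself maximality gives no contradiction, since raising `d` there also changes the
      -- normalization; the cheap loops are used instead.
      · obtain ⟨W, φ', hWc, hW, -, -, hφ', c, hc0, hstrict⟩ :=
          D.exists_bump hdc hdsub hx hφ hm hH hB one_pos
        obtain ⟨ε, hε, hle⟩ := D.exists_le_of_reach_self hx hWc hW hφ' hc0 hstrict hτ
        obtain ⟨t, b, ht, hb, hr⟩ := h ε hε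
        exact (hle t b ht hr).not_gt hb
      -- The bump is confined to the ball of radius `dist y x`, so `W y = d y = 0` and `W`
      -- contradicts the maximality of `d` at `x`.
      · obtain ⟨W, φ', hWc, hW, hlt, hfar, -⟩ :=
          D.exists_bump hdc hdsub hx hφ hm hH hB (dist_pos.2 hne.symm)
        have h1 := hdmax W hWc.upperSemicontinuousOn
          (D.isCompact.image_of_continuousOn hWc).bddAbove hW x hx
        rw [hfar y hy le_rfl, hdy] at h1
        linarith
    refine ⟨fun hΩ => ?_, fun hΓ => ?_⟩
    · by_contra! hH
      exact key ⟨hH, fun hΓ => absurd hΩ (notMem_of_mem_frontier D.isOpen hΓ)⟩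
    · by_contra! hcon
      exact key ⟨hcon.1, fun _ => hcon.2⟩

end

end NeumannHJ

end

theorem theorem6p3 {n : ℕ} (Ω : Set (EuclideanSpace ℝ (Fin n)))
    (H : EuclideanSpace ℝ (Fin n) → EuclideanSpace ℝ (Fin n) → ℝ)
    (γ : EuclideanSpace ℝ (Fin n) → EuclideanSpace ℝ (Fin n))
    (g : EuclideanSpace ℝ (Fin n) → ℝ)
    (hΩ_open : IsOpen Ω) (hΩ_conn : IsConnected Ω) (hΩ_bdd : Bornology.IsBounded Ω)
    (hΩ_C1 : NeumannHJ.HasC1Boundary Ω)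
    (hH_cont : ContinuousOn (fun z : EuclideanSpace ℝ (Fin n) × EuclideanSpace ℝ (Fin n) =>
      H z.1 z.2) (closure Ω ×ˢ Set.univ))
    (hγ_cont : ContinuousOn γ (frontier Ω))
    (hg_cont : ContinuousOn g (frontier Ω))
    (hH_convex : ∀ x ∈ closure Ω, ConvexOn ℝ Set.univ (H x))
    (hH_coercive : ∀ x ∈ closure Ω,
      Filter.Tendsto (H x) (Bornology.cobounded (EuclideanSpace ℝ (Fin n))) Filter.atTop)
    (hγ_oblique : NeumannHJ.IsOblique Ω γ)
    (hc : NeumannHJ.criticalValue Ω H γ g = 0)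
    (τ : ℝ) (hτ : 0 < τ) (y : EuclideanSpace ℝ (Fin n)) (hy : y ∈ closure Ω) :
    y ∈ NeumannHJ.aubrySet Ω H γ g ↔
      sInf {e : EReal | ∃ (t : ℝ) (η v : ℝ → EuclideanSpace ℝ (Fin n)) (l : ℝ → ℝ),
        τ < t ∧ NeumannHJ.IsSkorokhodTriple Ω γ η v l ∧ η 0 = y ∧ η t = y ∧
          e = NeumannHJ.action H g η v l t} = 0 := by
  have D : NeumannHJ.NeumannData Ω H γ g :=
    ⟨hΩ_open, hΩ_conn, hΩ_bdd, hΩ_C1, hH_cont, hγ_cont, hg_cont, hH_convex, hH_coercive, hγ_oblique⟩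
  rw [D.mem_aubrySet_iff hc hτ hy, D.sInf_action_eq_zero_iff hc hτ y]
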